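/- Let $dA$ be Lebesgue measure on $\mathbb{C}$. A weight is a measurable function $w:\mathbb{C}\to\mathbb{R}$ with $w>0$ almost everywhere, and it is an $A_2$ weight if $$[w]_{A_2}^{class}:=\sup_{B}\Big(\frac1{|B|}\int_B w\,dA\Big)\Big(\frac1{|B|}\int_B w^{-1}\,dA\Big)<\infty ,$$ the supremum being taken over all discs $B\subset\mathbb{C}$. For $g\in C_0^\infty(\mathbb{C})$ (smooth, complex-valued, compactly supported) let $T$ be the Ahlfors–Beurling transform $$Tg(z)=\frac1\pi\,\mathrm{p.v.}\!\int_{\mathbb{C}}\frac{g(\zeta)}{(\zeta-z)^2}\,dA(\zeta)=\lim_{\varepsilon\to0^+}\frac1\pi\int_{|\zeta-z|>\varepsilon}\frac{g(\zeta)}{(\zeta-z)^2}\,dA(\zeta),\qquad z\in\mathbb{C}.$$ **Theorem.** There is an absolute constant $C$ such that for every $A_2$ weight $w$ the following holds: $C_0^\infty(\mathbb{C})\subset L^2(w\,dA)$, the limit defining $Tg(z)$ exists for every $g\in C_0^\infty(\mathbb{C})$ and every $z\in\mathbb{C}$, the operator $T$ extends from $C_0^\infty(\mathbb{C})$ in a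 unique way to a bounded linear operator on the complex space $L^2(w\,dA)$, and this extension satisfies $$\|T\|_{L^2(w\,dA)\to L^2(w\,dA)}\le C\,[w]_{A_2}^{class}.$$ -/

import Mathlib

open MeasureTheory Filter Topology
open scoped ENNReal ContDiff

noncomputable section

/-- The `A₂` characteristic of `w` on the plane: the supremum over all discs `B` of
`(1/|B| ∫_B w dA) * (1/|B| ∫_B w⁻¹ dA)`, with values in `[0, ∞]`. -/
def a2Characteristic (w : ℂ → ℝ) : ℝ≥0∞ :=
  ⨆ (x : ℂ) (R : ℝ) (_ : 0 < R),
    (⨍⁻ z in Metric.ball x R, ENNReal.ofReal (w z) ∂volume) *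
      (⨍⁻ z in Metric.ball x R, (ENNReal.ofReal (w z))⁻¹ ∂volume)

/-- An `A₂` weight: a measurable, almost everywhere positive function on the plane with
finite `A₂` characteristic (this forces `w` and `w⁻¹` to be locally integrable). -/
structure IsA2Weight (w : ℂ → ℝ) : Prop where
  aemeasurable : AEMeasurable w
  pos : ∀ᵐ z, 0 < w z
  finite : a2Characteristic w < ⊤

/-- The measure `w dA`, where `dA` is Lebesgue measure on the plane. -/
def weightMeasure (w : ℂ → ℝ) : Measure ℂ :=
  volume.withDensity fun z => ENNReal.ofReal (w z)

/-- The truncated integral `(1/π) ∫_{|ζ - z| > ε} g(ζ) / (ζ - z)² dA(ζ)`. -/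
def truncatedBeurling (g : ℂ → ℂ) (z : ℂ) (ε : ℝ) : ℂ :=
  (1 / (Real.pi : ℂ)) * ∫ ζ in {ζ : ℂ | ε < ‖ζ - z‖}, g ζ / (ζ - z) ^ 2

/-- The Ahlfors–Beurling transform of `g` at `z`: the principal value, i.e. the limit of the
truncated integrals as `ε → 0⁺` (meaningful where that limit exists). -/
def beurling (g : ℂ → ℂ) (z : ℂ) : ℂ :=
  limUnder (𝓝[>] (0 : ℝ)) (truncatedBeurling g z)

/-- `S` is the Ahlfors–Beurling transform as a bounded operator on `L²(w dA)`: every test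
function `φ ∈ C₀^∞` lies in `L²(w dA)`, its principal value integral exists at every point,
and `S φ` is given by it. -/
def IsBeurlingOperator (w : ℂ → ℝ)
    (S : Lp ℂ 2 (weightMeasure w) →L[ℂ] Lp ℂ 2 (weightMeasure w)) : Prop :=
  ∀ φ : ℂ → ℂ, ContDiff ℝ ∞ φ → HasCompactSupport φ →
    (∀ z, Tendsto (truncatedBeurling φ z) (𝓝[>] (0 : ℝ)) (𝓝 (beurling φ z))) ∧
    ∃ h : MemLp φ 2 (weightMeasure w),
      S (h.toLp φ) =ᵐ[weightMeasure w] beurling φ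

end

/-! The proof is a bilinear sparse domination, run on regularised kernels so that every integral
converges absolutely; all constants are uniform in the regularisation parameter `e`.

Replace `1/u` by `k(u) = ū / (|u|² + e²)`. Then `∂k = -k²` holds exactly, while `P = ∂̄k` is a
positive approximate identity of mass independent of `e`. So `k²` regularises the kernel `1/u²`, and
two integrations by parts (`integral_beurlingKernel_mul_conj`) show that convolution with `k²` and
convolution with `P` have the same `L²` norm. This gives the unweighted `L²` bound without the
Fourier transform. The kernels `k²` have the size and smoothness of `1/u²` uniformly in `e`, so the
Calderón–Zygmund decomposition gives weak type (1,1) (`exists_weak_type_regBeurling`).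

Weak type for the operator `T` and for the maximal function produces, inside each square `Q`,
disjoint subsquares `P` of total area at most `|Q|/2` such that `|T(f 1_{3Q})|` is at most a
multiple of the average of `|f|` over `3Q` off the subsquares, and exceeds `|T(f 1_{3P})|` by at
most such a multiple on each `P` (`exists_sparse_step`). Iteration reduces `∫ |Tf| g` to terms
"average of `|f|` on `3Q`, times `∫_Q g`". The `A₂` condition is applied once to each term and
bounds it by `[w]` times the integral, over `Q` minus its subsquares, of the product of two centred
maximal functions, one of `f` with respect to `w⁻¹ dA` and one of `g` with respect to `w dA`. These
sets are disjoint over all generations, so the sum is at most a multiple of `[w] ∫ M₁ M₂`.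
Cauchy–Schwarz and the maximal theorem finish the estimate with no further power of `[w]`, because
Besicovitch's covering theorem makes the maximal constant independent of the measure.

Testing with `g = |Tf| w` turns the bilinear bound into the norm bound. Cancellation of the kernel
identifies the limit `e → 0` with `π` times the principal value, Fatou's lemma transfers the
estimate, and density of test functions gives the extension and its uniqueness. -/

noncomputable section

open scoped ComplexConjugate NNReal

/-! ### Wirtinger calculus and the regularised kernels -/

/-- The real-linear map `v ↦ a v + b v̄`; `a` and `b` are the Wirtinger derivatives of a function
with this differential. -/
def wirtingerMap (a b : ℂ) : ℂ →L[ℝ] ℂ :=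
  a • (1 : ℂ →L[ℝ] ℂ) + b • (Complex.conjCLE : ℂ →L[ℝ] ℂ)

@[simp] lemma wirtingerMap_apply (a b v : ℂ) : wirtingerMap a b v = a * v + b * conj v := by
  simp [wirtingerMap]

/-- Integrating by parts in the direction `v` gives an identity of the shape `αv + βv̄ = 0`. Taking
`v = 1` and `v = i` forces `α = β = 0`, which separates the rule for `∂` from the rule for `∂̄`. -/
lemma integral_mul_wirtinger {f fa fb g ga gb : ℂ → ℂ}
    (hf : ∀ x, HasFDerivAt f (wirtingerMap (fa x) (fb x)) x)
    (hg : ∀ x, HasFDerivAt g (wirtingerMap (ga x) (gb x)) x)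
    (h : Integrable (fun x => f x * g x))
    (h1 : Integrable (fun x => fa x * g x)) (h2 : Integrable (fun x => fb x * g x))
    (h3 : Integrable (fun x => f x * ga x)) (h4 : Integrable (fun x => f x * gb x)) :
    ∫ x, f x * ga x = -∫ x, fa x * g x ∧ ∫ x, f x * gb x = -∫ x, fb x * g x := by
  have key : ∀ v : ℂ, (∫ x, f x * ga x) * v + (∫ x, f x * gb x) * conj v
      = -((∫ x, fa x * g x) * v + (∫ x, fb x * g x) * conj v) := by
    intro v
    have e1 : ∀ x, wirtingerMap (fa x) (fb x) v * g x
        = fa x * g x * v + fb x * g x * conj v := by intro x; simp; ring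
    have e2 : ∀ x, f x * wirtingerMap (ga x) (gb x) v
        = f x * ga x * v + f x * gb x * conj v := by intro x; simp; ring
    have := integral_bilinear_hasFDerivAt_right_eq_neg_left_of_integrable (μ := volume)
      (f := f) (g := g) (v := v) (B := ContinuousLinearMap.mul ℝ ℂ)
      (f' := fun x => wirtingerMap (fa x) (fb x)) (g' := fun x => wirtingerMap (ga x) (gb x))
      (by simp only [ContinuousLinearMap.mul_apply', e1]
          exact (h1.mul_const v).add (h2.mul_const _))
      (by simp only [ContinuousLinearMap.mul_apply', e2]
          exact (h3.mul_const v).add (h4.mul_const _))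
      (by simpa using h) (fun x _ => hf x) (fun x _ => hg x)
    simp only [ContinuousLinearMap.mul_apply', e1, e2] at this
    rw [integral_add (h1.mul_const v) (h2.mul_const _),
      integral_add (h3.mul_const v) (h4.mul_const _)] at this
    simpa only [integral_mul_const] using this
  have k1 := key 1
  have kI := key Complex.I
  simp only [map_one, mul_one, Complex.conj_I] at k1 kI
  have kI' : (∫ x, f x * ga x) - (∫ x, f x * gb x)
      = -((∫ x, fa x * g x) - (∫ x, fb x * g x)) := by
    apply mul_right_cancel₀ Complex.I_ne_zero
    linear_combination kI
  constructor
  · linear_combination (k1 + kI') / 2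
  · linear_combination (k1 - kI') / 2

/-- Regularised Cauchy kernel `ū / (|u|² + e²)`. -/
def cauchyKernel (e : ℝ) (u : ℂ) : ℂ := conj u / ((‖u‖ ^ 2 + e ^ 2 : ℝ) : ℂ)

/-- The derivative `∂̄` of the regularised Cauchy kernel, an approximate identity
(up to the factor `π`). -/
def bumpKernel (e : ℝ) (u : ℂ) : ℂ := ((e ^ 2 / (‖u‖ ^ 2 + e ^ 2) ^ 2 : ℝ) : ℂ)

/-- Regularised Beurling kernel. -/
def beurlingKernel (e : ℝ) (u : ℂ) : ℂ := cauchyKernel e u ^ 2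

lemma normSq_add_pos {e : ℝ} (he : 0 < e) (u : ℂ) : 0 < ‖u‖ ^ 2 + e ^ 2 := by positivity

lemma ofReal_normSq_add (e : ℝ) (u : ℂ) :
    ((‖u‖ ^ 2 + e ^ 2 : ℝ) : ℂ) = u * conj u + (e : ℂ) ^ 2 := by
  rw [Complex.mul_conj, Complex.normSq_eq_norm_sq]; push_cast; ring

lemma hasFDerivAt_normSq_add (e : ℝ) (u : ℂ) :
    HasFDerivAt (fun u : ℂ => ((‖u‖ ^ 2 + e ^ 2 : ℝ) : ℂ)) (wirtingerMap (conj u) u) u := by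
  simp only [ofReal_normSq_add]
  have h1 : HasFDerivAt (fun u : ℂ => u) (1 : ℂ →L[ℝ] ℂ) u := hasFDerivAt_id u
  have h2 : HasFDerivAt (fun u : ℂ => conj u) (Complex.conjCLE : ℂ →L[ℝ] ℂ) u :=
    Complex.conjCLE.hasFDerivAt
  refine ((h1.mul h2).add_const _).congr_fderiv ?_
  ext v; simp; ring

lemma HasFDerivAt.wirtinger_inv {f : ℂ → ℂ} {a b u : ℂ} (h : HasFDerivAt f (wirtingerMap a b) u)
    (h0 : f u ≠ 0) :
    HasFDerivAt (fun u => (f u)⁻¹) (wirtingerMap (-a / f u ^ 2) (-b / f u ^ 2)) u := by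
  have h1 : HasFDerivAt (fun z : ℂ => z⁻¹) (wirtingerMap (-(f u ^ 2)⁻¹) 0) (f u) := by
    refine ((hasDerivAt_inv h0).hasFDerivAt.restrictScalars ℝ).congr_fderiv ?_
    ext v; simp; ring
  refine (h1.comp u h).congr_fderiv ?_
  ext v; simp; ring

lemma HasFDerivAt.wirtinger_mul {f g : ℂ → ℂ} {a b c d u : ℂ}
    (hf : HasFDerivAt f (wirtingerMap a b) u) (hg : HasFDerivAt g (wirtingerMap c d) u) :
    HasFDerivAt (fun u => f u * g u)
      (wirtingerMap (f u * c + a * g u) (f u * d + b * g u)) u := by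
  refine (hf.mul hg).congr_fderiv ?_
  ext v; simp; ring

lemma HasFDerivAt.wirtinger_conj {f : ℂ → ℂ} {a b u : ℂ}
    (hf : HasFDerivAt f (wirtingerMap a b) u) :
    HasFDerivAt (fun u => conj (f u)) (wirtingerMap (conj b) (conj a)) u := by
  have h2 : HasFDerivAt (fun u : ℂ => conj u) (Complex.conjCLE : ℂ →L[ℝ] ℂ) (f u) :=
    Complex.conjCLE.hasFDerivAt
  refine (h2.comp u hf).congr_fderiv ?_
  ext v; simp; ring

lemma HasFDerivAt.wirtinger_congr {f : ℂ → ℂ} {a b c d u : ℂ}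
    (hf : HasFDerivAt f (wirtingerMap a b) u) (h1 : a = c) (h2 : b = d) :
    HasFDerivAt f (wirtingerMap c d) u := by
  subst h1 h2; exact hf

lemma HasFDerivAt.wirtinger_comp_sub {f : ℂ → ℂ} {a b u s : ℂ}
    (hf : HasFDerivAt f (wirtingerMap a b) (u - s)) :
    HasFDerivAt (fun u => f (u - s)) (wirtingerMap a b) u := by
  simpa using! hf.comp u ((hasFDerivAt_id u).sub_const s)

/-- This is what singles out the chosen regularisation: the relation `∂(1/u) = -1/u²` survives
exactly, and the delta mass in `∂̄(1/u)` becomes an explicit positive bump. -/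
lemma hasFDerivAt_cauchyKernel {e : ℝ} (he : 0 < e) (u : ℂ) :
    HasFDerivAt (cauchyKernel e) (wirtingerMap (-beurlingKernel e u) (bumpKernel e u)) u := by
  have hD : ((‖u‖ ^ 2 + e ^ 2 : ℝ) : ℂ) ≠ 0 := by exact_mod_cast (normSq_add_pos he u).ne'
  have h2 : HasFDerivAt (fun u : ℂ => conj u) (wirtingerMap 0 1) u :=
    (Complex.conjCLE.hasFDerivAt (x := u)).congr_fderiv (by ext v; simp)
  have := h2.wirtinger_mul ((hasFDerivAt_normSq_add e u).wirtinger_inv hD)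
  refine this.wirtinger_congr ?_ ?_
  · rw [beurlingKernel, cauchyKernel]; field_simp; ring
  · have h3 := ofReal_normSq_add e u
    rw [bumpKernel]; push_cast at h3 hD ⊢
    field_simp
    linear_combination h3

lemma hasFDerivAt_bumpKernel {e : ℝ} (he : 0 < e) (u : ℂ) :
    HasFDerivAt (bumpKernel e) (wirtingerMap (-2 * cauchyKernel e u * bumpKernel e u)
      (-2 * conj (cauchyKernel e u) * bumpKernel e u)) u := by
  have hD : ((‖u‖ ^ 2 + e ^ 2 : ℝ) : ℂ) ≠ 0 := by exact_mod_cast (normSq_add_pos he u).ne'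
  have h2 : HasFDerivAt (fun _ : ℂ => (e : ℂ) ^ 2) (wirtingerMap 0 0) u :=
    (hasFDerivAt_const _ _).congr_fderiv (by ext v; simp)
  have h1 := (hasFDerivAt_normSq_add e u).wirtinger_inv hD
  have := h2.wirtinger_mul (h1.wirtinger_mul h1)
  have e1 : bumpKernel e = fun u : ℂ => (e : ℂ) ^ 2 * (((‖u‖ ^ 2 + e ^ 2 : ℝ) : ℂ)⁻¹
      * ((‖u‖ ^ 2 + e ^ 2 : ℝ) : ℂ)⁻¹) := by
    ext u; rw [bumpKernel]; push_cast; rw [div_eq_mul_inv, sq (_ + _), mul_inv]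
  rw [e1]
  refine this.wirtinger_congr ?_ ?_
  · rw [cauchyKernel]; field_simp; ring
  · rw [cauchyKernel, map_div₀, Complex.conj_conj, Complex.conj_ofReal]; field_simp; ring

lemma continuous_cauchyKernel {e : ℝ} (he : 0 < e) : Continuous (cauchyKernel e) :=
  continuous_iff_continuousAt.2 fun u => (hasFDerivAt_cauchyKernel he u).continuousAt

lemma continuous_bumpKernel {e : ℝ} (he : 0 < e) : Continuous (bumpKernel e) :=
  continuous_iff_continuousAt.2 fun u => (hasFDerivAt_bumpKernel he u).continuousAt

lemma continuous_beurlingKernel {e : ℝ} (he : 0 < e) : Continuous (beurlingKernel e) :=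
  (continuous_cauchyKernel he).pow 2

/-! ### Decay and integrability of products of kernels -/

/-- Continuous functions that are `O((1 + ‖u‖)⁻ⁿ)`. -/
def HasDecay (n : ℕ) (f : ℂ → ℂ) : Prop :=
  Continuous f ∧ ∃ C, ∀ u, ‖f u‖ ≤ C * ((1 + ‖u‖) ^ n)⁻¹

lemma HasDecay.mul {n m : ℕ} {f g : ℂ → ℂ} (hf : HasDecay n f) (hg : HasDecay m g) :
    HasDecay (n + m) (fun u => f u * g u) := by
  obtain ⟨cf, C, hC⟩ := hf
  obtain ⟨cg, D, hD⟩ := hg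
  refine ⟨cf.mul cg, C * D, fun u => ?_⟩
  rw [norm_mul, pow_add, mul_inv]
  have := mul_le_mul (hC u) (hD u) (norm_nonneg _) ((norm_nonneg _).trans (hC u))
  linarith

lemma HasDecay.conj {n : ℕ} {f : ℂ → ℂ} (hf : HasDecay n f) :
    HasDecay n (fun u => conj (f u)) := by
  obtain ⟨cf, C, hC⟩ := hf
  exact ⟨Complex.continuous_conj.comp cf, C, fun u => by simpa using hC u⟩

lemma HasDecay.const_mul {n : ℕ} {f : ℂ → ℂ} (hf : HasDecay n f) (c : ℂ) :
    HasDecay n (fun u => c * f u) := by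
  obtain ⟨cf, C, hC⟩ := hf
  refine ⟨continuous_const.mul cf, ‖c‖ * C, fun u => ?_⟩
  rw [norm_mul, mul_assoc]
  exact mul_le_mul_of_nonneg_left (hC u) (norm_nonneg _)

lemma HasDecay.comp_sub {n : ℕ} {f : ℂ → ℂ} (hf : HasDecay n f) (a : ℂ) :
    HasDecay n (fun u => f (u - a)) := by
  obtain ⟨cf, C, hC⟩ := hf
  have hC0 : 0 ≤ C := by
    have := (norm_nonneg _).trans (hC 0); simpa using this
  refine ⟨cf.comp (continuous_id.sub continuous_const), C * (1 + ‖a‖) ^ n, fun u => ?_⟩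
  refine (hC _).trans ?_
  rw [mul_assoc]
  refine mul_le_mul_of_nonneg_left ?_ hC0
  rw [← div_eq_mul_inv, inv_eq_one_div, div_le_div_iff₀ (by positivity) (by positivity), one_mul,
    ← mul_pow]
  gcongr
  have := norm_add_le (u - a) a
  rw [sub_add_cancel] at this
  nlinarith [norm_nonneg a, norm_nonneg (u - a), mul_nonneg (norm_nonneg a) (norm_nonneg (u - a))]

lemma HasDecay.integrable {n : ℕ} (hn : 3 ≤ n) {f : ℂ → ℂ} (hf : HasDecay n f) :
    Integrable f := by
  obtain ⟨cf, C, hC⟩ := hf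
  have h1 : Integrable (fun u : ℂ => C * (1 + ‖u‖) ^ (-(n : ℝ))) := by
    refine (integrable_one_add_norm ?_).const_mul C
    rw [Complex.finrank_real_complex]; exact_mod_cast hn
  refine h1.mono' cf.aestronglyMeasurable (Eventually.of_forall fun u => ?_)
  rw [Real.rpow_neg (by positivity), Real.rpow_natCast]
  exact hC u

lemma norm_cauchyKernel (e : ℝ) (u : ℂ) :
    ‖cauchyKernel e u‖ = ‖u‖ / (‖u‖ ^ 2 + e ^ 2) := by
  rw [cauchyKernel, norm_div, Complex.norm_conj, Complex.norm_real, Real.norm_of_nonneg]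
  positivity

lemma hasDecay_cauchyKernel {e : ℝ} (he : 0 < e) : HasDecay 1 (cauchyKernel e) := by
  refine ⟨continuous_cauchyKernel he, 2 + 1 / e ^ 2, fun u => ?_⟩
  rw [norm_cauchyKernel, pow_one, ← div_eq_mul_inv, div_le_div_iff₀ (by positivity) (by positivity)]
  have : (2 + 1 / e ^ 2) * (‖u‖ ^ 2 + e ^ 2) = 2 * ‖u‖ ^ 2 + 2 * e ^ 2 + ‖u‖ ^ 2 / e ^ 2 + 1 := by
    field_simp; ring
  rw [this]
  have h3 : 0 ≤ ‖u‖ ^ 2 / e ^ 2 := by positivity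
  nlinarith [norm_nonneg u, sq_nonneg (‖u‖ - 1), sq_nonneg e]

lemma hasDecay_bumpKernel {e : ℝ} (he : 0 < e) : HasDecay 2 (bumpKernel e) := by
  have h : ∃ C, ∀ u : ℂ, (1 + ‖u‖) ^ 2 ≤ C * (‖u‖ ^ 2 + e ^ 2) := by
    refine ⟨2 + 2 / e ^ 2, fun u => ?_⟩
    have : (2 + 2 / e ^ 2) * (‖u‖ ^ 2 + e ^ 2)
      = 2 * ‖u‖ ^ 2 + 2 * e ^ 2 + 2 * (‖u‖ ^ 2 / e ^ 2) + 2 := by field_simp; ring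
    rw [this]
    have h3 : 0 ≤ ‖u‖ ^ 2 / e ^ 2 := by positivity
    nlinarith [norm_nonneg u, sq_nonneg (‖u‖ - 1), sq_nonneg e]
  obtain ⟨C, hC⟩ := h
  refine ⟨continuous_bumpKernel he, C, fun u => ?_⟩
  have hp := normSq_add_pos he u
  rw [bumpKernel, Complex.norm_real, Real.norm_of_nonneg (by positivity), ← div_eq_mul_inv,
    div_le_div_iff₀ (by positivity) (by positivity)]
  have h1 := hC u
  have h2 : e ^ 2 ≤ ‖u‖ ^ 2 + e ^ 2 := by nlinarith [norm_nonneg u]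
  calc e ^ 2 * (1 + ‖u‖) ^ 2 ≤ (‖u‖ ^ 2 + e ^ 2) * (C * (‖u‖ ^ 2 + e ^ 2)) :=
        mul_le_mul h2 h1 (by positivity) hp.le
    _ = _ := by ring

lemma hasDecay_beurlingKernel {e : ℝ} (he : 0 < e) : HasDecay 2 (beurlingKernel e) := by
  have h : beurlingKernel e = fun u => cauchyKernel e u * cauchyKernel e u :=
    funext fun u => sq _
  rw [h]
  exact (hasDecay_cauchyKernel he).mul (hasDecay_cauchyKernel he)

/-! ### The unweighted `L²` bound -/

/-- A kernel form of `‖∂h‖₂ = ‖∂̄h‖₂`. Write `k_a` and `P_a` for the Cauchy and bump kernels centred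
at `a`. Since `∂k_a` is minus the Beurling kernel and `∂` of the conjugate of `k_b²` is `2 k̄_b
P_b`, the left side equals `∫ 2 k_a k̄_b P_b`. Since `∂̄P_b = -2 k̄_b P_b` and `∂̄k_a = P_a`, the
same integral equals the right side. -/
lemma integral_beurlingKernel_mul_conj {e : ℝ} (he : 0 < e) (a b : ℂ) :
    ∫ z, beurlingKernel e (z - a) * conj (beurlingKernel e (z - b))
      = ∫ z, bumpKernel e (z - a) * bumpKernel e (z - b) := by
  have dk := fun s => (hasDecay_cauchyKernel he).comp_sub s
  have dB := fun s => (hasDecay_beurlingKernel he).comp_sub s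
  have dP := fun s => (hasDecay_bumpKernel he).comp_sub s
  have hk : ∀ x, HasFDerivAt (fun z => cauchyKernel e (z - a))
      (wirtingerMap (-beurlingKernel e (x - a)) (bumpKernel e (x - a))) x :=
    fun x => (hasFDerivAt_cauchyKernel he _).wirtinger_comp_sub
  have hP : ∀ x, HasFDerivAt (fun z => bumpKernel e (z - b))
      (wirtingerMap (-2 * (cauchyKernel e (x - b) * bumpKernel e (x - b)))
        (-2 * (conj (cauchyKernel e (x - b)) * bumpKernel e (x - b)))) x :=
    fun x => ((hasFDerivAt_bumpKernel he _).wirtinger_comp_sub).wirtinger_congr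
      (by ring) (by ring)
  have hm : ∀ x, HasFDerivAt (fun z => conj (beurlingKernel e (z - b)))
      (wirtingerMap (2 * (conj (cauchyKernel e (x - b)) * bumpKernel e (x - b)))
        (-2 * (conj (cauchyKernel e (x - b)) * conj (beurlingKernel e (x - b))))) x := by
    intro x
    have h := ((hasFDerivAt_cauchyKernel he (x - b)).wirtinger_comp_sub).wirtinger_conj
    have h' := h.wirtinger_mul h
    simp only [beurlingKernel, map_pow] at h' ⊢
    simp only [sq] at h' ⊢
    refine h'.wirtinger_congr ?_ ?_
    · rw [bumpKernel, Complex.conj_ofReal]; ring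
    · simp; ring
  have neg1 : ∀ f : ℂ → ℂ, (fun x => -f x) = fun x => (-1) * f x := fun f => by ext; ring
  have dnB : HasDecay 2 (fun x => -beurlingKernel e (x - a)) := by
    rw [neg1]; exact (dB a).const_mul (-1)
  have r1 := (integral_mul_wirtinger hk hm
    (((dk a).mul (dB b).conj).integrable (by norm_num))
    ((dnB.mul (dB b).conj).integrable (by norm_num))
    (((dP a).mul (dB b).conj).integrable (by norm_num))
    (((dk a).mul (((dk b).conj.mul (dP b)).const_mul 2)).integrable (by norm_num))
    (((dk a).mul (((dk b).conj.mul (dB b).conj).const_mul (-2))).integrable (by norm_num))).1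
  have r2 := (integral_mul_wirtinger hk hP
    (((dk a).mul (dP b)).integrable (by norm_num))
    ((dnB.mul (dP b)).integrable (by norm_num))
    (((dP a).mul (dP b)).integrable (by norm_num))
    (((dk a).mul (((dk b).mul (dP b)).const_mul (-2))).integrable (by norm_num))
    (((dk a).mul (((dk b).conj.mul (dP b)).const_mul (-2))).integrable (by norm_num))).2
  have e1 : ∀ x, -beurlingKernel e (x - a) * conj (beurlingKernel e (x - b))
    = -(beurlingKernel e (x - a) * conj (beurlingKernel e (x - b))) := fun x => by ring
  have e2 : ∀ x, cauchyKernel e (x - a) * (-2 * (conj (cauchyKernel e (x - b))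
      * bumpKernel e (x - b))) = -(cauchyKernel e (x - a) * (2 * (conj (cauchyKernel e (x - b))
      * bumpKernel e (x - b)))) := fun x => by ring
  simp only [e1, e2, integral_neg, neg_neg] at r1 r2
  rw [← r1, ← neg_inj, ← r2]

/-- Regularised Beurling transform (without the factor `1/π`). -/
def regBeurling (e : ℝ) (f : ℂ → ℂ) (x : ℂ) : ℂ := ∫ y, beurlingKernel e (x - y) * f y

lemma sq_lintegral_mul_le {α : Type*} [MeasurableSpace α] {μ : Measure α} {f g : α → ℝ≥0∞}
    (hf : AEMeasurable f μ) (hg : AEMeasurable g μ) :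
    (∫⁻ x, f x * g x ∂μ) ^ 2 ≤ (∫⁻ x, f x ^ 2 ∂μ) * ∫⁻ x, g x ^ 2 ∂μ := by
  have h := ENNReal.lintegral_mul_le_Lp_mul_Lq μ Real.HolderConjugate.two_two hf hg
  simp only [ENNReal.rpow_ofNat, Pi.mul_apply] at h
  refine (pow_le_pow_left' h 2).trans_eq ?_
  rw [mul_pow, ← ENNReal.rpow_natCast, ← ENNReal.rpow_natCast, ← ENNReal.rpow_mul,
    ← ENNReal.rpow_mul]
  norm_num

lemma sq_lintegral_weighted_le {α : Type*} [MeasurableSpace α] {μ : Measure α} {p g : α → ℝ≥0∞}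
    (hp : AEMeasurable p μ) (hg : AEMeasurable g μ) :
    (∫⁻ x, p x * g x ∂μ) ^ 2 ≤ (∫⁻ x, p x ∂μ) * ∫⁻ x, p x * g x ^ 2 ∂μ := by
  have hs : ∀ a : ℝ≥0∞, (a ^ (1 / 2 : ℝ)) ^ 2 = a := fun a => by
    rw [← ENNReal.rpow_natCast, ← ENNReal.rpow_mul]; norm_num
  have h := sq_lintegral_mul_le (hp.pow_const (1 / 2 : ℝ)) ((hp.pow_const (1 / 2 : ℝ)).mul hg)
  simp only [mul_pow, hs, Pi.mul_apply, ← mul_assoc, ← sq] at h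
  exact h

lemma HasDecay.integrable_sq {K : ℂ → ℂ} (hK : HasDecay 2 K) : Integrable (fun z => ‖K z‖ ^ 2) := by
  simpa only [norm_pow, ← sq] using ((hK.mul hK).integrable (by norm_num)).norm

/-- This justifies Fubini when `|K * g|²` is expanded into a double integral. By `2xy ≤ x² + y²`,
the `z`-integral of `|K(z - y) K(z - y')|` is at most `‖K‖₂²` for all `y`, `y'`, and `g ⊗ ḡ` is
integrable. -/
lemma HasDecay.integrable_mul_tensor {K : ℂ → ℂ} (hK : HasDecay 2 K) {g : ℂ → ℂ}
    (hg : Integrable g) :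
    Integrable (fun q : ℂ × (ℂ × ℂ) => (g q.2.1 * conj (g q.2.2)) *
      (K (q.1 - q.2.1) * conj (K (q.1 - q.2.2)))) (volume.prod (volume.prod volume)) := by
  have hgc : Integrable (fun x => conj (g x)) :=
    ⟨Complex.continuous_conj.comp_aestronglyMeasurable hg.1, by
      simpa [HasFiniteIntegral] using hg.2⟩
  have hgg : Integrable (fun p : ℂ × ℂ => g p.1 * conj (g p.2)) (volume.prod volume) :=
    hg.mul_prod hgc
  have hm : AEStronglyMeasurable (fun q : ℂ × (ℂ × ℂ) => (g q.2.1 * conj (g q.2.2)) *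
      (K (q.1 - q.2.1) * conj (K (q.1 - q.2.2)))) (volume.prod (volume.prod volume)) := by
    refine (hgg.1.comp_snd (μ := volume)).mul ?_
    have h := hK.1
    have h' := Complex.continuous_conj
    exact (by fun_prop : Continuous fun q : ℂ × (ℂ × ℂ) =>
      (K (q.1 - q.2.1) * conj (K (q.1 - q.2.2)))).aestronglyMeasurable
  rw [integrable_prod_iff' hm]
  have hi : ∀ p : ℂ × ℂ, Integrable (fun z => K (z - p.1) * conj (K (z - p.2))) := fun p =>
    ((hK.comp_sub p.1).mul (hK.comp_sub p.2).conj).integrable (by norm_num)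
  refine ⟨Eventually.of_forall fun p => (hi p).const_mul (g p.1 * conj (g p.2)), ?_⟩
  refine (hgg.norm.mul_const (∫ z, ‖K z‖ ^ 2)).mono' hm.norm.prod_swap.integral_prod_right'
    (Eventually.of_forall fun p => ?_)
  rw [Real.norm_of_nonneg (integral_nonneg fun _ => norm_nonneg _)]
  simp only [norm_mul _ (_ * _)]
  rw [integral_const_mul]
  refine mul_le_mul_of_nonneg_left ?_ (norm_nonneg _)
  have hs : ∀ a, Integrable fun z => ‖K (z - a)‖ ^ 2 := fun a => (hK.comp_sub a).integrable_sq
  calc ∫ z, ‖K (z - p.1) * conj (K (z - p.2))‖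
      ≤ ∫ z, (1 / 2 * ‖K (z - p.1)‖ ^ 2 + 1 / 2 * ‖K (z - p.2)‖ ^ 2) := by
        refine integral_mono (hi p).norm (((hs _).const_mul _).add ((hs _).const_mul _))
          fun z => ?_
        simp only [norm_mul, RCLike.norm_conj]
        nlinarith [sq_nonneg (‖K (z - p.1)‖ - ‖K (z - p.2)‖)]
    _ = ∫ z, ‖K z‖ ^ 2 := by
        rw [integral_add ((hs _).const_mul _) ((hs _).const_mul _), integral_const_mul,
          integral_const_mul, integral_sub_right_eq_self (fun z => ‖K z‖ ^ 2),
          integral_sub_right_eq_self (fun z => ‖K z‖ ^ 2)]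
        ring

lemma tensor_integral_eq {K : ℂ → ℂ} (g : ℂ → ℂ) (z : ℂ) :
    ∫ p : ℂ × ℂ, (g p.1 * conj (g p.2)) * (K (z - p.1) * conj (K (z - p.2)))
      = ((‖∫ y, K (z - y) * g y‖ ^ 2 : ℝ) : ℂ) := by
  have h : ∀ p : ℂ × ℂ, (g p.1 * conj (g p.2)) * (K (z - p.1) * conj (K (z - p.2)))
    = (K (z - p.1) * g p.1) * conj (K (z - p.2) * g p.2) := fun p => by
      simp only [map_mul]; ring
  simp only [h]
  rw [Measure.volume_eq_prod, integral_prod_mul (fun y => K (z - y) * g y)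
    (fun y => conj (K (z - y) * g y)), integral_conj, Complex.mul_conj, Complex.normSq_eq_norm_sq]

lemma HasDecay.integrable_norm_conv_sq {K : ℂ → ℂ} (hK : HasDecay 2 K) {g : ℂ → ℂ}
    (hg : Integrable g) : Integrable (fun z => ‖∫ y, K (z - y) * g y‖ ^ 2) := by
  have := (hK.integrable_mul_tensor hg).integral_prod_left
  simp only [← Measure.volume_eq_prod, tensor_integral_eq] at this
  exact_mod_cast this.re

/-- The `L²` norm of a convolution depends on the kernel only through its correlations, so two
kernels with equal correlations give convolutions of equal norm. -/
lemma HasDecay.integral_norm_conv_sq {K : ℂ → ℂ} (hK : HasDecay 2 K) {g : ℂ → ℂ}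
    (hg : Integrable g) : ((∫ z, ‖∫ y, K (z - y) * g y‖ ^ 2 : ℝ) : ℂ) =
      ∫ p : ℂ × ℂ, (g p.1 * conj (g p.2)) * ∫ z, K (z - p.1) * conj (K (z - p.2)) := by
  rw [← integral_complex_ofReal]
  simp only [← tensor_integral_eq]
  rw [integral_integral_swap]
  · simp only [integral_const_mul]
  · exact hK.integrable_mul_tensor hg

lemma integral_norm_regBeurling_sq {e : ℝ} (he : 0 < e) {g : ℂ → ℂ} (hg : Integrable g) :
    ∫ z, ‖regBeurling e g z‖ ^ 2 = ∫ z, ‖∫ y, bumpKernel e (z - y) * g y‖ ^ 2 := by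
  have h1 := (hasDecay_beurlingKernel he).integral_norm_conv_sq hg
  have h2 := (hasDecay_bumpKernel he).integral_norm_conv_sq hg
  have h3 : ∀ u, conj (bumpKernel e u) = bumpKernel e u := fun u => Complex.conj_ofReal _
  simp only [h3] at h2
  simp only [integral_beurlingKernel_mul_conj he] at h1
  exact_mod_cast h1.trans h2.symm

/-- The kernel with parameter `e` is the `L¹`-normalised dilation `e⁻² P₁(u/e)`. This is the source
of uniformity in `e`. -/
lemma lintegral_enorm_bumpKernel {e : ℝ} (he : 0 < e) :
    ∫⁻ u, ‖bumpKernel e u‖ₑ = ∫⁻ u, ‖bumpKernel 1 u‖ₑ := by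
  have hi : ∀ {e : ℝ}, 0 < e → Integrable (bumpKernel e) := by
    intro e he
    have h1 : Integrable (fun u : ℂ => (1 + ‖u‖ ^ 2) ^ (-(4 : ℝ) / 2)) :=
      integrable_rpow_neg_one_add_norm_sq (by rw [Complex.finrank_real_complex]; norm_num)
    have h2 : Integrable (fun u : ℂ => (e ^ 2)⁻¹ * (1 + ‖e⁻¹ • u‖ ^ 2) ^ (-(4 : ℝ) / 2)) :=
      (h1.comp_smul (inv_ne_zero he.ne')).const_mul _
    refine h2.mono' (continuous_bumpKernel he).aestronglyMeasurable
      (Eventually.of_forall fun u => le_of_eq ?_)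
    rw [bumpKernel, Complex.norm_real, Real.norm_of_nonneg (by positivity), norm_smul, norm_inv,
      Real.norm_of_nonneg he.le, show -(4 : ℝ) / 2 = -((2 : ℕ) : ℝ) by norm_num,
      Real.rpow_neg (by positivity), Real.rpow_natCast]
    field_simp
    ring
  rw [← ofReal_integral_norm_eq_lintegral_enorm (hi he),
    ← ofReal_integral_norm_eq_lintegral_enorm (hi one_pos)]
  have h := Measure.integral_comp_inv_smul volume (fun u : ℂ => ‖bumpKernel 1 u‖) e
  rw [Complex.finrank_real_complex, smul_eq_mul, abs_of_pos (by positivity)] at h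
  have h2 : ∀ u : ℂ, ‖bumpKernel 1 (e⁻¹ • u)‖ = e ^ 2 * ‖bumpKernel e u‖ := by
    intro u
    simp only [bumpKernel, Complex.norm_real]
    rw [Real.norm_of_nonneg (by positivity), Real.norm_of_nonneg (by positivity), norm_smul,
      norm_inv, Real.norm_of_nonneg he.le]
    field_simp
  simp only [h2, integral_const_mul] at h
  rw [mul_left_cancel₀ (by positivity) h]

lemma lintegral_enorm_bumpKernel_lt_top : ∫⁻ u, ‖bumpKernel 1 u‖ₑ < ⊤ := by
  have h1 : Integrable (fun u : ℂ => (1 + ‖u‖ ^ 2) ^ (-(4 : ℝ) / 2)) :=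
    integrable_rpow_neg_one_add_norm_sq (by rw [Complex.finrank_real_complex]; norm_num)
  refine (h1.mono' (continuous_bumpKernel one_pos).aestronglyMeasurable
    (Eventually.of_forall fun u => le_of_eq ?_)).2
  rw [bumpKernel, Complex.norm_real, Real.norm_of_nonneg (by positivity),
    show -(4 : ℝ) / 2 = -((2 : ℕ) : ℝ) by norm_num, Real.rpow_neg (by positivity),
    Real.rpow_natCast]
  simp [add_comm]

/-- Young's inequality: Cauchy–Schwarz against the weight `|P(z - y)|`, then Tonelli and translation
invariance. -/
lemma lintegral_enorm_conv_sq_le {P g : ℂ → ℂ} (hP : Continuous P)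
    (hg : AEStronglyMeasurable g volume) :
    ∫⁻ z, ‖∫ y, P (z - y) * g y‖ₑ ^ 2 ≤ (∫⁻ u, ‖P u‖ₑ) ^ 2 * ∫⁻ y, ‖g y‖ₑ ^ 2 := by
  have hmP : ∀ z, AEMeasurable (fun y => ‖P (z - y)‖ₑ) volume := fun z =>
    (by fun_prop : Continuous fun y => P (z - y)).measurable.enorm.aemeasurable
  calc ∫⁻ z, ‖∫ y, P (z - y) * g y‖ₑ ^ 2
      ≤ ∫⁻ z, (∫⁻ u, ‖P u‖ₑ) * ∫⁻ y, ‖P (z - y)‖ₑ * ‖g y‖ₑ ^ 2 := by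
        refine lintegral_mono fun z => ?_
        have h1 : ‖∫ y, P (z - y) * g y‖ₑ ≤ ∫⁻ y, ‖P (z - y)‖ₑ * ‖g y‖ₑ := by
          simpa only [enorm_mul] using
            enorm_integral_le_lintegral_enorm (fun y => P (z - y) * g y)
        refine (pow_le_pow_left' h1 2).trans ?_
        refine (sq_lintegral_weighted_le (hmP z) hg.enorm).trans_eq ?_
        rw [lintegral_sub_left_eq_self (fun u => ‖P u‖ₑ)]
    _ ≤ (∫⁻ u, ‖P u‖ₑ) * ∫⁻ z, ∫⁻ y, ‖P (z - y)‖ₑ * ‖g y‖ₑ ^ 2 := by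
        rw [lintegral_const_mul'']
        refine AEMeasurable.lintegral_prod_right' (f := fun q : ℂ × ℂ =>
          ‖P (q.1 - q.2)‖ₑ * ‖g q.2‖ₑ ^ 2) ?_
        exact (by fun_prop : Continuous fun q : ℂ × ℂ => P (q.1 - q.2)).measurable.enorm.aemeasurable.mul
          ((hg.comp_snd).enorm.pow_const 2)
    _ = (∫⁻ u, ‖P u‖ₑ) * ∫⁻ y, ∫⁻ z, ‖P (z - y)‖ₑ * ‖g y‖ₑ ^ 2 := by
        rw [lintegral_lintegral_swap]
        exact (by fun_prop : Continuous fun q : ℂ × ℂ => P (q.1 - q.2)).measurable.enorm.aemeasurable.mul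
          ((hg.comp_snd).enorm.pow_const 2)
    _ = (∫⁻ u, ‖P u‖ₑ) * ∫⁻ y, (∫⁻ u, ‖P u‖ₑ) * ‖g y‖ₑ ^ 2 := by
        congr 1
        refine lintegral_congr fun y => ?_
        rw [lintegral_mul_const'' _ (by
          exact (by fun_prop : Continuous fun z => P (z - y)).measurable.enorm.aemeasurable),
          lintegral_sub_right_eq_self (fun u => ‖P u‖ₑ)]
    _ = _ := by rw [lintegral_const_mul'' _ (hg.enorm.pow_const 2), sq, mul_assoc]

lemma exists_lintegral_regBeurling_sq_le : ∃ C : ℝ≥0, ∀ e : ℝ, 0 < e → ∀ g : ℂ → ℂ, Integrable g →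
    ∫⁻ z, ‖regBeurling e g z‖ₑ ^ 2 ≤ C * ∫⁻ z, ‖g z‖ₑ ^ 2 := by
  refine ⟨(∫⁻ u, ‖bumpKernel 1 u‖ₑ).toNNReal ^ 2, fun e he g hg => ?_⟩
  have hsq : ∀ F : ℂ → ℂ, Integrable (fun z => ‖F z‖ ^ 2) →
      ∫⁻ z, ‖F z‖ₑ ^ 2 = ENNReal.ofReal (∫ z, ‖F z‖ ^ 2) := by
    intro F hF
    rw [ofReal_integral_eq_lintegral_ofReal hF (Eventually.of_forall fun z => by positivity)]
    refine lintegral_congr fun z => ?_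
    rw [ENNReal.ofReal_pow (norm_nonneg _), ofReal_norm]
  have h1 := (hasDecay_beurlingKernel he).integrable_norm_conv_sq hg
  have h2 := (hasDecay_bumpKernel he).integrable_norm_conv_sq hg
  rw [hsq (regBeurling e g) h1, integral_norm_regBeurling_sq he hg, ← hsq _ h2]
  refine (lintegral_enorm_conv_sq_le (continuous_bumpKernel he) hg.1).trans_eq ?_
  rw [lintegral_enorm_bumpKernel he, ENNReal.coe_pow,
    ENNReal.coe_toNNReal lintegral_enorm_bumpKernel_lt_top.ne]

/-! ### Size and smoothness of the kernels, uniformly in the regularisation -/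

lemma norm_cauchyKernel_le {e : ℝ} {u : ℂ} (hu : u ≠ 0) : ‖cauchyKernel e u‖ ≤ 1 / ‖u‖ := by
  have := norm_pos_iff.2 hu
  rw [norm_cauchyKernel, div_le_div_iff₀ (by positivity) this]
  nlinarith [sq_nonneg e]

lemma norm_beurlingKernel_le {e : ℝ} {u : ℂ} (hu : u ≠ 0) :
    ‖beurlingKernel e u‖ ≤ 1 / ‖u‖ ^ 2 := by
  have := pow_le_pow_left₀ (norm_nonneg _) (norm_cauchyKernel_le (e := e) hu) 2
  rwa [beurlingKernel, norm_pow, ← one_div_pow]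

lemma norm_beurlingKernel_le_const {e : ℝ} (he : 0 < e) (u : ℂ) :
    ‖beurlingKernel e u‖ ≤ 1 / e ^ 2 := by
  have h : ‖cauchyKernel e u‖ ≤ 1 / e := by
    rw [norm_cauchyKernel, div_le_div_iff₀ (by positivity) he]
    nlinarith [sq_nonneg (‖u‖ - e), norm_nonneg u, mul_nonneg (norm_nonneg u) he.le]
  have := pow_le_pow_left₀ (norm_nonneg _) h 2
  rwa [beurlingKernel, norm_pow, ← one_div_pow]

/-- The bound is the exact value of `|1/u - 1/v|`. Over the common denominator the numerator is at
most `(e² + |u||v|)|u - v|`, and `(e² + |u||v|)|u||v| ≤ (|u|² + e²)(|v|² + e²)`. -/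
lemma norm_cauchyKernel_sub_le {e : ℝ} {u v : ℂ} (hu : u ≠ 0) (hv : v ≠ 0) :
    ‖cauchyKernel e u - cauchyKernel e v‖ ≤ ‖u - v‖ / (‖u‖ * ‖v‖) := by
  have pu := norm_pos_iff.2 hu
  have pv := norm_pos_iff.2 hv
  have hDu : 0 < ‖u‖ ^ 2 + e ^ 2 := by positivity
  have hDv : 0 < ‖v‖ ^ 2 + e ^ 2 := by positivity
  have cu : ((‖u‖ ^ 2 + e ^ 2 : ℝ) : ℂ) ≠ 0 := by exact_mod_cast hDu.ne'
  have cv : ((‖v‖ ^ 2 + e ^ 2 : ℝ) : ℂ) ≠ 0 := by exact_mod_cast hDv.ne'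
  have h : cauchyKernel e u - cauchyKernel e v
      = ((e : ℂ) ^ 2 * conj (u - v) - conj u * conj v * (u - v)) /
        (((‖u‖ ^ 2 + e ^ 2 : ℝ) : ℂ) * ((‖v‖ ^ 2 + e ^ 2 : ℝ) : ℂ)) := by
    rw [cauchyKernel, cauchyKernel, div_sub_div _ _ cu cv, ofReal_normSq_add, ofReal_normSq_add,
      map_sub]
    ring
  have hn : ‖(e : ℂ) ^ 2 * conj (u - v) - conj u * conj v * (u - v)‖
      ≤ (e ^ 2 + ‖u‖ * ‖v‖) * ‖u - v‖ := by
    refine (norm_sub_le _ _).trans_eq ?_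
    simp only [norm_mul, norm_pow, Complex.norm_real, RCLike.norm_conj, Real.norm_eq_abs, sq_abs]
    ring
  rw [h, norm_div, norm_mul, Complex.norm_real, Complex.norm_real, Real.norm_of_nonneg hDu.le,
    Real.norm_of_nonneg hDv.le, div_le_div_iff₀ (by positivity) (by positivity)]
  calc _ ≤ ((e ^ 2 + ‖u‖ * ‖v‖) * ‖u - v‖) * (‖u‖ * ‖v‖) :=
        mul_le_mul_of_nonneg_right hn (by positivity)
    _ = ‖u - v‖ * ((e ^ 2 + ‖u‖ * ‖v‖) * (‖u‖ * ‖v‖)) := by ring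
    _ ≤ ‖u - v‖ * ((‖u‖ ^ 2 + e ^ 2) * (‖v‖ ^ 2 + e ^ 2)) := by
        refine mul_le_mul_of_nonneg_left ?_ (norm_nonneg _)
        nlinarith [mul_nonneg (sq_nonneg e) (sq_nonneg (‖u‖ - ‖v‖)), sq_nonneg (e ^ 2),
          mul_nonneg (sq_nonneg e) (mul_pos pu pv).le]

/-- Factor the difference of squares. The hypotheses give `|u| ≤ 3|v|`, so the difference of Cauchy
kernels is at most `6l/|u|²` and their sum at most `4/|u|`. -/
lemma norm_beurlingKernel_sub_le {e l : ℝ} (hl : 0 < l) {u v : ℂ} (hu : l ≤ ‖u‖) (hv : l ≤ ‖v‖)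
    (huv : ‖u - v‖ ≤ 2 * l) :
    ‖beurlingKernel e u - beurlingKernel e v‖ ≤ 24 * l / ‖u‖ ^ 3 := by
  have pu : 0 < ‖u‖ := hl.trans_le hu
  have pv : 0 < ‖v‖ := hl.trans_le hv
  have u0 := norm_pos_iff.1 pu
  have v0 := norm_pos_iff.1 pv
  have h3 : ‖u‖ ≤ 3 * ‖v‖ := by
    have := norm_sub_norm_le u v
    linarith
  have hv' : 1 / ‖v‖ ≤ 3 / ‖u‖ := by
    rw [div_le_div_iff₀ pv pu]; linarith
  have h1 : ‖cauchyKernel e u - cauchyKernel e v‖ ≤ 6 * l / ‖u‖ ^ 2 := by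
    refine (norm_cauchyKernel_sub_le u0 v0).trans ?_
    calc ‖u - v‖ / (‖u‖ * ‖v‖) = ‖u - v‖ * (1 / ‖u‖) * (1 / ‖v‖) := by field_simp
      _ ≤ (2 * l) * (1 / ‖u‖) * (3 / ‖u‖) := by gcongr
      _ = _ := by field_simp; ring
  have h2 : ‖cauchyKernel e u + cauchyKernel e v‖ ≤ 4 / ‖u‖ := by
    refine (norm_add_le _ _).trans ?_
    have a := norm_cauchyKernel_le (e := e) u0
    have b := (norm_cauchyKernel_le (e := e) v0).trans hv'
    calc _ ≤ 1 / ‖u‖ + 3 / ‖u‖ := add_le_add a b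
      _ = _ := by ring
  have : beurlingKernel e u - beurlingKernel e v
      = (cauchyKernel e u - cauchyKernel e v) * (cauchyKernel e u + cauchyKernel e v) := by
    simp only [beurlingKernel]; ring
  rw [this, norm_mul]
  calc _ ≤ (6 * l / ‖u‖ ^ 2) * (4 / ‖u‖) :=
        mul_le_mul h1 h2 (norm_nonneg _) (by positivity)
    _ = _ := by field_simp; ring

/-! ### Dyadic squares and stopping squares -/

/-- The half-open square with lower left corner `a` and side length `l`. -/
def square (a : ℂ) (l : ℝ) : Set ℂ :=
  Set.Ico a.re (a.re + l) ×ℂ Set.Ico a.im (a.im + l)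

lemma mem_square {a z : ℂ} {l : ℝ} :
    z ∈ square a l ↔ (a.re ≤ z.re ∧ z.re < a.re + l) ∧ (a.im ≤ z.im ∧ z.im < a.im + l) := by
  simp [square, Complex.mem_reProdIm]

lemma measurableSet_square (a : ℂ) (l : ℝ) : MeasurableSet (square a l) :=
  (measurableSet_Ico.preimage Complex.measurable_re).inter
    (measurableSet_Ico.preimage Complex.measurable_im)

lemma volume_square (a : ℂ) (l : ℝ) : volume (square a l) = ENNReal.ofReal l ^ 2 := by
  have h : square a l = Complex.measurableEquivRealProd ⁻¹'
      (Set.Ico a.re (a.re + l) ×ˢ Set.Ico a.im (a.im + l)) := by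
    ext z; simp [square, Complex.mem_reProdIm, Complex.measurableEquivRealProd]
  rw [h, Complex.volume_preserving_equiv_real_prod.measure_preimage
    (measurableSet_Ico.prod measurableSet_Ico).nullMeasurableSet, Measure.volume_eq_prod,
    Measure.prod_prod, Real.volume_Ico, Real.volume_Ico]
  simp [sq]

lemma norm_sub_le_of_mem_square {a z w : ℂ} {l : ℝ} (hz : z ∈ square a l) (hw : w ∈ square a l) :
    ‖z - w‖ ≤ 2 * l := by
  rw [mem_square] at hz hw
  refine (Complex.norm_le_abs_re_add_abs_im _).trans ?_
  have h1 : |(z - w).re| ≤ l := by rw [Complex.sub_re, abs_le]; constructor <;> linarith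
  have h2 : |(z - w).im| ≤ l := by rw [Complex.sub_im, abs_le]; constructor <;> linarith
  linarith

/-- Index of the dyadic subsquare of generation `n` (relative to `square a l`) containing `z`. -/
def dyadicIndex (a : ℂ) (l : ℝ) (n : ℕ) (z : ℂ) : ℤ × ℤ :=
  (⌊(z.re - a.re) / l * 2 ^ n⌋, ⌊(z.im - a.im) / l * 2 ^ n⌋)

/-- Lower left corner of the dyadic square with a given index. -/
def dyadicCorner (a : ℂ) (l : ℝ) (n : ℕ) (k : ℤ × ℤ) : ℂ :=
  ⟨a.re + k.1 * (l / 2 ^ n), a.im + k.2 * (l / 2 ^ n)⟩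

lemma mem_square_dyadicCorner {a z : ℂ} {l : ℝ} (hl : 0 < l) (n : ℕ) (k : ℤ × ℤ) :
    z ∈ square (dyadicCorner a l n k) (l / 2 ^ n) ↔ dyadicIndex a l n z = k := by
  have key : ∀ (x b : ℝ) (m : ℤ), (b + m * (l / 2 ^ n) ≤ x ∧ x < b + m * (l / 2 ^ n) + l / 2 ^ n)
      ↔ ⌊(x - b) / l * 2 ^ n⌋ = m := by
    intro x b m
    rw [Int.floor_eq_iff]
    have h2 : (0 : ℝ) < 2 ^ n := by positivity
    have e : (x - b) / l * 2 ^ n = (x - b) / (l / 2 ^ n) := by field_simp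
    have hp : 0 < l / 2 ^ n := by positivity
    rw [e, le_div_iff₀ hp, div_lt_iff₀ hp]
    constructor <;> rintro ⟨h, h'⟩ <;> constructor <;> nlinarith
  rw [mem_square, dyadicIndex, Prod.ext_iff]
  exact and_congr (key _ _ _) (key _ _ _)

/-- Nestedness of the grids: a coarse index is the integer quotient of a fine index by `2^(n-m)`. -/
lemma dyadicIndex_eq_of_le {a z w : ℂ} {l : ℝ} {m n : ℕ} (hmn : m ≤ n)
    (h : dyadicIndex a l n z = dyadicIndex a l n w) :
    dyadicIndex a l m z = dyadicIndex a l m w := by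
  have key : ∀ t : ℝ, ⌊t * 2 ^ m⌋ = ⌊t * 2 ^ n⌋ / ((2 ^ (n - m) : ℕ) : ℤ) := by
    intro t
    rw [← Int.floor_div_natCast]
    congr 1
    have : (2 : ℝ) ^ n = 2 ^ m * 2 ^ (n - m) := by rw [← pow_add, Nat.add_sub_cancel' hmn]
    rw [this]; push_cast; field_simp
  simp only [dyadicIndex, Prod.mk.injEq] at h ⊢
  exact ⟨by rw [key, h.1, ← key], by rw [key, h.2, ← key]⟩

lemma dyadicIndex_zero {a z : ℂ} {l : ℝ} (hl : 0 < l) :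
    dyadicIndex a l 0 z = (0, 0) ↔ z ∈ square a l := by
  rw [← mem_square_dyadicCorner hl]; simp [dyadicCorner]

/-- The dyadic subsquare of generation `n` of `square a l` around `z`. -/
def dyadicCell (a : ℂ) (l : ℝ) (n : ℕ) (z : ℂ) : Set ℂ :=
  square (dyadicCorner a l n (dyadicIndex a l n z)) (l / 2 ^ n)

lemma mem_dyadicCell {a z w : ℂ} {l : ℝ} (hl : 0 < l) {n : ℕ} :
    w ∈ dyadicCell a l n z ↔ dyadicIndex a l n w = dyadicIndex a l n z :=
  mem_square_dyadicCorner hl n _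

lemma dyadicCell_subset {a z : ℂ} {l : ℝ} (hl : 0 < l) {m n : ℕ} (hmn : m ≤ n) :
    dyadicCell a l n z ⊆ dyadicCell a l m z := fun w hw => by
  rw [mem_dyadicCell hl] at hw ⊢
  exact dyadicIndex_eq_of_le hmn hw

lemma dyadicCell_zero {a z : ℂ} {l : ℝ} (hl : 0 < l) (hz : z ∈ square a l) :
    dyadicCell a l 0 z = square a l := by
  ext w
  rw [mem_dyadicCell hl, (dyadicIndex_zero hl).2 hz, dyadicIndex_zero hl]

lemma volume_square_pos (a : ℂ) {l : ℝ} (hl : 0 < l) : 0 < volume (square a l) := by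
  rw [volume_square]; exact ENNReal.pow_pos (ENNReal.ofReal_pos.2 hl) 2

lemma volume_square_lt_top (a : ℂ) (l : ℝ) : volume (square a l) < ⊤ := by
  rw [volume_square]; exact ENNReal.pow_lt_top ENNReal.ofReal_lt_top

lemma volume_square_half (a b : ℂ) (l : ℝ) :
    volume (square a l) = 4 * volume (square b (l / 2)) := by
  rw [volume_square, volume_square, ENNReal.ofReal_div_of_pos two_pos, ENNReal.div_eq_inv_mul,
    mul_pow, ← mul_assoc]
  norm_num
  rw [← ENNReal.inv_pow, show (2 : ℝ≥0∞) ^ 2 = 4 by norm_num, ENNReal.mul_inv_cancel (by norm_num)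
    (by norm_num), one_mul]

/-- Lebesgue differentiation along dyadic cells. A cell of side `s` around `x` lies in the disc of
radius `2s` about `x`, whose area is `4π` times larger, so the mean of `|f - f(x)|` over the cell is
at most `4π` times its mean over the disc and tends to zero at Lebesgue points. -/
lemma ae_enorm_le_of_dyadicCell_le {a : ℂ} {l : ℝ} (hl : 0 < l) {f : ℂ → ℂ} (hf : Integrable f)
    (c : ℝ≥0∞) :
    ∀ᵐ x, (∀ n, ∫⁻ y in dyadicCell a l n x, ‖f y‖ₑ ≤ c * volume (dyadicCell a l n x)) →
      ‖f x‖ₑ ≤ c := by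
  filter_upwards [IsUnifLocDoublingMeasure.ae_tendsto_average_norm_sub volume
    hf.locallyIntegrable 1] with x hx hle
  set δ : ℕ → ℝ := fun n => 2 * (l / 2 ^ n) with hδ
  have hδpos : ∀ n, 0 < δ n := fun n => by positivity
  have hδlim : Tendsto δ atTop (𝓝[>] 0) := by
    refine tendsto_nhdsWithin_iff.2 ⟨?_, Eventually.of_forall hδpos⟩
    have h1 : Tendsto (fun n : ℕ => (2 * l) * (1 / 2 : ℝ) ^ n) atTop (𝓝 ((2 * l) * 0)) :=
      (tendsto_pow_atTop_nhds_zero_of_lt_one (by norm_num) (by norm_num)).const_mul _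
    rw [mul_zero] at h1
    refine h1.congr fun n => ?_
    simp only [hδ, one_div, inv_pow]; ring
  have hlim := hx (fun _ => x) δ hδlim (Eventually.of_forall fun n => by
    simp [(hδpos n).le])
  set A : ℕ → ℝ := fun n => ⨍ y in Metric.closedBall x (δ n), ‖f y - f x‖ with hA
  have hmain : ∀ n, ‖f x‖ₑ ≤ ENNReal.ofReal (4 * Real.pi * A n) + c := by
    intro n
    have hcell : dyadicCell a l n x ⊆ Metric.closedBall x (δ n) := fun y hy => by
      have hx' : x ∈ dyadicCell a l n x := (mem_dyadicCell hl).2 rfl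
      rw [Metric.mem_closedBall, dist_eq_norm]
      exact norm_sub_le_of_mem_square hy hx'
    have hv0 : volume (dyadicCell a l n x) ≠ 0 :=
      (volume_square_pos _ (by positivity)).ne'
    have hvt : volume (dyadicCell a l n x) ≠ ⊤ := (volume_square_lt_top _ _).ne
    have hB : volume.real (Metric.closedBall x (δ n)) = 4 * Real.pi * (l / 2 ^ n) ^ 2 := by
      rw [Measure.real, Complex.volume_closedBall, ENNReal.toReal_mul, ENNReal.toReal_pow,
        ENNReal.toReal_ofReal (hδpos n).le]
      simp [hδ]; ring
    have hint : IntegrableOn (fun y => f y - f x) (Metric.closedBall x (δ n)) :=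
      hf.integrableOn.sub (integrableOn_const (measure_closedBall_lt_top.ne))
    have h1 : ∫⁻ y in Metric.closedBall x (δ n), ‖f y - f x‖ₑ
        = ENNReal.ofReal (4 * Real.pi * A n) * volume (dyadicCell a l n x) := by
      rw [← ofReal_integral_norm_eq_lintegral_enorm hint, dyadicCell, volume_square,
        ← ENNReal.ofReal_pow (by positivity), ← ENNReal.ofReal_mul' (by positivity)]
      congr 1
      have : A n = (4 * Real.pi * (l / 2 ^ n) ^ 2)⁻¹ *
          ∫ y in Metric.closedBall x (δ n), ‖f y - f x‖ := by
        simp only [hA]; rw [setAverage_eq, hB, smul_eq_mul]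
      rw [this]
      have hpi := Real.pi_pos
      have h2 : (0 : ℝ) < 2 ^ n := by positivity
      field_simp
    refine (ENNReal.mul_le_mul_iff_left hv0 hvt).1 ?_
    calc ‖f x‖ₑ * volume (dyadicCell a l n x)
        = ∫⁻ _ in dyadicCell a l n x, ‖f x‖ₑ := by rw [setLIntegral_const]
      _ ≤ ∫⁻ y in dyadicCell a l n x, (‖f y - f x‖ₑ + ‖f y‖ₑ) := by
          refine lintegral_mono fun y => ?_
          have h := enorm_sub_le (a := f y) (b := f y - f x)
          rw [sub_sub_cancel, add_comm] at h
          exact h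
      _ = (∫⁻ y in dyadicCell a l n x, ‖f y - f x‖ₑ) + ∫⁻ y in dyadicCell a l n x, ‖f y‖ₑ :=
          lintegral_add_right' _ hf.1.restrict.enorm
      _ ≤ (∫⁻ y in Metric.closedBall x (δ n), ‖f y - f x‖ₑ)
            + c * volume (dyadicCell a l n x) :=
          add_le_add (lintegral_mono_set hcell) (hle n)
      _ = _ := by rw [h1, add_mul]
  have hlim2 : Tendsto (fun n => ENNReal.ofReal (4 * Real.pi * A n) + c) atTop
      (𝓝 (ENNReal.ofReal (4 * Real.pi * 0) + c)) :=
    (ENNReal.tendsto_ofReal (hlim.const_mul _)).add_const _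
  have := ge_of_tendsto' hlim2 hmain
  simpa using this

/-- **Calderón–Zygmund stopping squares.** -/
theorem exists_stopping_squares {a : ℂ} {l : ℝ} (hl : 0 < l) {f : ℂ → ℂ} (hf : Integrable f)
    {c : ℝ≥0∞} (hc : ∫⁻ y in square a l, ‖f y‖ₑ ≤ c * volume (square a l)) :
    ∃ S : Set (ℂ × ℝ), S.Countable ∧
      (∀ p ∈ S, 0 < p.2 ∧ square p.1 p.2 ⊆ square a l ∧
        c * volume (square p.1 p.2) < ∫⁻ y in square p.1 p.2, ‖f y‖ₑ ∧
        ∫⁻ y in square p.1 p.2, ‖f y‖ₑ ≤ 4 * c * volume (square p.1 p.2)) ∧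
      S.PairwiseDisjoint (fun p => square p.1 p.2) ∧
      ∀ᵐ x, x ∈ square a l → (∀ p ∈ S, x ∉ square p.1 p.2) → ‖f x‖ₑ ≤ c := by
  set big : ℕ → ℂ → Prop := fun n x =>
    c * volume (dyadicCell a l n x) < ∫⁻ y in dyadicCell a l n x, ‖f y‖ₑ with hbig
  -- The stopping squares are the maximal cells on which the mean of `|f|` exceeds `c`, that is, the
  -- first such cell in the chain of cells shrinking to a point.
  set S : Set (ℂ × ℝ) := {p | ∃ x ∈ square a l, ∃ n,
    p = (dyadicCorner a l n (dyadicIndex a l n x), l / 2 ^ n) ∧ big n x ∧ ∀ m < n, ¬ big m x}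
    with hS
  have hcell : ∀ {n x y}, y ∈ dyadicCell a l n x → ∀ {m}, m ≤ n →
      dyadicCell a l m y = dyadicCell a l m x := by
    intro n x y hy m hm
    rw [dyadicCell, dyadicCell, dyadicIndex_eq_of_le hm ((mem_dyadicCell hl).1 hy)]
  refine ⟨S, ?_, ?_, ?_, ?_⟩
  · refine (Set.countable_range fun q : ℕ × (ℤ × ℤ) =>
      (dyadicCorner a l q.1 q.2, l / (2 : ℝ) ^ q.1)).mono ?_
    rintro p ⟨x, -, n, rfl, -⟩
    exact ⟨(n, dyadicIndex a l n x), rfl⟩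
  · rintro p ⟨x, hx, n, rfl, hn, hlt⟩
    change 0 < l / 2 ^ n ∧ dyadicCell a l n x ⊆ _ ∧ big n x ∧
      ∫⁻ y in dyadicCell a l n x, ‖f y‖ₑ ≤ 4 * c * volume (dyadicCell a l n x)
    refine ⟨by positivity, ?_, hn, ?_⟩
    · rw [← dyadicCell_zero hl hx]; exact dyadicCell_subset hl (Nat.zero_le n)
    -- Generation zero is never selected, by `hc`. Otherwise the parent was not selected, and its
    -- area is four times larger; this gives the factor 4.
    · rcases n with _ | n
      · exfalso
        simp only [hbig, dyadicCell_zero hl hx] at hn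
        exact absurd hc (not_le.2 hn)
      · have h1 := not_lt.1 (hlt n (Nat.lt_succ_self n))
        refine (lintegral_mono_set (dyadicCell_subset hl (Nat.le_succ n))).trans (h1.trans_eq ?_)
        rw [dyadicCell, volume_square_half _ (dyadicCorner a l (n + 1) (dyadicIndex a l (n + 1) x)),
          dyadicCell, pow_succ, div_div]
        ring
  · rintro p ⟨x, hx, n, rfl, hn, hlt⟩ q ⟨x', hx', n', rfl, hn', hlt'⟩ hne
    rw [Function.onFun, Set.disjoint_left]
    intro y hy hy'
    change y ∈ dyadicCell a l n x at hy
    change y ∈ dyadicCell a l n' x' at hy'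
    have b1 : ∀ {m}, m ≤ n → (big m y ↔ big m x) := fun hm => by
      simp only [hbig, hcell hy hm]
    have b2 : ∀ {m}, m ≤ n' → (big m y ↔ big m x') := fun hm => by
      simp only [hbig, hcell hy' hm]
    -- Two stopping squares sharing `y` both come from the chain of cells around `y`, where the
    -- first large generation is unique.
    have hnn : n = n' := by
      rcases lt_trichotomy n n' with h | h | h
      · exact absurd ((b2 h.le).1 ((b1 le_rfl).2 hn)) (hlt' n h)
      · exact h
      · exact absurd ((b1 h.le).1 ((b2 le_rfl).2 hn')) (hlt n' h)
    subst hnn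
    apply hne
    rw [← (mem_dyadicCell hl).1 hy, ← (mem_dyadicCell hl).1 hy']
  · filter_upwards [ae_enorm_le_of_dyadicCell_le hl hf c] with x hx hxs hxS
    refine hx fun n => ?_
    by_contra hn
    have hex : ∃ n, big n x := ⟨n, not_le.1 hn⟩
    classical
    refine hxS _ ⟨x, hxs, Nat.find hex, rfl, Nat.find_spec hex, fun m hm => Nat.find_min hex hm⟩ ?_
    exact (mem_dyadicCell hl).2 rfl

/-! ### Centred maximal functions for arbitrary measures -/

/-- Centered maximal function with respect to `μ`, over balls of dyadic radius. -/
def centeredMaximal (μ : Measure ℂ) (φ : ℂ → ℝ≥0∞) (x : ℂ) : ℝ≥0∞ :=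
  ⨆ k : ℤ, (∫⁻ y in Metric.ball x ((2 : ℝ) ^ k), φ y ∂μ) / μ (Metric.ball x ((2 : ℝ) ^ k))

lemma lintegral_ball_le_centeredMaximal {μ : Measure ℂ} {φ : ℂ → ℝ≥0∞} {x : ℂ} {k : ℤ}
    (h0 : μ (Metric.ball x ((2 : ℝ) ^ k)) ≠ 0) (ht : μ (Metric.ball x ((2 : ℝ) ^ k)) ≠ ⊤) :
    ∫⁻ y in Metric.ball x ((2 : ℝ) ^ k), φ y ∂μ
      ≤ centeredMaximal μ φ x * μ (Metric.ball x ((2 : ℝ) ^ k)) :=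
  (ENNReal.div_le_iff h0 ht).1 (le_iSup (fun k : ℤ =>
    (∫⁻ y in Metric.ball x ((2 : ℝ) ^ k), φ y ∂μ) / μ (Metric.ball x ((2 : ℝ) ^ k))) k)

lemma measurable_lintegral_ball {μ : Measure ℂ} [SFinite μ] {φ : ℂ → ℝ≥0∞} (hφ : Measurable φ)
    (r : ℝ) : Measurable fun x => ∫⁻ y in Metric.ball x r, φ y ∂μ := by
  have h : ∀ x, ∫⁻ y in Metric.ball x r, φ y ∂μ
      = ∫⁻ y, {q : ℂ × ℂ | dist q.2 q.1 < r}.indicator (fun q => φ q.2) (x, y) ∂μ := by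
    intro x
    rw [← lintegral_indicator Metric.isOpen_ball.measurableSet]
    rfl
  simp only [h]
  refine Measurable.lintegral_prod_right' ((hφ.comp measurable_snd).indicator ?_)
  exact (isOpen_lt (by fun_prop) continuous_const).measurableSet

lemma measurable_centeredMaximal {μ : Measure ℂ} [SFinite μ] {φ : ℂ → ℝ≥0∞} (hφ : Measurable φ) :
    Measurable (centeredMaximal μ φ) := by
  refine Measurable.iSup fun k => (measurable_lintegral_ball hφ _).div ?_
  have := measurable_lintegral_ball (μ := μ) (measurable_const (a := (1 : ℝ≥0∞))) ((2 : ℝ) ^ k)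
  simpa using this

/-- The Besicovitch covering theorem splits the centred balls into `N` disjoint families, with `N`
depending on the plane only. No doubling of `μ` is used; otherwise the doubling constant of the
weight would spoil the linear dependence on the characteristic. -/
lemma exists_weak_type_centeredMaximal : ∃ N : ℕ, ∀ (μ : Measure ℂ) (φ : ℂ → ℝ≥0∞) (t : ℝ≥0∞),
    t * μ {x | t < centeredMaximal μ φ x} ≤ N * ∫⁻ y, φ y ∂μ := by
  obtain ⟨N, τ, hτ, hN⟩ := HasBesicovitchCovering.no_satelliteConfig (α := ℂ)
  refine ⟨N, fun μ φ t => ?_⟩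
  -- Besicovitch's theorem needs bounded radii, so the level set is exhausted by the sets where a
  -- ball of radius at most `2^n` suffices.
  set E : ℕ → Set ℂ := fun n => {x | ∃ k : ℤ, k ≤ n ∧
    t < (∫⁻ y in Metric.ball x ((2 : ℝ) ^ k), φ y ∂μ) / μ (Metric.ball x ((2 : ℝ) ^ k))} with hE
  have hU : {x | t < centeredMaximal μ φ x} = ⋃ n, E n := by
    ext x
    simp only [centeredMaximal, lt_iSup_iff, Set.mem_ofPred_eq, hE, Set.mem_iUnion]
    constructor
    · rintro ⟨k, hk⟩
      exact ⟨k.toNat, k, Int.self_le_toNat k, hk⟩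
    · rintro ⟨n, k, -, hk⟩
      exact ⟨k, hk⟩
  have hmono : Monotone E := fun n m hnm x ⟨k, hk, h⟩ =>
    ⟨k, hk.trans (by exact_mod_cast hnm), h⟩
  rw [hU, hmono.measure_iUnion, ENNReal.mul_iSup]
  refine iSup_le fun n => ?_
  choose! k hk hlt using fun (x : ℂ) (hx : x ∈ E n) => hx
  let q : Besicovitch.BallPackage (E n) ℂ :=
    { c := fun x => x
      r := fun x => (2 : ℝ) ^ k x
      rpos := fun x => by positivity
      r_bound := (2 : ℝ) ^ (n : ℤ)
      r_le := fun x => zpow_le_zpow_right₀ (by norm_num) (hk x x.2) }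
  obtain ⟨s, hs, hcov⟩ := Besicovitch.exist_disjoint_covering_families hτ hN q
  have hcount : ∀ i, (s i).Countable := fun i => by
    refine (hs i).countable_of_nonempty_interior fun j _ => ?_
    exact (Metric.nonempty_ball.2 (q.rpos j)).mono Metric.ball_subset_interior_closedBall
  have hE' : E n ⊆ ⋃ i, ⋃ j ∈ s i, Metric.ball (q.c j) (q.r j) := by
    refine Set.Subset.trans (fun x hx => ?_) hcov
    exact ⟨⟨x, hx⟩, rfl⟩
  calc t * μ (E n) ≤ t * ∑ i, μ (⋃ j ∈ s i, Metric.ball (q.c j) (q.r j)) := by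
        gcongr
        exact (measure_mono hE').trans (measure_iUnion_fintype_le _ _)
    _ = ∑ i, t * μ (⋃ j ∈ s i, Metric.ball (q.c j) (q.r j)) := Finset.mul_sum _ _ _
    _ ≤ ∑ _i : Fin N, ∫⁻ y, φ y ∂μ := by
        refine Finset.sum_le_sum fun i _ => ?_
        have hd : (s i).PairwiseDisjoint fun j => Metric.ball (q.c j) (q.r j) :=
          (hs i).mono fun j => Metric.ball_subset_closedBall
        rw [measure_biUnion (hcount i) hd fun j _ => Metric.isOpen_ball.measurableSet,
          ← ENNReal.tsum_mul_left]
        calc _ ≤ ∑' j : s i, ∫⁻ y in Metric.ball (q.c j) (q.r j), φ y ∂μ := by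
              refine ENNReal.tsum_le_tsum fun j => ?_
              exact ENNReal.mul_le_of_le_div (hlt _ j.1.2).le
          _ = ∫⁻ y in ⋃ j ∈ s i, Metric.ball (q.c j) (q.r j), φ y ∂μ :=
              (lintegral_biUnion (hcount i) (fun j _ => Metric.isOpen_ball.measurableSet) hd
                _).symm
          _ ≤ _ := setLIntegral_le_lintegral _ _
    _ = N * ∫⁻ y, φ y ∂μ := by simp

/-- A lossy layer-cake inequality: keeping only `t` in `(a/2, a)`, where `2t ≥ a`, already yields
`a²/2`. An infinite `a` is treated by letting finite values increase. -/
lemma sq_le_lintegral_layer (a : ℝ≥0∞) :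
    a ^ 2 ≤ 2 * ∫⁻ t : ℝ, {t : ℝ | 0 < t ∧ ENNReal.ofReal t < a}.indicator
      (fun t => ENNReal.ofReal (2 * t)) t := by
  have key : ∀ r : ℝ, 0 ≤ r → ENNReal.ofReal r ≤ a →
      ENNReal.ofReal r ^ 2 ≤ 2 * ∫⁻ t : ℝ, {t : ℝ | 0 < t ∧ ENNReal.ofReal t < a}.indicator
      (fun t => ENNReal.ofReal (2 * t)) t := by
    intro r hr hra
    have h1 : ∫⁻ _ in Set.Ioo (r / 2) r, ENNReal.ofReal r
        ≤ ∫⁻ t : ℝ, {t : ℝ | 0 < t ∧ ENNReal.ofReal t < a}.indicator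
          (fun t => ENNReal.ofReal (2 * t)) t := by
      rw [← lintegral_indicator measurableSet_Ioo]
      refine lintegral_mono fun t => ?_
      by_cases ht : t ∈ Set.Ioo (r / 2) r
      · have ht0 : 0 < t := by linarith [ht.1]
        rw [Set.indicator_of_mem ht, Set.indicator_of_mem]
        · exact ENNReal.ofReal_le_ofReal (by linarith [ht.1])
        · exact ⟨ht0, ((ENNReal.ofReal_lt_ofReal_iff (ht0.trans ht.2)).2 ht.2).trans_le hra⟩
      · rw [Set.indicator_of_notMem ht]; exact zero_le
    refine le_trans (le_of_eq ?_) (mul_le_mul_right h1 2)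
    rw [setLIntegral_const, Real.volume_Ioo, ← ENNReal.ofReal_mul hr, ← ENNReal.ofReal_pow hr,
      show (2 : ℝ≥0∞) = ENNReal.ofReal 2 by simp, ← ENNReal.ofReal_mul two_pos.le]
    congr 1
    ring
  rcases eq_or_ne a ⊤ with ha | ha
  · have : (2 * ∫⁻ t : ℝ, {t : ℝ | 0 < t ∧ ENNReal.ofReal t < a}.indicator
      (fun t => ENNReal.ofReal (2 * t)) t) = ⊤ := by
      refine ENNReal.eq_top_of_forall_nnreal_le fun r => ?_
      have h := key (max r 1) (by positivity) (by simp [ha])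
      refine le_trans ?_ h
      rw [← ENNReal.ofReal_pow (by positivity), ← ENNReal.ofReal_coe_nnreal]
      refine ENNReal.ofReal_le_ofReal ?_
      have h1 := le_max_left (r : ℝ) 1
      have h2 := le_max_right (r : ℝ) 1
      nlinarith
    rw [this]; exact le_top
  · have := key a.toReal ENNReal.toReal_nonneg (ENNReal.ofReal_toReal ha).le
    rwa [ENNReal.ofReal_toReal ha] at this

lemma volume_pos_ofReal_lt_le (c : ℝ≥0∞) : volume {t : ℝ | 0 < t ∧ ENNReal.ofReal t < c} ≤ c := by
  rcases eq_or_ne c ⊤ with hc | hc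
  · rw [hc]; exact le_top
  · refine (measure_mono (t := Set.Ioo 0 c.toReal) fun t ht => ⟨ht.1, ?_⟩).trans ?_
    · exact (ENNReal.ofReal_lt_iff_lt_toReal ht.1.le hc).1 ht.2
    · rw [Real.volume_Ioo, sub_zero, ENNReal.ofReal_toReal hc]

lemma centeredMaximal_le_add {μ : Measure ℂ} {φ ψ : ℂ → ℝ≥0∞} {c : ℝ≥0∞} (hψ : Measurable ψ)
    (h : ∀ y, φ y ≤ ψ y + c) (x : ℂ) : centeredMaximal μ φ x ≤ centeredMaximal μ ψ x + c := by
  refine iSup_le fun k => ?_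
  calc _ ≤ (∫⁻ y in Metric.ball x ((2 : ℝ) ^ k), (ψ y + c) ∂μ)
        / μ (Metric.ball x ((2 : ℝ) ^ k)) := by
        gcongr; exact h _
    _ = (∫⁻ y in Metric.ball x ((2 : ℝ) ^ k), ψ y ∂μ) / μ (Metric.ball x ((2 : ℝ) ^ k))
        + c * μ (Metric.ball x ((2 : ℝ) ^ k)) / μ (Metric.ball x ((2 : ℝ) ^ k)) := by
        rw [lintegral_add_left hψ, setLIntegral_const, ENNReal.add_div]
    _ ≤ _ := by
        gcongr
        · exact le_iSup (fun k : ℤ => (∫⁻ y in Metric.ball x ((2 : ℝ) ^ k), ψ y ∂μ)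
            / μ (Metric.ball x ((2 : ℝ) ^ k))) k
        · exact ENNReal.div_le_of_le_mul le_rfl

/-- Marcinkiewicz interpolation between weak type (1,1) and the trivial bound on constants. At level
`t` the part of `φ` below `t/2` raises the maximal function by at most `t/2`, so only `φ` restricted
to `2φ > t` counts; Tonelli in `(x, t)` finishes. -/
lemma exists_strong_type_centeredMaximal : ∃ C : ℝ≥0, ∀ (μ : Measure ℂ) [SFinite μ]
    (φ : ℂ → ℝ≥0∞), Measurable φ →
    ∫⁻ x, centeredMaximal μ φ x ^ 2 ∂μ ≤ C * ∫⁻ x, φ x ^ 2 ∂μ := by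
  obtain ⟨N, hN⟩ := exists_weak_type_centeredMaximal
  refine ⟨16 * N, fun μ _ φ hφ => ?_⟩
  have hM := measurable_centeredMaximal (μ := μ) hφ
  have hlevel : ∀ t : ℝ, 0 < t → ENNReal.ofReal (2 * t) *
      μ {x | ENNReal.ofReal t < centeredMaximal μ φ x}
      ≤ 4 * N * ∫⁻ x, {x | ENNReal.ofReal t < 2 * φ x}.indicator φ x ∂μ := by
    intro t ht
    set c := ENNReal.ofReal (t / 2) with hc
    have hc2 : c + c = ENNReal.ofReal t := by
      rw [hc, ← ENNReal.ofReal_add (by positivity) (by positivity), add_halves]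
    have hset : MeasurableSet {x | ENNReal.ofReal t < 2 * φ x} :=
      measurableSet_lt measurable_const (hφ.const_mul 2)
    have hle : ∀ y, φ y ≤ {x | ENNReal.ofReal t < 2 * φ x}.indicator φ y + c := by
      intro y
      by_cases hy : ENNReal.ofReal t < 2 * φ y
      · rw [Set.indicator_of_mem (by exact hy)]; exact le_self_add
      · rw [Set.indicator_of_notMem (by exact hy), zero_add]
        rw [not_lt, ← hc2, ← two_mul] at hy
        exact (ENNReal.mul_le_mul_iff_right (by norm_num) (by norm_num)).1 hy
    have hsub : {x | ENNReal.ofReal t < centeredMaximal μ φ x} ⊆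
        {x | c < centeredMaximal μ ({x | ENNReal.ofReal t < 2 * φ x}.indicator φ) x} := by
      intro x hx
      have h1 := lt_of_lt_of_le hx (centeredMaximal_le_add (μ := μ) (hφ.indicator hset) hle x)
      refine (ENNReal.add_lt_add_iff_right (a := c) ENNReal.ofReal_ne_top).1 ?_
      rwa [hc2]
    have h4 : ENNReal.ofReal (2 * t) = 4 * c := by
      rw [hc, show (4 : ℝ≥0∞) = ENNReal.ofReal 4 by simp, ← ENNReal.ofReal_mul (by norm_num)]
      congr 1; ring
    rw [h4, mul_assoc, mul_assoc]
    refine mul_le_mul_right ?_ 4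
    exact (mul_le_mul_right (measure_mono hsub) c).trans (hN μ _ c)
  calc ∫⁻ x, centeredMaximal μ φ x ^ 2 ∂μ
      ≤ ∫⁻ x, (2 * ∫⁻ t : ℝ, {t : ℝ | 0 < t ∧ ENNReal.ofReal t < centeredMaximal μ φ x}.indicator
      (fun t => ENNReal.ofReal (2 * t)) t) ∂μ := lintegral_mono fun x => sq_le_lintegral_layer _
    _ = 2 * ∫⁻ x, (∫⁻ t : ℝ, {q : ℂ × ℝ | 0 < q.2 ∧ ENNReal.ofReal q.2 <
        centeredMaximal μ φ q.1}.indicator (fun q => ENNReal.ofReal (2 * q.2)) (x, t)) ∂μ := by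
        rw [lintegral_const_mul' _ _ (by norm_num)]; rfl
    _ = 2 * ∫⁻ t : ℝ, ∫⁻ x, {q : ℂ × ℝ | 0 < q.2 ∧ ENNReal.ofReal q.2 <
        centeredMaximal μ φ q.1}.indicator (fun q => ENNReal.ofReal (2 * q.2)) (x, t) ∂μ := by
        rw [lintegral_lintegral_swap]
        refine Measurable.aemeasurable ?_
        refine Measurable.indicator (by fun_prop) ?_
        exact (measurableSet_lt measurable_const measurable_snd).inter
          (measurableSet_lt (by fun_prop) (hM.comp measurable_fst))
    _ ≤ 2 * ∫⁻ t : ℝ, 4 * N * ∫⁻ x, {q : ℂ × ℝ | 0 < q.2 ∧ ENNReal.ofReal q.2 <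
        2 * φ q.1}.indicator (fun q => φ q.1) (x, t) ∂μ := by
        refine mul_le_mul_right (lintegral_mono fun t => ?_) 2
        by_cases ht : 0 < t
        · have e1 : ∀ x, {q : ℂ × ℝ | 0 < q.2 ∧ ENNReal.ofReal q.2 <
              centeredMaximal μ φ q.1}.indicator (fun q => ENNReal.ofReal (2 * q.2)) (x, t)
              = {x | ENNReal.ofReal t < centeredMaximal μ φ x}.indicator
                (fun _ => ENNReal.ofReal (2 * t)) x := by
            intro x; simp [Set.indicator_apply, ht]
          have e2 : ∀ x, {q : ℂ × ℝ | 0 < q.2 ∧ ENNReal.ofReal q.2 <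
              2 * φ q.1}.indicator (fun q => φ q.1) (x, t)
              = {x | ENNReal.ofReal t < 2 * φ x}.indicator φ x := by
            intro x; simp [Set.indicator_apply, ht]
          simp only [e1, e2]
          rw [lintegral_indicator_const (measurableSet_lt measurable_const hM)]
          exact hlevel t ht
        · simp [ht]
    _ = 2 * (4 * N * ∫⁻ x, (∫⁻ t : ℝ, {q : ℂ × ℝ | 0 < q.2 ∧ ENNReal.ofReal q.2 <
        2 * φ q.1}.indicator (fun q => φ q.1) (x, t)) ∂μ) := by
        rw [lintegral_const_mul' _ _ (by finiteness), lintegral_lintegral_swap]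
        refine Measurable.aemeasurable ?_
        refine Measurable.indicator (by fun_prop) ?_
        exact (measurableSet_lt measurable_const measurable_fst).inter
          (measurableSet_lt (ENNReal.measurable_ofReal.comp measurable_fst)
            ((hφ.comp measurable_snd).const_mul 2))
    _ ≤ 2 * (4 * N * ∫⁻ x, 2 * φ x ^ 2 ∂μ) := by
        gcongr with x
        have e1 : ∀ t, {q : ℂ × ℝ | 0 < q.2 ∧ ENNReal.ofReal q.2 <
              2 * φ q.1}.indicator (fun q => φ q.1) (x, t)
              = {t : ℝ | 0 < t ∧ ENNReal.ofReal t < 2 * φ x}.indicator (fun _ => φ x) t := by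
            intro t; simp [Set.indicator_apply]
        simp only [e1]
        refine (lintegral_indicator_const_le _ _).trans ?_
        refine (mul_le_mul_right (volume_pos_ofReal_lt_le _) _).trans_eq ?_
        ring
    _ = _ := by
        rw [lintegral_const_mul' _ _ (by norm_num)]
        push_cast
        ring

lemma volume_ball_pos (x : ℂ) {r : ℝ} (hr : 0 < r) : volume (Metric.ball x r) ≠ 0 :=
  (Metric.measure_ball_pos _ _ hr).ne'

/-- Split into dyadic annuli starting at the power of two with `2^k ≤ l < 2^(k+1)`. The `n`-th
annulus contributes at most `8π 2⁻ⁿ` times the maximal function, and the geometric sum is `16π`. -/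
lemma lintegral_tail_le_centeredMaximal {l : ℝ} (hl : 0 < l) (φ : ℂ → ℝ≥0∞) (x : ℂ) :
    ∫⁻ y in {y | l ≤ ‖x - y‖}, ENNReal.ofReal (l / ‖x - y‖ ^ 3) * φ y
      ≤ ENNReal.ofReal (16 * Real.pi) * centeredMaximal volume φ x := by
  obtain ⟨k, hk, hk'⟩ := exists_mem_Ico_zpow hl (by norm_num : (1 : ℝ) < 2)
  have h2 : (0 : ℝ) < 2 ^ k := by positivity
  set A : ℕ → Set ℂ := fun n => {y | 2 ^ k * 2 ^ n ≤ ‖x - y‖ ∧ ‖x - y‖ < 2 ^ k * 2 ^ (n + 1)}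
    with hA
  have hcov : {y | l ≤ ‖x - y‖} ⊆ ⋃ n, A n := by
    intro y hy
    have h1 : 1 ≤ ‖x - y‖ / 2 ^ k := by rw [le_div_iff₀ h2, one_mul]; exact hk.trans hy
    obtain ⟨n, hn, hn'⟩ := exists_nat_pow_near h1 (by norm_num : (1 : ℝ) < 2)
    rw [le_div_iff₀ h2] at hn
    rw [div_lt_iff₀ h2] at hn'
    refine Set.mem_iUnion.2 ⟨n, ?_, ?_⟩ <;> linarith
  have hn : ∀ n, ∫⁻ y in A n, ENNReal.ofReal (l / ‖x - y‖ ^ 3) * φ y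
      ≤ ENNReal.ofReal (8 * Real.pi * (1 / 2) ^ n) * centeredMaximal volume φ x := by
    intro n
    have hm : Measurable fun y : ℂ => ‖x - y‖ := by fun_prop
    have hAm : MeasurableSet (A n) :=
      (measurableSet_le measurable_const hm).inter (measurableSet_lt hm measurable_const)
    have hr : (2 : ℝ) ^ k * 2 ^ (n + 1) = 2 ^ (k + ((n + 1 : ℕ) : ℤ)) := by
      rw [zpow_add₀ two_ne_zero, zpow_natCast]
    have hAb : A n ⊆ Metric.ball x (2 ^ (k + ((n + 1 : ℕ) : ℤ))) := by
      intro y hy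
      rw [Metric.mem_ball, dist_comm, dist_eq_norm, ← hr]; exact hy.2
    set c : ℝ := 2 * 2 ^ k / (2 ^ k * 2 ^ n) ^ 3 with hc
    calc ∫⁻ y in A n, ENNReal.ofReal (l / ‖x - y‖ ^ 3) * φ y
        ≤ ∫⁻ y in A n, ENNReal.ofReal c * φ y := by
          refine setLIntegral_mono' hAm fun y hy => ?_
          gcongr
          rw [hc]
          have hl2 : l ≤ 2 * 2 ^ k := by rw [zpow_add_one₀ two_ne_zero] at hk'; linarith
          gcongr
          exact hy.1
      _ = ENNReal.ofReal c * ∫⁻ y in A n, φ y := lintegral_const_mul' _ _ ENNReal.ofReal_ne_top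
      _ ≤ ENNReal.ofReal c * (centeredMaximal volume φ x *
            volume (Metric.ball x ((2 : ℝ) ^ (k + ((n + 1 : ℕ) : ℤ))))) := by
          gcongr
          exact (lintegral_mono_set hAb).trans (lintegral_ball_le_centeredMaximal
            (volume_ball_pos _ (by positivity)) measure_ball_lt_top.ne)
      _ = _ := by
          rw [← hr, Complex.volume_ball, ← ENNReal.ofReal_pow (by positivity),
            ← ENNReal.ofReal_coe_nnreal, mul_left_comm, ← ENNReal.ofReal_mul (by positivity),
            ← ENNReal.ofReal_mul (by positivity), mul_comm]
          congr 2
          rw [hc, NNReal.coe_real_pi, pow_succ, one_div, inv_pow]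
          field_simp
          ring
  calc _ ≤ ∫⁻ y in ⋃ n, A n, ENNReal.ofReal (l / ‖x - y‖ ^ 3) * φ y := lintegral_mono_set hcov
    _ ≤ ∑' n, ∫⁻ y in A n, ENNReal.ofReal (l / ‖x - y‖ ^ 3) * φ y := lintegral_iUnion_le _ _
    _ ≤ ∑' n, ENNReal.ofReal (8 * Real.pi * (1 / 2) ^ n) * centeredMaximal volume φ x :=
        ENNReal.tsum_le_tsum hn
    _ = _ := by
        rw [ENNReal.tsum_mul_right, ← ENNReal.ofReal_tsum_of_nonneg (fun n => by positivity)
          (summable_geometric_two.mul_left _), tsum_mul_left, tsum_geometric_two]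
        congr 2; ring

/-! ### Calderón–Zygmund decomposition and weak type (1,1) -/

lemma integrable_beurlingKernel_mul {e : ℝ} (he : 0 < e) {f : ℂ → ℂ} (hf : Integrable f) (x : ℂ) :
    Integrable (fun y => beurlingKernel e (x - y) * f y) := by
  have hc := continuous_beurlingKernel he
  exact hf.bdd_mul (by fun_prop : Continuous fun y => beurlingKernel e (x - y)).aestronglyMeasurable
    (Eventually.of_forall fun y => norm_beurlingKernel_le_const he _)

lemma regBeurling_add {e : ℝ} (he : 0 < e) {f g : ℂ → ℂ} (hf : Integrable f) (hg : Integrable g)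
    (x : ℂ) : regBeurling e (f + g) x = regBeurling e f x + regBeurling e g x := by
  simp only [regBeurling, Pi.add_apply, mul_add]
  exact integral_add (integrable_beurlingKernel_mul he hf x) (integrable_beurlingKernel_mul he hg x)

lemma continuous_regBeurling {e : ℝ} (he : 0 < e) {f : ℂ → ℂ} (hf : Integrable f) :
    Continuous (regBeurling e f) := by
  have hc := continuous_beurlingKernel he
  refine continuous_of_dominated (bound := fun y => 1 / e ^ 2 * ‖f y‖)
    (fun x => (integrable_beurlingKernel_mul he hf x).1)
    (fun x => Eventually.of_forall fun y => ?_) (hf.norm.const_mul _)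
    (Eventually.of_forall fun y => by fun_prop)
  rw [norm_mul]
  exact mul_le_mul_of_nonneg_right (norm_beurlingKernel_le_const he _) (norm_nonneg _)

/-- The bound blows up as `e → 0` and serves only qualitatively: for finiteness, for data of zero
mass, and to start the induction over stopping generations. -/
lemma enorm_regBeurling_le {e : ℝ} (he : 0 < e) (f : ℂ → ℂ) (x : ℂ) :
    ‖regBeurling e f x‖ₑ ≤ ENNReal.ofReal (1 / e ^ 2) * ∫⁻ y, ‖f y‖ₑ := by
  refine (enorm_integral_le_lintegral_enorm _).trans ?_
  rw [← lintegral_const_mul' _ _ ENNReal.ofReal_ne_top]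
  refine lintegral_mono fun y => ?_
  rw [enorm_mul]
  gcongr
  rw [← ofReal_norm]
  exact ENNReal.ofReal_le_ofReal (norm_beurlingKernel_le_const he _)

lemma lintegral_tail_le {l : ℝ} (hl : 0 < l) (a : ℂ) :
    ∫⁻ y in {y | l ≤ ‖y - a‖}, ENNReal.ofReal (l / ‖y - a‖ ^ 3) ≤ ENNReal.ofReal (16 * Real.pi) := by
  have h := lintegral_tail_le_centeredMaximal hl (fun _ => 1) a
  simp only [mul_one, norm_sub_rev a] at h
  refine h.trans ?_
  conv_rhs => rw [← mul_one (ENNReal.ofReal _)]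
  gcongr
  refine iSup_le fun k => ?_
  rw [setLIntegral_const, one_mul]
  exact ENNReal.div_self_le_one

/-- Mean zero allows the kernel at the corner `a` to be subtracted, and smoothness then gives the
integrable decay `l/|x - a|³`. Outside the disc of radius `4l` both kernel arguments have modulus at
least `l`; `384 = 24 · 16`. -/
lemma lintegral_atom_le {e l : ℝ} (he : 0 < e) (hl : 0 < l) {a : ℂ} {b : ℂ → ℂ} (hb : Integrable b)
    (h0 : ∫ y in square a l, b y = 0) :
    ∫⁻ x in (Metric.ball a (4 * l))ᶜ, ‖∫ y in square a l, beurlingKernel e (x - y) * b y‖ₑ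
      ≤ ENNReal.ofReal (384 * Real.pi) * ∫⁻ y in square a l, ‖b y‖ₑ := by
  have hpt : ∀ x ∈ (Metric.ball a (4 * l))ᶜ,
      ‖∫ y in square a l, beurlingKernel e (x - y) * b y‖ₑ
      ≤ 24 * (∫⁻ y in square a l, ‖b y‖ₑ) * ENNReal.ofReal (l / ‖x - a‖ ^ 3) := by
    intro x hx
    have hxa : 4 * l ≤ ‖x - a‖ := by
      simpa [Metric.mem_ball, dist_eq_norm] using hx
    have e1 : ∫ y in square a l, beurlingKernel e (x - y) * b y
        = ∫ y in square a l, (beurlingKernel e (x - y) - beurlingKernel e (x - a)) * b y := by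
      simp only [sub_mul]
      rw [integral_sub (integrable_beurlingKernel_mul he hb x).integrableOn
        (hb.const_mul _).integrableOn, integral_const_mul, h0]
      simp
    rw [e1]
    refine (enorm_integral_le_lintegral_enorm _).trans ?_
    rw [mul_comm (24 : ℝ≥0∞), mul_assoc, ← lintegral_mul_const' _ _ (by finiteness)]
    refine setLIntegral_mono' (measurableSet_square _ _) fun y hy => ?_
    rw [enorm_mul, mul_comm]
    gcongr
    rw [← ofReal_norm, show (24 : ℝ≥0∞) = ENNReal.ofReal 24 by simp,
      ← ENNReal.ofReal_mul (by norm_num)]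
    refine ENNReal.ofReal_le_ofReal ?_
    have ha : a ∈ square a l := by rw [mem_square]; constructor <;> constructor <;> linarith
    have hya := norm_sub_le_of_mem_square hy ha
    have hxy : ‖x - a‖ ≤ ‖x - y‖ + ‖y - a‖ := by
      simpa using norm_add_le (x - y) (y - a)
    rw [norm_sub_rev, ← mul_div_assoc]
    refine norm_beurlingKernel_sub_le hl (by linarith) (by linarith) ?_
    rwa [show x - a - (x - y) = y - a by ring]
  calc _ ≤ ∫⁻ x in (Metric.ball a (4 * l))ᶜ,
        24 * (∫⁻ y in square a l, ‖b y‖ₑ) * ENNReal.ofReal (l / ‖x - a‖ ^ 3) :=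
        setLIntegral_mono' Metric.isOpen_ball.measurableSet.compl hpt
    _ ≤ ∫⁻ x in {y | l ≤ ‖y - a‖},
        24 * (∫⁻ y in square a l, ‖b y‖ₑ) * ENNReal.ofReal (l / ‖x - a‖ ^ 3) := by
        refine lintegral_mono_set fun x hx => ?_
        have hxa : 4 * l ≤ ‖x - a‖ := by simpa [Metric.mem_ball, dist_eq_norm] using hx
        change l ≤ ‖x - a‖
        linarith
    _ ≤ 24 * (∫⁻ y in square a l, ‖b y‖ₑ) * ENNReal.ofReal (16 * Real.pi) := by
        rw [lintegral_const_mul' _ _ (ENNReal.mul_ne_top (by norm_num)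
          ((setLIntegral_le_lintegral _ _).trans_lt hb.2).ne)]
        gcongr
        exact lintegral_tail_le hl a
    _ = _ := by
        rw [mul_right_comm, show (24 : ℝ≥0∞) = ENNReal.ofReal 24 by simp,
          ← ENNReal.ofReal_mul (by norm_num)]
        congr 2; ring

/-- **Calderón–Zygmund decomposition** of an integrable function supported in a square. -/
theorem exists_calderon_zygmund {a : ℂ} {l : ℝ} (hl : 0 < l) {f : ℂ → ℂ} (hf : Integrable f)
    (hsupp : ∀ x ∉ square a l, f x = 0)
    {c : ℝ≥0∞} (hc : ∫⁻ y in square a l, ‖f y‖ₑ ≤ c * volume (square a l)) :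
    ∃ (S : Set (ℂ × ℝ)) (g b : ℂ → ℂ), S.Countable ∧
      S.PairwiseDisjoint (fun p => square p.1 p.2) ∧
      (∀ p ∈ S, 0 < p.2 ∧ c * volume (square p.1 p.2) ≤ ∫⁻ y in square p.1 p.2, ‖f y‖ₑ ∧
        ∫ y in square p.1 p.2, b y = 0 ∧
        ∫⁻ y in square p.1 p.2, ‖b y‖ₑ ≤ 2 * ∫⁻ y in square p.1 p.2, ‖f y‖ₑ) ∧
      Integrable g ∧ Integrable b ∧ f = g + b ∧ (∀ᵐ x, ‖g x‖ₑ ≤ 4 * c) ∧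
      ∫⁻ x, ‖g x‖ₑ ≤ ∫⁻ x, ‖f x‖ₑ ∧ (∀ x ∉ ⋃ p ∈ S, square p.1 p.2, b x = 0) := by
  obtain ⟨S, hcount, hS, hdisj, hae⟩ := exists_stopping_squares hl hf hc
  classical
  set U := ⋃ p ∈ S, square p.1 p.2 with hU
  have hUm : MeasurableSet U := MeasurableSet.biUnion hcount fun p _ => measurableSet_square _ _
  -- The good function is the mean of `f` on each stopping square and `f` elsewhere; disjointness
  -- makes the choice of square irrelevant.
  set g : ℂ → ℂ := fun x => if h : ∃ p ∈ S, x ∈ square p.1 p.2 then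
    ⨍ y in square h.choose.1 h.choose.2, f y else f x with hg
  have gp : ∀ p ∈ S, ∀ x ∈ square p.1 p.2, g x = ⨍ y in square p.1 p.2, f y := by
    intro p hp x hx
    have h : ∃ p ∈ S, x ∈ square p.1 p.2 := ⟨p, hp, hx⟩
    have : h.choose = p := hdisj.elim_set h.choose_spec.1 hp x h.choose_spec.2 hx
    simp only [hg, dif_pos h, this]
  have gU : ∀ x ∉ U, g x = f x := by
    intro x hx
    have h : ¬ ∃ p ∈ S, x ∈ square p.1 p.2 := by simpa [hU] using hx
    simp only [hg, dif_neg h]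
  have gbound : ∀ p ∈ S, ‖⨍ y in square p.1 p.2, f y‖ₑ * volume (square p.1 p.2)
      ≤ ∫⁻ y in square p.1 p.2, ‖f y‖ₑ := by
    intro p hp
    have h0 := (volume_square_pos p.1 (hS p hp).1).ne'
    have ht := (volume_square_lt_top p.1 p.2).ne
    have hr : volume.real (square p.1 p.2) ≠ 0 := (ENNReal.toReal_pos h0 ht).ne'
    have : ((volume.real (square p.1 p.2) : ℝ)) • ⨍ y in square p.1 p.2, f y
        = ∫ y in square p.1 p.2, f y := by
      rw [setAverage_eq, smul_inv_smul₀ hr]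
    have h3 : ‖volume.real (square p.1 p.2)‖ₑ = volume (square p.1 p.2) := by
      rw [Real.enorm_eq_ofReal measureReal_nonneg, Measure.real, ENNReal.ofReal_toReal ht]
    rw [← h3, mul_comm, ← enorm_smul, this]
    exact enorm_integral_le_lintegral_enorm _
  have glint : ∀ p ∈ S, ∫⁻ y in square p.1 p.2, ‖g y‖ₑ ≤ ∫⁻ y in square p.1 p.2, ‖f y‖ₑ := by
    intro p hp
    rw [setLIntegral_congr_fun (measurableSet_square _ _)
      (fun y hy => by rw [gp p hp y hy]), setLIntegral_const]
    exact gbound p hp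
  have gm : AEStronglyMeasurable g volume := by
    rw [← Measure.restrict_univ (μ := (volume : Measure ℂ)), ← Set.union_compl_self U,
      aestronglyMeasurable_union_iff]
    constructor
    · have : Countable S := hcount.to_subtype
      rw [hU, Set.biUnion_eq_iUnion, aestronglyMeasurable_iUnion_iff]
      intro p
      refine (aestronglyMeasurable_const (b := ⨍ y in square p.1.1 p.1.2, f y)).congr ?_
      filter_upwards [ae_restrict_mem (measurableSet_square _ _)] with y hy
      rw [gp p p.2 y hy]
    · refine hf.1.restrict.congr ?_
      filter_upwards [ae_restrict_mem hUm.compl] with y hy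
      rw [gU y hy]
  have gl1 : ∫⁻ x, ‖g x‖ₑ ≤ ∫⁻ x, ‖f x‖ₑ := by
    rw [← lintegral_add_compl _ hUm, ← lintegral_add_compl (fun x => ‖f x‖ₑ) hUm]
    refine add_le_add ?_ (le_of_eq ?_)
    · rw [hU, lintegral_biUnion hcount (fun p _ => measurableSet_square _ _) hdisj,
        lintegral_biUnion hcount (fun p _ => measurableSet_square _ _) hdisj]
      exact ENNReal.tsum_le_tsum fun p => glint p p.2
    · exact setLIntegral_congr_fun hUm.compl fun y hy => by rw [gU y hy]
  have gi : Integrable g := ⟨gm, gl1.trans_lt hf.2⟩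
  refine ⟨S, g, f - g, hcount, hdisj, ?_, gi, hf.sub gi, by simp, ?_, gl1, ?_⟩
  · intro p hp
    obtain ⟨h1, -, h2, -⟩ := hS p hp
    have h0 := (volume_square_pos p.1 h1).ne'
    have ht := (volume_square_lt_top p.1 p.2).ne
    have hr : volume.real (square p.1 p.2) ≠ 0 := (ENNReal.toReal_pos h0 ht).ne'
    refine ⟨h1, h2.le, ?_, ?_⟩
    · simp only [Pi.sub_apply]
      rw [integral_sub hf.integrableOn gi.integrableOn,
        setIntegral_congr_fun (measurableSet_square _ _) (fun y hy => gp p hp y hy),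
        setIntegral_const, setAverage_eq, smul_inv_smul₀ hr, sub_self]
    · calc ∫⁻ y in square p.1 p.2, ‖(f - g) y‖ₑ
          ≤ ∫⁻ y in square p.1 p.2, (‖f y‖ₑ + ‖g y‖ₑ) :=
            lintegral_mono fun y => enorm_sub_le
        _ ≤ _ := by
            rw [lintegral_add_left' hf.1.restrict.enorm, two_mul]
            exact add_le_add le_rfl (glint p hp)
  · filter_upwards [hae] with x hx
    by_cases hxU : x ∈ U
    · simp only [hU, Set.mem_iUnion] at hxU
      obtain ⟨p, hp, hxp⟩ := hxU
      obtain ⟨h1, -, -, h2⟩ := hS p hp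
      rw [gp p hp x hxp]
      exact (ENNReal.mul_le_mul_iff_left (volume_square_pos p.1 h1).ne'
        (volume_square_lt_top p.1 p.2).ne).1 ((gbound p hp).trans h2)
    · rw [gU x hxU]
      have hc4 : c ≤ 4 * c := le_mul_of_one_le_left zero_le (by norm_num)
      by_cases hxs : x ∈ square a l
      · refine (hx hxs fun p hp hxp => hxU ?_).trans hc4
        simp only [hU, Set.mem_iUnion]
        exact ⟨p, hp, hxp⟩
      · rw [hsupp x hxs]; simp
  · intro x hx
    simp [gU x hx]

/-- Weak type `(1,1)` of the regularised Beurling transform, uniformly in the regularisation. -/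
theorem exists_weak_type_regBeurling : ∃ C : ℝ≥0, ∀ (e : ℝ) (_ : 0 < e) (a : ℂ) (l : ℝ) (_ : 0 < l)
    (f : ℂ → ℂ) (_ : Integrable f) (_ : ∀ x ∉ square a l, f x = 0) (c : ℝ≥0∞) (_ : c ≠ 0)
    (_ : c ≠ ⊤) (_ : ∫⁻ y in square a l, ‖f y‖ₑ ≤ c * volume (square a l)),
    c * volume {x | c < ‖regBeurling e f x‖ₑ} ≤ C * ∫⁻ y, ‖f y‖ₑ := by
  obtain ⟨C, hC⟩ := exists_lintegral_regBeurling_sq_le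
  -- The good part gives `16C`, by Chebyshev in `L²` and `|g| ≤ 4c`. The bad part off the enlarged
  -- discs gives `2 · 768π`, and the discs themselves give `16π`.
  refine ⟨16 * C + 1552 * NNReal.pi, fun e he a l hl f hf hsupp c hc0 hct hc => ?_⟩
  obtain ⟨S, g, b, hcount, hdisj, hS, gi, bi, hfgb, gle, gl1, bU⟩ :=
    exists_calderon_zygmund hl hf hsupp hc
  have hcS : Countable S := hcount.to_subtype
  set I := ∫⁻ y, ‖f y‖ₑ with hI
  set d := c / 2 with hd
  have hd0 : d ≠ 0 := by simp [hd, hc0]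
  have hdt : d ≠ ⊤ := by simp [hd, hct, ENNReal.div_eq_top]
  have hdd : c = 2 * d := by rw [hd, ENNReal.mul_div_cancel (by norm_num) (by norm_num)]
  set V := ⋃ p : S, Metric.ball p.1.1 (4 * p.1.2) with hV
  have hVm : MeasurableSet V := MeasurableSet.iUnion fun p => Metric.isOpen_ball.measurableSet
  have hsumI : ∑' p : S, ∫⁻ y in square p.1.1 p.1.2, ‖f y‖ₑ ≤ I := by
    rw [← lintegral_iUnion (fun p : S => measurableSet_square _ _)
      (fun p q hpq => hdisj p.2 q.2 (fun h => hpq (Subtype.ext h)))]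
    exact setLIntegral_le_lintegral _ _
  have hgood : d * (d * volume {x | d ≤ ‖regBeurling e g x‖ₑ}) ≤ d * (8 * C * I) := by
    have h1 : d ^ 2 * volume {x | d ^ 2 ≤ ‖regBeurling e g x‖ₑ ^ 2}
        ≤ ∫⁻ x, ‖regBeurling e g x‖ₑ ^ 2 :=
      mul_meas_ge_le_lintegral ((continuous_regBeurling he gi).measurable.enorm.pow_const 2) _
    have h2 : {x | d ≤ ‖regBeurling e g x‖ₑ} ⊆ {x | d ^ 2 ≤ ‖regBeurling e g x‖ₑ ^ 2} :=
      fun x (hx : d ≤ _) => show d ^ 2 ≤ _ from pow_le_pow_left' hx 2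
    calc d * (d * volume {x | d ≤ ‖regBeurling e g x‖ₑ})
        = d ^ 2 * volume {x | d ≤ ‖regBeurling e g x‖ₑ} := by ring
      _ ≤ C * ∫⁻ x, ‖g x‖ₑ ^ 2 :=
          (mul_le_mul_right (measure_mono h2) _).trans (h1.trans (hC e he g gi))
      _ ≤ C * ∫⁻ x, 4 * c * ‖g x‖ₑ := by
          refine mul_le_mul_right (lintegral_mono_ae ?_) _
          filter_upwards [gle] with x hx
          rw [sq]
          exact mul_le_mul_left hx _
      _ ≤ C * (4 * c * I) := by
          rw [lintegral_const_mul' _ _ (by finiteness)]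
          gcongr
      _ = _ := by rw [hdd]; ring
  have hbadpt : ∀ x, ‖regBeurling e b x‖ₑ
      ≤ ∑' p : S, ‖∫ y in square p.1.1 p.1.2, beurlingKernel e (x - y) * b y‖ₑ := by
    intro x
    have h1 : regBeurling e b x = ∫ y in ⋃ p : S, square p.1.1 p.1.2,
        beurlingKernel e (x - y) * b y := by
      rw [regBeurling, setIntegral_eq_integral_of_forall_compl_eq_zero]
      intro y hy
      rw [bU y (by simpa using hy), mul_zero]
    rw [h1, integral_iUnion (fun p : S => measurableSet_square _ _)
      (fun p q hpq => hdisj p.2 q.2 (fun h => hpq (Subtype.ext h)))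
      (integrable_beurlingKernel_mul he bi x).integrableOn]
    exact enorm_tsum_le_tsum_enorm
  have hKm : ∀ p : S, AEMeasurable (fun x => ‖∫ y in square p.1.1 p.1.2,
      beurlingKernel e (x - y) * b y‖ₑ) volume := by
    intro p
    have h := continuous_regBeurling he (bi.indicator (measurableSet_square p.1.1 p.1.2))
    have h2 : ∀ x, regBeurling e ((square p.1.1 p.1.2).indicator b) x
        = ∫ y in square p.1.1 p.1.2, beurlingKernel e (x - y) * b y := by
      intro x
      rw [regBeurling, ← integral_indicator (measurableSet_square _ _)]
      congr 1; ext y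
      by_cases hy : y ∈ square p.1.1 p.1.2 <;> simp [hy]
    simp only [← h2]
    exact h.measurable.enorm.aemeasurable
  have hbad : d * volume ({x | d ≤ ‖regBeurling e b x‖ₑ} ∩ Vᶜ)
      ≤ ENNReal.ofReal (768 * Real.pi) * I := by
    have h1 : d * (volume.restrict Vᶜ) {x | d ≤ ‖regBeurling e b x‖ₑ}
        ≤ ∫⁻ x in Vᶜ, ‖regBeurling e b x‖ₑ :=
      mul_meas_ge_le_lintegral (continuous_regBeurling he bi).measurable.enorm _
    refine (mul_le_mul_right (Measure.le_restrict_apply _ _) _).trans (h1.trans ?_)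
    calc ∫⁻ x in Vᶜ, ‖regBeurling e b x‖ₑ
        ≤ ∫⁻ x in Vᶜ, ∑' p : S, ‖∫ y in square p.1.1 p.1.2, beurlingKernel e (x - y) * b y‖ₑ :=
          lintegral_mono hbadpt
      _ = ∑' p : S, ∫⁻ x in Vᶜ, ‖∫ y in square p.1.1 p.1.2, beurlingKernel e (x - y) * b y‖ₑ :=
          lintegral_tsum fun p => (hKm p).restrict
      _ ≤ ∑' p : S, ENNReal.ofReal (384 * Real.pi) *
            (2 * ∫⁻ y in square p.1.1 p.1.2, ‖f y‖ₑ) := by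
          refine ENNReal.tsum_le_tsum fun p => ?_
          obtain ⟨hp, -, hp0, hpb⟩ := hS p p.2
          refine (lintegral_mono_set (Set.compl_subset_compl.2 (Set.subset_iUnion _ p))).trans
            ((lintegral_atom_le he hp bi hp0).trans ?_)
          gcongr
      _ ≤ ENNReal.ofReal (384 * Real.pi) * (2 * I) := by
          rw [ENNReal.tsum_mul_left, ENNReal.tsum_mul_left]
          gcongr
      _ = _ := by
          rw [← mul_assoc, show (2 : ℝ≥0∞) = ENNReal.ofReal 2 by simp,
            ← ENNReal.ofReal_mul (by positivity)]
          congr 2; ring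
  have hVvol : c * volume V ≤ ENNReal.ofReal (16 * Real.pi) * I := by
    calc c * volume V ≤ c * ∑' p : S, volume (Metric.ball p.1.1 (4 * p.1.2)) := by
          gcongr; exact measure_iUnion_le _
      _ = ∑' p : S, c * volume (Metric.ball p.1.1 (4 * p.1.2)) := ENNReal.tsum_mul_left.symm
      _ ≤ ∑' p : S, ENNReal.ofReal (16 * Real.pi) * ∫⁻ y in square p.1.1 p.1.2, ‖f y‖ₑ := by
          refine ENNReal.tsum_le_tsum fun p => ?_
          obtain ⟨hp, hp2, -⟩ := hS p p.2
          refine le_trans (le_of_eq ?_) (mul_le_mul_right hp2 _)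
          rw [Complex.volume_ball, volume_square, ENNReal.ofReal_mul (by norm_num),
            ENNReal.ofReal_mul (by norm_num), ← NNReal.coe_real_pi, ENNReal.ofReal_coe_nnreal]
          norm_num
          ring
      _ ≤ _ := by rw [ENNReal.tsum_mul_left]; gcongr
  have hsub : {x | c < ‖regBeurling e f x‖ₑ} ⊆ {x | d ≤ ‖regBeurling e g x‖ₑ} ∪
      ({x | d ≤ ‖regBeurling e b x‖ₑ} ∩ Vᶜ) ∪ V := by
    intro x hx
    by_cases hxV : x ∈ V
    · exact Or.inr hxV
    by_cases hxg : d ≤ ‖regBeurling e g x‖ₑ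
    · exact Or.inl (Or.inl hxg)
    refine Or.inl (Or.inr ⟨?_, hxV⟩)
    by_contra hxb
    have hx' : c < ‖regBeurling e f x‖ₑ := hx
    rw [hfgb, regBeurling_add he gi bi, hdd, two_mul] at hx'
    exact absurd (hx'.trans_le (enorm_add_le _ _))
      (not_lt.2 (add_le_add (not_le.1 hxg).le (not_le.1 hxb).le))
  have hgood' := (ENNReal.mul_le_mul_iff_right hd0 hdt).1 hgood
  calc c * volume {x | c < ‖regBeurling e f x‖ₑ}
      ≤ c * (volume {x | d ≤ ‖regBeurling e g x‖ₑ} +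
        volume ({x | d ≤ ‖regBeurling e b x‖ₑ} ∩ Vᶜ) + volume V) := by
        gcongr
        exact (measure_mono hsub).trans ((measure_union_le _ _).trans
          (add_le_add (measure_union_le _ _) le_rfl))
    _ = 2 * (d * volume {x | d ≤ ‖regBeurling e g x‖ₑ}) +
        2 * (d * volume ({x | d ≤ ‖regBeurling e b x‖ₑ} ∩ Vᶜ)) + c * volume V := by
        rw [hdd]; ring
    _ ≤ 2 * (8 * C * I) + 2 * (ENNReal.ofReal (768 * Real.pi) * I)
        + ENNReal.ofReal (16 * Real.pi) * I := by gcongr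
    _ = _ := by
        rw [ENNReal.ofReal_mul (by norm_num), ENNReal.ofReal_mul (by norm_num),
          ← NNReal.coe_real_pi, ENNReal.ofReal_coe_nnreal]
        push_cast
        simp only [ENNReal.ofReal_ofNat]
        ring

/-! ### Localisation to triple squares and the sparse step -/

/-- The square concentric with `square a l` and three times as large. -/
def tripleSquare (a : ℂ) (l : ℝ) : Set ℂ := square ⟨a.re - l, a.im - l⟩ (3 * l)

lemma measurableSet_tripleSquare (a : ℂ) (l : ℝ) : MeasurableSet (tripleSquare a l) :=
  measurableSet_square _ _

lemma mem_tripleSquare {a z : ℂ} {l : ℝ} : z ∈ tripleSquare a l ↔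
    (a.re - l ≤ z.re ∧ z.re < a.re + 2 * l) ∧ (a.im - l ≤ z.im ∧ z.im < a.im + 2 * l) := by
  rw [tripleSquare, mem_square]
  refine and_congr (and_congr Iff.rfl ?_) (and_congr Iff.rfl ?_) <;>
  constructor <;> intro h <;> dsimp only at * <;> linarith

lemma square_subset_tripleSquare {a : ℂ} {l : ℝ} : square a l ⊆ tripleSquare a l := by
  intro z hz
  rw [mem_square] at hz
  rw [mem_tripleSquare]
  refine ⟨⟨?_, ?_⟩, ?_, ?_⟩ <;> linarith [hz.1.1, hz.1.2, hz.2.1, hz.2.2]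

lemma le_norm_sub_of_notMem_tripleSquare {a x y : ℂ} {l : ℝ} (hx : x ∈ square a l)
    (hy : y ∉ tripleSquare a l) : l ≤ ‖x - y‖ := by
  by_contra h
  apply hy
  have h1 := (abs_le.1 (Complex.abs_re_le_norm (x - y)))
  have h2 := (abs_le.1 (Complex.abs_im_le_norm (x - y)))
  rw [Complex.sub_re] at h1
  rw [Complex.sub_im] at h2
  rw [mem_square] at hx
  rw [mem_tripleSquare]
  refine ⟨⟨?_, ?_⟩, ?_, ?_⟩ <;> linarith [hx.1.1, hx.1.2, hx.2.1, hx.2.2]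

lemma tripleSquare_subset {a b : ℂ} {l m : ℝ} (hm : 0 < m) (h : square b m ⊆ square a l) :
    tripleSquare b m ⊆ tripleSquare a l := by
  have hb := h (mem_square.2 ⟨⟨le_rfl, by linarith⟩, ⟨le_rfl, by linarith⟩⟩)
  rw [mem_square] at hb
  -- If the right edge stuck out, the half-open small square would contain a point on the missing
  -- right edge of the large one.
  have h1 : b.re + m ≤ a.re + l := by
    by_contra hc
    have := h (a := ⟨a.re + l, b.im⟩) (mem_square.2 ⟨⟨hb.1.2.le, by dsimp only; linarith⟩,
      ⟨le_rfl, by dsimp only; linarith⟩⟩)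
    rw [mem_square] at this
    exact absurd this.1.2 (lt_irrefl _)
  have h2 : b.im + m ≤ a.im + l := by
    by_contra hc
    have := h (a := ⟨b.re, a.im + l⟩) (mem_square.2 ⟨⟨le_rfl, by dsimp only; linarith⟩,
      ⟨hb.2.2.le, by dsimp only; linarith⟩⟩)
    rw [mem_square] at this
    exact absurd this.2.2 (lt_irrefl _)
  intro z hz
  rw [mem_tripleSquare] at hz ⊢
  refine ⟨⟨?_, ?_⟩, ?_, ?_⟩ <;> linarith [hz.1.1, hz.1.2, hz.2.1, hz.2.2, hb.1.1, hb.2.1]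

lemma exists_zpow_two_near {r : ℝ} (hr : 0 < r) : ∃ k : ℤ, r < 2 ^ k ∧ (2 : ℝ) ^ k ≤ 2 * r := by
  obtain ⟨k, hk, hk'⟩ := exists_mem_Ico_zpow hr (by norm_num : (1 : ℝ) < 2)
  refine ⟨k + 1, hk', ?_⟩
  rw [zpow_add_one₀ two_ne_zero]
  linarith

/-- `∫_{3Q} |f|` divided by the area of `Q`. -/
def tripleAverage (f : ℂ → ℂ) (a : ℂ) (l : ℝ) : ℝ≥0∞ :=
  (∫⁻ y in tripleSquare a l, ‖f y‖ₑ) / volume (square a l)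

lemma tripleAverage_mul_volume (f : ℂ → ℂ) (a : ℂ) {l : ℝ} (hl : 0 < l) :
    tripleAverage f a l * volume (square a l) = ∫⁻ y in tripleSquare a l, ‖f y‖ₑ :=
  ENNReal.div_mul_cancel (volume_square_pos a hl).ne' (volume_square_lt_top a l).ne

lemma tripleAverage_ne_top {f : ℂ → ℂ} (hf : Integrable f) (a : ℂ) {l : ℝ} (hl : 0 < l) :
    tripleAverage f a l ≠ ⊤ :=
  ENNReal.div_ne_top ((setLIntegral_le_lintegral _ _).trans_lt hf.2).ne (volume_square_pos a hl).ne'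

lemma lintegral_indicator_tripleSquare (f : ℂ → ℂ) (a : ℂ) (l : ℝ) :
    ∫⁻ y, ‖(tripleSquare a l).indicator f y‖ₑ = ∫⁻ y in tripleSquare a l, ‖f y‖ₑ := by
  rw [← lintegral_indicator (measurableSet_tripleSquare a l)]
  refine lintegral_congr fun y => ?_
  rw [enorm_indicator_eq_indicator_enorm]

lemma volume_tripleSquare (a : ℂ) (l : ℝ) :
    volume (tripleSquare a l) = 9 * volume (square a l) := by
  rw [tripleSquare, volume_square, volume_square, ENNReal.ofReal_mul (by norm_num), mul_pow]
  norm_num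

lemma exists_weak_type_local : ∃ A : ℝ≥0, 1 ≤ A ∧ ∀ (e : ℝ) (_ : 0 < e) (f : ℂ → ℂ)
    (_ : Integrable f) (a : ℂ) (l : ℝ) (_ : 0 < l),
    32 * volume {x | A * tripleAverage f a l <
      ‖regBeurling e ((tripleSquare a l).indicator f) x‖ₑ} ≤ volume (square a l) ∧
    32 * volume {x | A * tripleAverage f a l <
      centeredMaximal volume (fun y => ‖(tripleSquare a l).indicator f y‖ₑ) x}
        ≤ volume (square a l) := by
  obtain ⟨C, hC⟩ := exists_weak_type_regBeurling
  obtain ⟨N, hN⟩ := exists_weak_type_centeredMaximal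
  -- The multiples of 32 make both exceptional sets at most `1/32` of the square. The summand 1
  -- ensures that the level dominates the mean over the triple square, as the weak type bound
  -- requires.
  refine ⟨32 * C + 32 * N + 1, le_add_self, fun e he f hf a l hl => ?_⟩
  set A : ℝ≥0 := 32 * C + 32 * N + 1 with hA
  have hCA : 32 * (C : ℝ≥0∞) ≤ A := by
    rw [hA]; exact_mod_cast (le_self_add.trans le_self_add)
  have hNA : 32 * (N : ℝ≥0∞) ≤ A := by
    rw [hA]; exact_mod_cast (le_add_self.trans le_self_add)
  have h1A : (1 : ℝ≥0∞) ≤ A := by rw [hA]; exact_mod_cast le_add_self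
  have hA0 : (A : ℝ≥0∞) ≠ 0 := (zero_lt_one.trans_le h1A).ne'
  set t := tripleAverage f a l with ht
  set m := ∫⁻ y in tripleSquare a l, ‖f y‖ₑ with hm
  have htm : t * volume (square a l) = m := tripleAverage_mul_volume f a hl
  have htt : t ≠ ⊤ := tripleAverage_ne_top hf a hl
  have hmm := lintegral_indicator_tripleSquare f a l
  rw [← hm] at hmm
  have conclude : ∀ (D : ℝ≥0∞) (s : Set ℂ), 32 * D ≤ A → t ≠ 0 → A * t * volume s ≤ D * m →
      32 * volume s ≤ volume (square a l) := by
    intro D s hD ht0 h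
    rw [← ENNReal.mul_le_mul_iff_right (a := A * t) (mul_ne_zero hA0 ht0)
      (ENNReal.mul_ne_top ENNReal.coe_ne_top htt)]
    calc A * t * (32 * volume s) = 32 * (A * t * volume s) := by ring
      _ ≤ 32 * (D * m) := by gcongr
      _ = 32 * D * m := by ring
      _ ≤ A * m := by gcongr
      _ = _ := by rw [← htm]; ring
  -- The weak type bound assumes a nonzero level; at level zero `f` vanishes almost everywhere on
  -- the triple square and both level sets are empty.
  by_cases ht0 : t = 0
  · have hm0 : m = 0 := by rw [← htm, ht0, zero_mul]
    constructor
    · have : {x | A * t < ‖regBeurling e ((tripleSquare a l).indicator f) x‖ₑ} = ∅ := by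
        refine Set.eq_empty_of_forall_notMem fun x hx => ?_
        have h := enorm_regBeurling_le he ((tripleSquare a l).indicator f) x
        rw [hmm, hm0, mul_zero] at h
        exact absurd (lt_of_lt_of_le hx h) not_lt_zero
      rw [this]; simp
    · have : {x | A * t < centeredMaximal volume
          (fun y => ‖(tripleSquare a l).indicator f y‖ₑ) x} = ∅ := by
        refine Set.eq_empty_of_forall_notMem fun x hx => ?_
        have h : centeredMaximal volume
          (fun y => ‖(tripleSquare a l).indicator f y‖ₑ) x ≤ 0 := by
          refine iSup_le fun k => ?_
          have : ∫⁻ y in Metric.ball x ((2 : ℝ) ^ k), ‖(tripleSquare a l).indicator f y‖ₑ = 0 :=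
            le_antisymm ((setLIntegral_le_lintegral _ _).trans (hmm.trans hm0).le) zero_le
          rw [this, ENNReal.zero_div]
        exact absurd (lt_of_lt_of_le hx h) not_lt_zero
      rw [this]; simp
  · constructor
    · refine conclude C _ hCA ht0 ?_
      rw [← hmm]
      refine hC e he ⟨a.re - l, a.im - l⟩ (3 * l) (by positivity) _
        (hf.indicator (measurableSet_tripleSquare a l))
        (fun x hx => Set.indicator_of_notMem hx f) _ (mul_ne_zero hA0 ht0)
        (ENNReal.mul_ne_top ENNReal.coe_ne_top htt) ?_
      refine (setLIntegral_le_lintegral _ _).trans ?_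
      rw [hmm, ← htm]
      change _ ≤ A * t * volume (tripleSquare a l)
      rw [volume_tripleSquare]
      calc t * volume (square a l) = 1 * t * (1 * volume (square a l)) := by ring
        _ ≤ A * t * (9 * volume (square a l)) := by gcongr; norm_num
    · refine conclude N _ hNA ht0 ?_
      rw [← hmm]
      exact hN volume _ _

/-- One step of the stopping-time argument behind sparse domination. -/
theorem exists_sparse_step : ∃ A : ℝ≥0, ∀ (e : ℝ) (_ : 0 < e) (f : ℂ → ℂ) (_ : Integrable f)
    (a : ℂ) (l : ℝ) (_ : 0 < l), ∃ S : Set (ℂ × ℝ), S.Countable ∧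
      (∀ p ∈ S, 0 < p.2 ∧ square p.1 p.2 ⊆ square a l) ∧
      S.PairwiseDisjoint (fun p => square p.1 p.2) ∧
      2 * ∑' p : S, volume (square p.1.1 p.1.2) ≤ volume (square a l) ∧
      (∀ᵐ x, x ∈ square a l → (∀ p ∈ S, x ∉ square p.1 p.2) →
        ‖regBeurling e ((tripleSquare a l).indicator f) x‖ₑ ≤ A * tripleAverage f a l) ∧
      ∀ p ∈ S, ∀ x ∈ square p.1 p.2, ‖regBeurling e ((tripleSquare a l).indicator f) x‖ₑ ≤
        ‖regBeurling e ((tripleSquare p.1 p.2).indicator f) x‖ₑ + A * tripleAverage f a l := by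
  obtain ⟨A, hA1, hA⟩ := exists_weak_type_local
  -- Compared at a good point `x'` of a subsquare `P`, the three terms bound the oscillation of the
  -- far part between `x` and `x'`, the value of `T(f 1_{3Q})` at `x'`, and the value of `T(f
  -- 1_{3P})` at `x'`.
  refine ⟨384 * NNReal.pi * A + A + A * (196 * NNReal.pi * A), fun e he f hf a l hl => ?_⟩
  set t := tripleAverage f a l with ht
  set φ : ℂ → ℝ≥0∞ := fun y => ‖(tripleSquare a l).indicator f y‖ₑ with hφ
  obtain ⟨hT, hM⟩ := hA e he f hf a l hl
  have hfi := hf.indicator (measurableSet_tripleSquare a l)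
  set E : Set ℂ := {x | x ∈ square a l ∧ (A * t <
      ‖regBeurling e ((tripleSquare a l).indicator f) x‖ₑ ∨ A * t < centeredMaximal volume φ x)}
    with hE
  -- measurable hull, since `φ` is only a.e. measurable
  set E' := toMeasurable volume E with hE'
  have hEE' : E ⊆ E' := subset_toMeasurable _ _
  have hE'm : MeasurableSet E' := measurableSet_toMeasurable _ _
  have hEvol : 16 * volume E' ≤ volume (square a l) := by
    rw [hE', measure_toMeasurable]
    have h1 : volume E ≤ volume {x | A * t <
        ‖regBeurling e ((tripleSquare a l).indicator f) x‖ₑ} +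
        volume {x | A * t < centeredMaximal volume φ x} :=
      (measure_mono fun x hx => hx.2).trans (measure_union_le _ _)
    have h2 : 2 * (16 * volume E) ≤ 2 * volume (square a l) := by
      calc 2 * (16 * volume E) = 32 * volume E := by ring
        _ ≤ 32 * volume {x | A * t <
        ‖regBeurling e ((tripleSquare a l).indicator f) x‖ₑ} +
        32 * volume {x | A * t < centeredMaximal volume φ x} := by
            rw [← mul_add]; gcongr
        _ ≤ _ := by rw [two_mul]; exact add_le_add hT hM
    exact (ENNReal.mul_le_mul_iff_right (by norm_num) (by norm_num)).1 h2
  have hE't : volume E' ≠ ⊤ := by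
    intro h
    rw [h, ENNReal.mul_top (by norm_num), top_le_iff] at hEvol
    exact (volume_square_lt_top a l).ne hEvol
  set u : ℂ → ℂ := E'.indicator fun _ => 1 with hu
  have hui : Integrable u := (integrable_indicator_iff hE'm).2 (integrableOn_const hE't)
  have hulint : ∀ s, MeasurableSet s → ∫⁻ y in s, ‖u y‖ₑ = volume (E' ∩ s) := by
    intro s hs
    simp only [hu, enorm_indicator_eq_indicator_enorm, enorm_one]
    rw [lintegral_indicator_const hE'm, one_mul, Measure.restrict_apply hE'm]
  have h8 : (8 : ℝ≥0∞) * (1 / 8) = 1 := by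
    rw [one_div]; exact ENNReal.mul_inv_cancel (by norm_num) (by norm_num)
  -- Height `1/8` applied to the indicator of the exceptional set: its density in each selected
  -- square lies between `1/8` and `1/2`. The lower bound limits the total area to `8|E'| ≤ |Q|/2`,
  -- and the upper bound leaves good points in every selected square. Almost every point outside the
  -- selected squares lies outside `E'`.
  obtain ⟨S, hcount, hS, hdisj, hae⟩ := exists_stopping_squares hl hui (c := 1 / 8) (by
    rw [hulint _ (measurableSet_square a l)]
    refine (ENNReal.mul_le_mul_iff_right (a := 8) (by norm_num) (by norm_num)).1 ?_
    rw [← mul_assoc, h8, one_mul]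
    refine le_trans ?_ hEvol
    calc 8 * volume (E' ∩ square a l) ≤ 16 * volume E' := by
          gcongr
          · norm_num
          · exact Set.inter_subset_left)
  have hcS : Countable S := hcount.to_subtype
  have hAt1 : A * t ≤ (384 * NNReal.pi * A + A + A * (196 * NNReal.pi * A) : ℝ≥0) * t := by
    gcongr
    rw [add_assoc]
    exact le_self_add.trans le_add_self
  refine ⟨S, hcount, fun p hp => ⟨(hS p hp).1, (hS p hp).2.1⟩, hdisj, ?_, ?_, ?_⟩
  · calc 2 * ∑' p : S, volume (square p.1.1 p.1.2)
        ≤ 2 * ∑' p : S, 8 * volume (E' ∩ square p.1.1 p.1.2) := by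
          gcongr with p
          obtain ⟨-, -, h, -⟩ := hS p p.2
          rw [hulint _ (measurableSet_square _ _)] at h
          have := mul_le_mul_right h.le 8
          rwa [← mul_assoc, h8, one_mul] at this
      _ = 16 * ∑' p : S, volume (E' ∩ square p.1.1 p.1.2) := by
          rw [ENNReal.tsum_mul_left, ← mul_assoc]; norm_num
      _ ≤ 16 * volume E' := by
          rw [← measure_iUnion (fun p q hpq => (hdisj p.2 q.2
            (fun h => hpq (Subtype.ext h))).mono Set.inter_subset_right Set.inter_subset_right)
            (fun p => hE'm.inter (measurableSet_square _ _))]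
          gcongr
          exact Set.iUnion_subset fun p => Set.inter_subset_left
      _ ≤ _ := hEvol
  · filter_upwards [hae] with x hx hxs hxS
    have h := hx hxs hxS
    by_contra hcon
    have hxE : x ∈ E' := hEE' ⟨hxs, Or.inl (hAt1.trans_lt (not_le.1 hcon))⟩
    rw [hu, Set.indicator_of_mem hxE, enorm_one] at h
    have := mul_le_mul_right h 8
    rw [h8] at this
    norm_num at this
  · intro p hp x hx
    obtain ⟨hp0, hpsub, -, hp4⟩ := hS p hp
    rw [hulint _ (measurableSet_square _ _)] at hp4
    obtain ⟨hTp, -⟩ := hA e he f hf p.1 p.2 hp0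
    set t' := tripleAverage f p.1 p.2 with ht'
    set B : Set ℂ := {x | A * t' < ‖regBeurling e ((tripleSquare p.1 p.2).indicator f) x‖ₑ} with hB
    set v := volume (square p.1 p.2) with hv
    have hv0 : v ≠ 0 := (volume_square_pos _ hp0).ne'
    have hvt : v ≠ ⊤ := (volume_square_lt_top _ _).ne
    -- `E'` fills at most half of the subsquare and `B` at most `1/32`, together `17/32 < 1`.
    obtain ⟨x', hx', hx'E, hx'B⟩ : ∃ x' ∈ square p.1 p.2, x' ∉ E' ∧ x' ∉ B := by
      by_contra! hcon
      have hsub : square p.1 p.2 ⊆ (E' ∩ square p.1 p.2) ∪ B := fun z hz => by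
        by_cases hzE : z ∈ E'
        · exact Or.inl ⟨hzE, hz⟩
        · exact Or.inr (hcon z hz hzE)
      have h1 : v ≤ volume (E' ∩ square p.1 p.2) + volume B :=
        (measure_mono hsub).trans (measure_union_le _ _)
      have h2 : 32 * v ≤ 17 * v := by
        calc 32 * v ≤ 32 * volume (E' ∩ square p.1 p.2) + 32 * volume B := by
              rw [← mul_add]; gcongr
          _ ≤ 32 * (4 * (1 / 8) * v) + v := by gcongr
          _ = 16 * (8 * (1 / 8)) * v + v := by ring
          _ = 17 * v := by rw [h8]; ring
      have h3 := (ENNReal.mul_le_mul_iff_left hv0 hvt).1 h2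
      norm_num at h3
    have hx'Q := hpsub hx'
    have hx'1 : ‖regBeurling e ((tripleSquare a l).indicator f) x'‖ₑ ≤ A * t := by
      by_contra h
      exact hx'E (hEE' ⟨hx'Q, Or.inl (not_le.1 h)⟩)
    have hx'2 : centeredMaximal volume φ x' ≤ A * t := by
      by_contra h
      exact hx'E (hEE' ⟨hx'Q, Or.inr (not_le.1 h)⟩)
    have hx'3 : ‖regBeurling e ((tripleSquare p.1 p.2).indicator f) x'‖ₑ ≤ A * t' := not_lt.1 hx'B
    have h3sub := tripleSquare_subset hp0 hpsub
    have htt' : t' ≤ 196 * NNReal.pi * (A * t) := by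
      rw [ht', tripleAverage]
      refine ENNReal.div_le_of_le_mul ?_
      -- Points of the triple square are at distance at most 6 sides from `x'`, so a dyadic radius
      -- between 7 and 14 sides captures it; `196 = 14²`.
      obtain ⟨k, hk1, hk2⟩ := exists_zpow_two_near (r := 7 * p.2) (by positivity)
      have hball : tripleSquare p.1 p.2 ⊆ Metric.ball x' (2 ^ k) := by
        intro y hy
        rw [Metric.mem_ball, dist_eq_norm]
        have := norm_sub_le_of_mem_square hy (square_subset_tripleSquare hx')
        linarith
      calc ∫⁻ y in tripleSquare p.1 p.2, ‖f y‖ₑ = ∫⁻ y in tripleSquare p.1 p.2, φ y := by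
            refine setLIntegral_congr_fun (measurableSet_tripleSquare _ _) fun y hy => ?_
            simp only [hφ, Set.indicator_of_mem (h3sub hy)]
        _ ≤ ∫⁻ y in Metric.ball x' (2 ^ k), φ y := lintegral_mono_set hball
        _ ≤ centeredMaximal volume φ x' * volume (Metric.ball x' ((2 : ℝ) ^ k)) :=
            lintegral_ball_le_centeredMaximal (volume_ball_pos _ (by positivity))
              measure_ball_lt_top.ne
        _ ≤ (A * t) * (ENNReal.ofReal (14 * p.2) ^ 2 * NNReal.pi) := by
            rw [Complex.volume_ball]
            gcongr
            linarith
        _ = _ := by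
            rw [volume_square, ENNReal.ofReal_mul (by norm_num)]
            simp only [ENNReal.ofReal_ofNat]
            ring
    set F := (tripleSquare a l).indicator f with hF
    set G := (tripleSquare p.1 p.2).indicator f with hG
    have hGi : Integrable G := hf.indicator (measurableSet_tripleSquare _ _)
    have hR : ∀ z, regBeurling e F z = regBeurling e G z + regBeurling e (F - G) z := by
      intro z
      rw [← regBeurling_add he hGi (hfi.sub hGi)]
      congr 1; abel
    have hdiff : ‖regBeurling e (F - G) x - regBeurling e (F - G) x'‖ₑ
        ≤ 384 * NNReal.pi * (A * t) := by
      have e1 : regBeurling e (F - G) x - regBeurling e (F - G) x'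
          = ∫ y, (beurlingKernel e (x - y) - beurlingKernel e (x' - y)) * (F - G) y := by
        simp only [sub_mul]
        rw [integral_sub (integrable_beurlingKernel_mul he (hfi.sub hGi) x)
          (integrable_beurlingKernel_mul he (hfi.sub hGi) x')]
        rfl
      rw [e1]
      refine (enorm_integral_le_lintegral_enorm _).trans ?_
      have hpt : ∀ y, ‖(beurlingKernel e (x - y) - beurlingKernel e (x' - y)) * (F - G) y‖ₑ
          ≤ {y | p.2 ≤ ‖x' - y‖}.indicator
            (fun y => 24 * (ENNReal.ofReal (p.2 / ‖x' - y‖ ^ 3) * φ y)) y := by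
        intro y
        by_cases hy : y ∈ tripleSquare p.1 p.2
        · have : (F - G) y = 0 := by
            simp only [Pi.sub_apply, hF, hG, Set.indicator_of_mem hy,
              Set.indicator_of_mem (h3sub hy), sub_self]
          rw [this]; simp
        · have hFG : (F - G) y = F y := by
            simp only [Pi.sub_apply, hG, Set.indicator_of_notMem hy, sub_zero]
          have h1 := le_norm_sub_of_notMem_tripleSquare hx hy
          have h2 := le_norm_sub_of_notMem_tripleSquare hx' hy
          rw [hFG, Set.indicator_of_mem (by exact h2), enorm_mul, ← mul_assoc]
          refine mul_le_mul_left ?_ _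
          rw [← ofReal_norm, show (24 : ℝ≥0∞) = ENNReal.ofReal 24 by simp,
            ← ENNReal.ofReal_mul (by norm_num)]
          refine ENNReal.ofReal_le_ofReal ?_
          rw [norm_sub_rev, ← mul_div_assoc]
          refine norm_beurlingKernel_sub_le hp0 h2 h1 ?_
          rw [show x' - y - (x - y) = x' - x by ring]
          exact norm_sub_le_of_mem_square hx' hx
      have hmeas : MeasurableSet {y | p.2 ≤ ‖x' - y‖} :=
        (isClosed_le continuous_const (by fun_prop)).measurableSet
      calc _ ≤ ∫⁻ y, {y | p.2 ≤ ‖x' - y‖}.indicator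
            (fun y => 24 * (ENNReal.ofReal (p.2 / ‖x' - y‖ ^ 3) * φ y)) y := lintegral_mono hpt
        _ = 24 * ∫⁻ y in {y | p.2 ≤ ‖x' - y‖}, ENNReal.ofReal (p.2 / ‖x' - y‖ ^ 3) * φ y := by
            rw [lintegral_indicator hmeas, lintegral_const_mul' _ _ (by norm_num)]
        _ ≤ 24 * (ENNReal.ofReal (16 * Real.pi) * (A * t)) := by
            gcongr
            exact (lintegral_tail_le_centeredMaximal hp0 φ x').trans (by gcongr)
        _ = _ := by
            rw [ENNReal.ofReal_mul (by norm_num), ← NNReal.coe_real_pi, ENNReal.ofReal_coe_nnreal]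
            simp only [ENNReal.ofReal_ofNat]
            ring
    have hRx' : ‖regBeurling e (F - G) x'‖ₑ ≤ A * t + A * t' := by
      have : regBeurling e (F - G) x' = regBeurling e F x' - regBeurling e G x' := by
        rw [hR x']; ring
      rw [this]
      exact enorm_sub_le.trans (add_le_add hx'1 hx'3)
    calc ‖regBeurling e F x‖ₑ
        = ‖regBeurling e G x + ((regBeurling e (F - G) x - regBeurling e (F - G) x')
            + regBeurling e (F - G) x')‖ₑ := by rw [hR x]; congr 1; ring
      _ ≤ ‖regBeurling e G x‖ₑ + (384 * NNReal.pi * (A * t) + (A * t + A * t')) := by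
          refine (enorm_add_le _ _).trans (add_le_add le_rfl ?_)
          exact (enorm_add_le _ _).trans (add_le_add hdiff hRx')
      _ ≤ ‖regBeurling e G x‖ₑ + (384 * NNReal.pi * (A * t) + (A * t +
            A * (196 * NNReal.pi * (A * t)))) := by gcongr
      _ = _ := by push_cast; ring

/-! ### `A₂` densities and the linear weighted bound for regularised transforms -/

lemma lintegral_withDensity_mul_inv {W h : ℂ → ℝ≥0∞} (hW : Measurable W) (h0 : ∀ x, W x ≠ 0)
    (ht : ∀ x, W x ≠ ⊤) (hh : Measurable h) {s : Set ℂ} (hs : MeasurableSet s) :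
    ∫⁻ y in s, h y * (W y)⁻¹ ∂(volume.withDensity W) = ∫⁻ y in s, h y := by
  have hm : Measurable fun y => h y * (W y)⁻¹ := hh.mul hW.inv
  rw [restrict_withDensity hs, lintegral_withDensity_eq_lintegral_mul _ hW hm]
  refine lintegral_congr fun y => ?_
  simp only [Pi.mul_apply]
  rw [mul_left_comm, ENNReal.mul_inv_cancel (h0 y) (ht y), mul_one]

/-- A pointwise finite, nonvanishing density with `A₂` characteristic at most `K`. -/
structure IsA2Density (W : ℂ → ℝ≥0∞) (K : ℝ≥0∞) : Prop where
  measurable : Measurable W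
  ne_zero : ∀ x, W x ≠ 0
  ne_top : ∀ x, W x ≠ ⊤
  const_ne_top : K ≠ ⊤
  le : ∀ (x : ℂ) (R : ℝ), 0 < R → (∫⁻ y in Metric.ball x R, W y) *
    (∫⁻ y in Metric.ball x R, (W y)⁻¹) ≤ K * volume (Metric.ball x R) ^ 2

namespace IsA2Density

variable {W : ℂ → ℝ≥0∞} {K : ℝ≥0∞}

lemma inv (h : IsA2Density W K) : IsA2Density (fun x => (W x)⁻¹) K where
  measurable := h.measurable.inv
  ne_zero x := ENNReal.inv_ne_zero.2 (h.ne_top x)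
  ne_top x := ENNReal.inv_ne_top.2 (h.ne_zero x)
  const_ne_top := h.const_ne_top
  le x R hR := by simpa only [inv_inv, mul_comm] using h.le x R hR

lemma withDensity_ball (x : ℂ) (R : ℝ) :
    volume.withDensity W (Metric.ball x R) = ∫⁻ y in Metric.ball x R, W y :=
  withDensity_apply _ Metric.isOpen_ball.measurableSet

lemma lintegral_ball_ne_zero (h : IsA2Density W K) (x : ℂ) {R : ℝ} (hR : 0 < R) :
    ∫⁻ y in Metric.ball x R, W y ≠ 0 := by
  intro h0
  rw [lintegral_eq_zero_iff h.measurable] at h0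
  have h1 : ∀ᵐ y ∂volume.restrict (Metric.ball x R), False := by
    filter_upwards [h0] with y hy using h.ne_zero y hy
  have h2 : volume.restrict (Metric.ball x R) = 0 := by
    simpa [ae_iff] using h1
  rw [Measure.restrict_eq_zero] at h2
  exact volume_ball_pos x hR h2

/-- A finite bound on the product of the masses of `W` and `W⁻¹`, neither of which can vanish, makes
each of them finite. -/
lemma lintegral_ball_ne_top (h : IsA2Density W K) (x : ℂ) {R : ℝ} (hR : 0 < R) :
    ∫⁻ y in Metric.ball x R, W y ≠ ⊤ := by
  intro ht
  have h1 := h.le x R hR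
  rw [ht, ENNReal.top_mul (h.inv.lintegral_ball_ne_zero x hR), top_le_iff] at h1
  exact ENNReal.mul_ne_top h.const_ne_top (ENNReal.pow_ne_top measure_ball_lt_top.ne) h1

lemma lintegral_ball_le (h : IsA2Density W K) {g : ℂ → ℝ≥0∞} (hg : Measurable g) (x : ℂ) (k : ℤ) :
    ∫⁻ y in Metric.ball x ((2 : ℝ) ^ k), g y ≤
      centeredMaximal (volume.withDensity W) (fun y => g y * (W y)⁻¹) x *
        ∫⁻ y in Metric.ball x ((2 : ℝ) ^ k), W y := by
  have hk : (0 : ℝ) < 2 ^ k := by positivity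
  rw [← lintegral_withDensity_mul_inv h.measurable h.ne_zero h.ne_top hg
    Metric.isOpen_ball.measurableSet, ← withDensity_ball]
  refine lintegral_ball_le_centeredMaximal ?_ ?_ <;> rw [withDensity_ball]
  · exact h.lintegral_ball_ne_zero x hk
  · exact h.lintegral_ball_ne_top x hk

/-- The product of the two weighted maximal functions controlling the bilinear form
`∫ |T f| g`. -/
def maximalProduct (W : ℂ → ℝ≥0∞) (f : ℂ → ℂ) (g : ℂ → ℝ≥0∞) (x : ℂ) : ℝ≥0∞ :=
  centeredMaximal (volume.withDensity fun y => (W y)⁻¹) (fun y => ‖f y‖ₑ * W y) x *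
    centeredMaximal (volume.withDensity W) (fun y => g y * (W y)⁻¹) x

lemma measurable_maximalProduct (h : IsA2Density W K) {f : ℂ → ℂ} {g : ℂ → ℝ≥0∞}
    (hf : Measurable f) (hg : Measurable g) : Measurable (maximalProduct W f g) :=
  (measurable_centeredMaximal (hf.enorm.mul h.measurable)).mul
    (measurable_centeredMaximal (hg.mul h.measurable.inv))

/-- The point where the `A₂` condition produces the factor `K`. On a ball `B` about `x` containing
`3Q`, write `∫ |f| = ∫ (|f| W) W⁻¹` and `∫ g = ∫ (g W⁻¹) W`. Each is a weighted maximal function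
times the mass of its own measure, and the product of the two masses is at most `K |B|²`. -/
lemma tripleAverage_mul_lintegral_le (h : IsA2Density W K) {f : ℂ → ℂ} {g : ℂ → ℝ≥0∞}
    (hf : Measurable f) (hg : Measurable g) {a : ℂ} {l : ℝ} (hl : 0 < l) {x : ℂ}
    (hx : x ∈ square a l) :
    tripleAverage f a l * ∫⁻ y in square a l, g y ≤
      (196 * NNReal.pi) ^ 2 * K * volume (square a l) * maximalProduct W f g x := by
  obtain ⟨k, hk1, hk2⟩ := exists_zpow_two_near (r := 7 * l) (by positivity)
  have hk : (0 : ℝ) < 2 ^ k := by positivity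
  have hball : tripleSquare a l ⊆ Metric.ball x (2 ^ k) := by
    intro y hy
    rw [Metric.mem_ball, dist_eq_norm]
    have := norm_sub_le_of_mem_square hy (square_subset_tripleSquare hx)
    linarith
  have hv0 := (volume_square_pos a hl).ne'
  have hvt := (volume_square_lt_top a l).ne
  have hvol : volume (Metric.ball x ((2 : ℝ) ^ k)) ≤ 196 * NNReal.pi * volume (square a l) := by
    calc _ ≤ ENNReal.ofReal (14 * l) ^ 2 * NNReal.pi := by
          rw [Complex.volume_ball]; gcongr; linarith
      _ = _ := by
          rw [volume_square, ENNReal.ofReal_mul (by norm_num)]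
          simp only [ENNReal.ofReal_ofNat]
          ring
  have hf' := h.inv.lintegral_ball_le hf.enorm x k
  simp only [inv_inv] at hf'
  have hg' := h.lintegral_ball_le hg x k
  refine (ENNReal.mul_le_mul_iff_left hv0 hvt).1 ?_
  calc tripleAverage f a l * (∫⁻ y in square a l, g y) * volume (square a l)
      = (∫⁻ y in tripleSquare a l, ‖f y‖ₑ) * ∫⁻ y in square a l, g y := by
        rw [← tripleAverage_mul_volume f a hl]; ring
    _ ≤ (∫⁻ y in Metric.ball x ((2 : ℝ) ^ k), ‖f y‖ₑ) *
          ∫⁻ y in Metric.ball x ((2 : ℝ) ^ k), g y := by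
        gcongr
        exact square_subset_tripleSquare.trans hball
    _ ≤ _ := mul_le_mul' hf' hg'
    _ = maximalProduct W f g x * ((∫⁻ y in Metric.ball x ((2 : ℝ) ^ k), W y) *
          (∫⁻ y in Metric.ball x ((2 : ℝ) ^ k), (W y)⁻¹)) := by rw [maximalProduct]; ring
    _ ≤ maximalProduct W f g x * (K * (196 * NNReal.pi * volume (square a l)) ^ 2) := by
        refine mul_le_mul_right ((h.le x _ hk).trans ?_) _
        gcongr
    _ = _ := by ring

/-- At least half of the square lies outside `U`, so the pointwise bound may be averaged over that
part only. When `U` is the union of the stopping squares, these parts are disjoint across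
generations, which replaces a Carleson embedding. -/
lemma lintegral_sub_biUnion_bound (h : IsA2Density W K) {f : ℂ → ℂ} {g : ℂ → ℝ≥0∞}
    (hf : Measurable f) (hg : Measurable g) {a : ℂ} {l : ℝ} (hl : 0 < l) {U : Set ℂ}
    (hU : MeasurableSet U) (hUvol : 2 * volume U ≤ volume (square a l)) :
    tripleAverage f a l * ∫⁻ y in square a l, g y ≤
      2 * (196 * NNReal.pi) ^ 2 * K * ∫⁻ y in square a l \ U, maximalProduct W f g y := by
  have hv0 := (volume_square_pos a hl).ne'
  have hvt := (volume_square_lt_top a l).ne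
  set v := volume (square a l) with hv
  have hsplit : v ≤ 2 * volume (square a l \ U) := by
    have h1 : v ≤ volume U + volume (square a l \ U) := by
      refine (measure_mono ?_).trans (measure_union_le _ _)
      intro x hx
      by_cases hxU : x ∈ U
      · exact Or.inl hxU
      · exact Or.inr ⟨hx, hxU⟩
    have h2 : v + v ≤ v + 2 * volume (square a l \ U) := by
      calc v + v = 2 * v := (two_mul v).symm
        _ ≤ 2 * (volume U + volume (square a l \ U)) := by gcongr
        _ = 2 * volume U + 2 * volume (square a l \ U) := mul_add _ _ _
        _ ≤ _ := by gcongr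
    exact (ENNReal.add_le_add_iff_left hvt).1 h2
  refine (ENNReal.mul_le_mul_iff_left hv0 hvt).1 ?_
  set m := tripleAverage f a l * ∫⁻ y in square a l, g y with hm
  calc m * v ≤ m * (2 * volume (square a l \ U)) := by gcongr
    _ = 2 * ∫⁻ _ in square a l \ U, m := by rw [setLIntegral_const]; ring
    _ ≤ 2 * ∫⁻ x in square a l \ U, (196 * NNReal.pi) ^ 2 * K * v * maximalProduct W f g x := by
        gcongr 2 * ?_
        exact setLIntegral_mono' ((measurableSet_square a l).diff hU) fun x hx =>
          h.tripleAverage_mul_lintegral_le hf hg hl hx.1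
    _ = _ := by
        rw [lintegral_const_mul _ (h.measurable_maximalProduct hf hg)]
        ring

/-- Domination of the local bilinear form by the integral of the maximal product. -/
theorem exists_bilinear_le : ∃ C : ℝ≥0, ∀ (W : ℂ → ℝ≥0∞) (K : ℝ≥0∞) (_ : IsA2Density W K)
    (e : ℝ) (_ : 0 < e) (f : ℂ → ℂ) (_ : Measurable f) (_ : Integrable f) (g : ℂ → ℝ≥0∞)
    (_ : Measurable g) (G : ℝ≥0∞) (_ : G ≠ ⊤) (_ : ∀ x, g x ≤ G) (a : ℂ) (l : ℝ) (_ : 0 < l),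
    ∫⁻ x in square a l, ‖regBeurling e ((tripleSquare a l).indicator f) x‖ₑ * g x
      ≤ C * K * ∫⁻ x in square a l, maximalProduct W f g x := by
  obtain ⟨A, hA⟩ := exists_sparse_step
  refine ⟨A * (2 * (196 * NNReal.pi) ^ 2), fun W K h e he f hfm hf g hg G hG hgG => ?_⟩
  set C : ℝ≥0∞ := ((A * (2 * (196 * NNReal.pi) ^ 2) : ℝ≥0) : ℝ≥0∞) * K with hC
  -- A crude bound for the integrand, depending on `e` and `G`; it enters only through an error that
  -- tends to zero.
  set L : ℝ≥0∞ := ENNReal.ofReal (1 / e ^ 2) * (∫⁻ y, ‖f y‖ₑ) * G with hL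
  have hLt : L ≠ ⊤ :=
    ENNReal.mul_ne_top (ENNReal.mul_ne_top ENNReal.ofReal_ne_top hf.2.ne) hG
  have hFm := h.measurable_maximalProduct hfm hg
  have hTm : ∀ a l, Measurable fun x =>
      ‖regBeurling e ((tripleSquare a l).indicator f) x‖ₑ := fun a l =>
    (continuous_regBeurling he (hf.indicator (measurableSet_tripleSquare a l))).measurable.enorm
  -- Apply the sparse step `n` times and estimate crudely what remains. The remaining squares lose
  -- at least half their area at each step, so the error is at most `L 2⁻ⁿ |Q|`, and no sparse
  -- family need be assembled.
  have key : ∀ n : ℕ, ∀ (a : ℂ) (l : ℝ), 0 < l →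
      ∫⁻ x in square a l, ‖regBeurling e ((tripleSquare a l).indicator f) x‖ₑ * g x
      ≤ C * (∫⁻ x in square a l, maximalProduct W f g x)
        + L * (1 / 2) ^ n * volume (square a l) := by
    intro n
    induction n with
    | zero =>
      intro a l hl
      refine le_add_left ?_
      rw [pow_zero, mul_one, ← setLIntegral_const]
      refine lintegral_mono fun x => mul_le_mul' ?_ (hgG x)
      refine (enorm_regBeurling_le he _ x).trans ?_
      rw [lintegral_indicator_tripleSquare]
      exact mul_le_mul_right (setLIntegral_le_lintegral _ _) _
    | succ n ih =>
      intro a l hl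
      obtain ⟨S, hcount, hS, hdisj, hsum, hae, hloc⟩ := hA e he f hf a l hl
      have hcS : Countable S := hcount.to_subtype
      set U := ⋃ p : S, square p.1.1 p.1.2 with hU
      have hUm : MeasurableSet U := MeasurableSet.iUnion fun p => measurableSet_square _ _
      have hUsub : U ⊆ square a l := Set.iUnion_subset fun p => (hS p p.2).2
      have hdisj' : Pairwise (Function.onFun Disjoint fun p : S => square p.1.1 p.1.2) :=
        fun p q hpq => hdisj p.2 q.2 fun h => hpq (Subtype.ext h)
      have hUvol : volume U = ∑' p : S, volume (square p.1.1 p.1.2) :=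
        measure_iUnion hdisj' fun p => measurableSet_square _ _
      have split : ∀ u : ℂ → ℝ≥0∞, ∫⁻ x in square a l, u x
          = (∫⁻ x in square a l \ U, u x) + ∑' p : S, ∫⁻ x in square p.1.1 p.1.2, u x := by
        intro u
        rw [← lintegral_iUnion (fun p => measurableSet_square _ _) hdisj', add_comm,
          ← lintegral_inter_add_sdiff u (square a l) hUm, Set.inter_eq_self_of_subset_right hUsub]
      set t := tripleAverage f a l with ht
      have hstep : ∫⁻ x in square a l, ‖regBeurling e ((tripleSquare a l).indicator f) x‖ₑ * g x
          ≤ A * (t * ∫⁻ x in square a l, g x) + ∑' p : S, ∫⁻ x in square p.1.1 p.1.2,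
            ‖regBeurling e ((tripleSquare p.1.1 p.1.2).indicator f) x‖ₑ * g x := by
        have h1 : ∫⁻ x in square a l \ U,
            ‖regBeurling e ((tripleSquare a l).indicator f) x‖ₑ * g x
            ≤ A * t * ∫⁻ x in square a l \ U, g x := by
          rw [← lintegral_const_mul _ hg]
          refine lintegral_mono_ae ?_
          filter_upwards [ae_restrict_mem ((measurableSet_square a l).diff hUm),
            ae_restrict_of_ae hae] with x hx hx'
          gcongr
          refine hx' hx.1 fun p hp hxp => hx.2 (Set.mem_iUnion.2 ⟨⟨p, hp⟩, hxp⟩)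
        have h2 : ∀ p : S, ∫⁻ x in square p.1.1 p.1.2,
            ‖regBeurling e ((tripleSquare a l).indicator f) x‖ₑ * g x
            ≤ (∫⁻ x in square p.1.1 p.1.2,
              ‖regBeurling e ((tripleSquare p.1.1 p.1.2).indicator f) x‖ₑ * g x)
              + A * t * ∫⁻ x in square p.1.1 p.1.2, g x := by
          intro p
          have hm : Measurable fun x =>
            ‖regBeurling e ((tripleSquare p.1.1 p.1.2).indicator f) x‖ₑ * g x := (hTm _ _).mul hg
          rw [← lintegral_const_mul _ hg, ← lintegral_add_left hm]
          refine setLIntegral_mono' (measurableSet_square _ _) fun x hx => ?_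
          rw [← add_mul]
          gcongr
          exact hloc p p.2 x hx
        rw [split, split g]
        calc _ ≤ A * t * (∫⁻ x in square a l \ U, g x) + ∑' p : S, ((∫⁻ x in square p.1.1 p.1.2,
              ‖regBeurling e ((tripleSquare p.1.1 p.1.2).indicator f) x‖ₑ * g x)
              + A * t * ∫⁻ x in square p.1.1 p.1.2, g x) :=
              add_le_add h1 (ENNReal.tsum_le_tsum h2)
          _ = _ := by
              rw [ENNReal.tsum_add, ENNReal.tsum_mul_left]; ring
      have hmain := h.lintegral_sub_biUnion_bound hfm hg hl hUm (by rw [hUvol]; exact hsum)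
      calc _ ≤ _ := hstep
        _ ≤ A * (2 * (196 * NNReal.pi) ^ 2 * K * ∫⁻ y in square a l \ U, maximalProduct W f g y)
            + ∑' p : S, (C * (∫⁻ x in square p.1.1 p.1.2, maximalProduct W f g x)
              + L * (1 / 2) ^ n * volume (square p.1.1 p.1.2)) := by
            refine add_le_add (mul_le_mul_right hmain _) (ENNReal.tsum_le_tsum fun p => ?_)
            exact ih p.1.1 p.1.2 (hS p p.2).1
        _ = C * ((∫⁻ y in square a l \ U, maximalProduct W f g y)
            + ∑' p : S, ∫⁻ x in square p.1.1 p.1.2, maximalProduct W f g x)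
            + L * (1 / 2) ^ n * ∑' p : S, volume (square p.1.1 p.1.2) := by
            rw [ENNReal.tsum_add, ENNReal.tsum_mul_left, ENNReal.tsum_mul_left, hC]
            push_cast
            ring
        _ ≤ _ := by
            rw [← split]
            gcongr C * _ + ?_
            rw [pow_succ, ← mul_assoc, mul_assoc (L * (1 / 2) ^ n)]
            gcongr
            rw [one_div, ← ENNReal.div_eq_inv_mul, ENNReal.le_div_iff_mul_le (by simp) (by simp),
              mul_comm]
            exact hsum
  intro a l hl
  have hlim : Tendsto (fun n : ℕ => C * (∫⁻ x in square a l, maximalProduct W f g x)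
        + L * (1 / 2) ^ n * volume (square a l)) atTop
      (𝓝 (C * (∫⁻ x in square a l, maximalProduct W f g x) + L * 0 * volume (square a l))) := by
    refine Tendsto.const_add _ ?_
    refine ENNReal.Tendsto.mul_const (ENNReal.Tendsto.const_mul
      (ENNReal.tendsto_pow_atTop_nhds_zero_of_lt_one (by
        rw [one_div]; exact ENNReal.inv_lt_one.2 (by norm_num))) (Or.inr hLt)) (Or.inr ?_)
    exact (volume_square_lt_top a l).ne
  have := ge_of_tendsto' hlim fun n => key n a l hl
  simpa using this

/-- Insert `W^{-1/2} W^{1/2} = 1`, apply Cauchy–Schwarz, and use the maximal theorem for `W⁻¹ dA`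
and for `W dA`. The constant does not involve `K`, because the maximal theorem is uniform over
measures. -/
lemma exists_lintegral_maximalProduct_le : ∃ C : ℝ≥0, ∀ (W : ℂ → ℝ≥0∞) (K : ℝ≥0∞)
    (_ : IsA2Density W K) (f : ℂ → ℂ) (_ : Measurable f) (g : ℂ → ℝ≥0∞) (_ : Measurable g),
    (∫⁻ x, maximalProduct W f g x) ^ 2
      ≤ C * (∫⁻ x, ‖f x‖ₑ ^ 2 * W x) * ∫⁻ x, g x ^ 2 * (W x)⁻¹ := by
  obtain ⟨C, hC⟩ := exists_strong_type_centeredMaximal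
  refine ⟨C * C, fun W K h f hf g hg => ?_⟩
  have hW := h.measurable
  have weighted : ∀ (V : ℂ → ℝ≥0∞), IsA2Density V K → ∀ u : ℂ → ℝ≥0∞, Measurable u →
      ∫⁻ x, centeredMaximal (volume.withDensity V) (fun y => u y * (V y)⁻¹) x ^ 2 * V x
        ≤ C * ∫⁻ x, u x ^ 2 * (V x)⁻¹ := by
    intro V hV u hu
    have hm : Measurable fun y => u y * (V y)⁻¹ := hu.mul hV.measurable.inv
    have h1 := hC (volume.withDensity V) _ hm
    rw [lintegral_withDensity_eq_lintegral_mul _ hV.measurable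
      ((measurable_centeredMaximal hm).pow_const 2),
      lintegral_withDensity_eq_lintegral_mul _ hV.measurable (hm.pow_const 2)] at h1
    simp only [Pi.mul_apply] at h1
    refine le_trans (le_of_eq ?_) (h1.trans_eq ?_)
    · exact lintegral_congr fun x => mul_comm _ _
    · congr 1
      refine lintegral_congr fun x => ?_
      have := ENNReal.mul_inv_cancel (hV.ne_zero x) (hV.ne_top x)
      calc V x * (u x * (V x)⁻¹) ^ 2 = u x ^ 2 * (V x)⁻¹ * (V x * (V x)⁻¹) := by ring
        _ = _ := by rw [this, mul_one]
  have hsq : ∀ c : ℝ≥0∞, (c ^ (1 / 2 : ℝ)) ^ 2 = c := fun c => by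
    rw [← ENNReal.rpow_natCast, ← ENNReal.rpow_mul]; norm_num
  set M1 := centeredMaximal (volume.withDensity fun y => (W y)⁻¹) (fun y => ‖f y‖ₑ * W y) with hM1
  set M2 := centeredMaximal (volume.withDensity W) (fun y => g y * (W y)⁻¹) with hM2
  have m1 : Measurable M1 := measurable_centeredMaximal (hf.enorm.mul hW)
  have m2 : Measurable M2 := measurable_centeredMaximal (hg.mul hW.inv)
  have e1 : ∀ x, maximalProduct W f g x
      = (M1 x * ((W x)⁻¹) ^ (1 / 2 : ℝ)) * (M2 x * (W x) ^ (1 / 2 : ℝ)) := by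
    intro x
    have : ((W x)⁻¹) ^ (1 / 2 : ℝ) * (W x) ^ (1 / 2 : ℝ) = 1 := by
      rw [← ENNReal.mul_rpow_of_nonneg _ _ (by norm_num),
        ENNReal.inv_mul_cancel (h.ne_zero x) (h.ne_top x), ENNReal.one_rpow]
    calc maximalProduct W f g x = M1 x * M2 x * 1 := by rw [mul_one, maximalProduct]
      _ = _ := by rw [← this]; ring
  simp only [e1]
  have m1' : Measurable fun x => M1 x * ((W x)⁻¹) ^ (1 / 2 : ℝ) := m1.mul (hW.inv.pow_const _)
  have m2' : Measurable fun x => M2 x * (W x) ^ (1 / 2 : ℝ) := m2.mul (hW.pow_const _)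
  refine (sq_lintegral_mul_le m1'.aemeasurable m2'.aemeasurable).trans ?_
  simp only [mul_pow, hsq]
  have w1 := weighted _ h.inv (fun y => ‖f y‖ₑ) hf.enorm
  have w2 := weighted W h g hg
  simp only [inv_inv] at w1
  refine (mul_le_mul' w1 w2).trans_eq ?_
  push_cast
  ring

/-- The linear weighted bound for the regularised transforms. -/
theorem exists_weighted_regBeurling_le : ∃ C : ℝ≥0, ∀ (W : ℂ → ℝ≥0∞) (K : ℝ≥0∞)
    (_ : IsA2Density W K) (e : ℝ) (_ : 0 < e) (f : ℂ → ℂ) (_ : Measurable f) (_ : Integrable f)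
    (_ : HasCompactSupport f),
    ∫⁻ x, ‖regBeurling e f x‖ₑ ^ 2 * W x ≤ C * K ^ 2 * ∫⁻ x, ‖f x‖ₑ ^ 2 * W x := by
  obtain ⟨C1, h1⟩ := exists_bilinear_le
  obtain ⟨C2, h2⟩ := exists_lintegral_maximalProduct_le
  refine ⟨C1 ^ 2 * C2, fun W K h e he f hfm hf hfc => ?_⟩
  set I := ∫⁻ x, ‖f x‖ₑ ^ 2 * W x with hI
  have hTm : Measurable fun x => ‖regBeurling e f x‖ₑ :=
    (continuous_regBeurling he hf).measurable.enorm
  obtain ⟨R, hR⟩ := hfc.isCompact.isBounded.subset_ball 0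
  -- The weight is truncated in height and support so that the quantity to be bounded is finite and
  -- can be cancelled from both sides; monotone convergence restores `W`.
  set V : ℕ → ℂ → ℝ≥0∞ := fun n => (Metric.ball (0 : ℂ) n).indicator fun x => min (W x) n with hV
  have hVm : ∀ n, Measurable (V n) := fun n =>
    (h.measurable.min measurable_const).indicator Metric.isOpen_ball.measurableSet
  have hVn : ∀ n x, V n x ≤ n := fun n x => by
    simp only [hV]
    refine (Set.indicator_le_self' (fun _ _ => zero_le) x).trans (min_le_right _ _)
  have hVW : ∀ n x, V n x ≤ W x := fun n x => by
    simp only [hV]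
    refine (Set.indicator_le_self' (fun _ _ => zero_le) x).trans (min_le_left _ _)
  have hmono : Monotone V := by
    intro n m hnm x
    simp only [hV]
    by_cases hx : x ∈ Metric.ball (0 : ℂ) n
    · rw [Set.indicator_of_mem hx, Set.indicator_of_mem
        (Metric.ball_subset_ball (by exact_mod_cast hnm) hx)]
      gcongr
    · rw [Set.indicator_of_notMem hx]; exact zero_le
  have hsup : ∀ x, ⨆ n, V n x = W x := by
    intro x
    refine le_antisymm (iSup_le fun n => hVW n x) ?_
    obtain ⟨n, hn⟩ := exists_nat_gt (max ‖x‖ (W x).toReal)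
    refine le_iSup_of_le n ?_
    have hx : x ∈ Metric.ball (0 : ℂ) n := by
      simpa using (le_max_left _ _).trans_lt hn
    simp only [hV, Set.indicator_of_mem hx]
    refine le_min le_rfl ?_
    rw [← ENNReal.ofReal_toReal (h.ne_top x), ← ENNReal.ofReal_natCast]
    exact ENNReal.ofReal_le_ofReal ((le_max_right _ _).trans hn.le)
  have hX : ∀ n, ∫⁻ x, ‖regBeurling e f x‖ₑ ^ 2 * V n x ≤ C1 ^ 2 * C2 * K ^ 2 * I := by
    intro n
    set X := ∫⁻ x, ‖regBeurling e f x‖ₑ ^ 2 * V n x with hXdef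
    set B : ℝ≥0∞ := ENNReal.ofReal (1 / e ^ 2) * ∫⁻ y, ‖f y‖ₑ with hB
    have hBt : B ≠ ⊤ := ENNReal.mul_ne_top ENNReal.ofReal_ne_top hf.2.ne
    have hTB : ∀ x, ‖regBeurling e f x‖ₑ ≤ B := enorm_regBeurling_le he f
    have hXt : X ≠ ⊤ := by
      have hle : X ≤ ∫⁻ x, (Metric.ball (0 : ℂ) n).indicator (fun _ => B ^ 2 * n) x := by
        refine lintegral_mono fun x => ?_
        by_cases hx : x ∈ Metric.ball (0 : ℂ) n
        · rw [Set.indicator_of_mem hx]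
          exact mul_le_mul' (pow_le_pow_left' (hTB x) 2) (hVn n x)
        · simp [hV, Set.indicator_of_notMem hx]
      rw [lintegral_indicator_const Metric.isOpen_ball.measurableSet] at hle
      exact (hle.trans_lt (ENNReal.mul_lt_top (ENNReal.mul_lt_top (ENNReal.pow_lt_top hBt.lt_top)
        (by simp)) measure_ball_lt_top)).ne
    -- The extremal test function of `L²` duality: `∫ |Tf| g = X` while `∫ g² W⁻¹ ≤ X`, so the
    -- bilinear bound gives an estimate of `X²` by a multiple of `X`.
    set g : ℂ → ℝ≥0∞ := fun x => ‖regBeurling e f x‖ₑ * V n x with hg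
    have hgm : Measurable g := hTm.mul (hVm n)
    -- A square containing both the support of `f` and the support of the truncated weight makes the
    -- local bilinear bound global.
    obtain ⟨N, hN⟩ := exists_nat_gt (max R n)
    have hN0 : (0 : ℝ) < N := (Nat.cast_nonneg n).trans_lt ((le_max_right _ _).trans_lt hN)
    have hballQ : Metric.ball (0 : ℂ) N ⊆ square ⟨-N, -N⟩ (2 * N) := by
      intro x hx
      have hx' : ‖x‖ < N := by simpa using hx
      have a1 := abs_lt.1 ((Complex.abs_re_le_norm x).trans_lt hx')
      have a2 := abs_lt.1 ((Complex.abs_im_le_norm x).trans_lt hx')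
      rw [mem_square]
      refine ⟨⟨?_, ?_⟩, ?_, ?_⟩ <;> dsimp only <;> linarith
    have hind : (tripleSquare ⟨-N, -N⟩ (2 * N)).indicator f = f := by
      refine Set.indicator_eq_self.2 fun x hx => ?_
      refine square_subset_tripleSquare (hballQ (Metric.ball_subset_ball
        ((le_max_left _ _).trans hN.le) (hR (subset_tsupport f hx))))
    have hb := h1 W K h e he f hfm hf g hgm (B * n) (ENNReal.mul_ne_top hBt (by simp))
      (fun x => mul_le_mul' (hTB x) (hVn n x)) ⟨-N, -N⟩ (2 * N) (by positivity)
    rw [hind] at hb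
    have hXb : X ≤ C1 * K * ∫⁻ x, maximalProduct W f g x := by
      refine le_trans ?_ (hb.trans (mul_le_mul_right (setLIntegral_le_lintegral _ _) _))
      rw [← lintegral_indicator (measurableSet_square _ _)]
      refine lintegral_mono fun x => ?_
      by_cases hx : x ∈ square ⟨-(N : ℝ), -(N : ℝ)⟩ (2 * (N : ℝ))
      · rw [Set.indicator_of_mem hx, sq, mul_assoc]
      · have hxn : x ∉ Metric.ball (0 : ℂ) n := fun hx' => hx (hballQ (Metric.ball_subset_ball
          ((le_max_right _ _).trans hN.le) hx'))
        simp [hV, Set.indicator_of_notMem hxn]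
    have hg2 : ∫⁻ x, g x ^ 2 * (W x)⁻¹ ≤ X := by
      refine lintegral_mono fun x => ?_
      calc g x ^ 2 * (W x)⁻¹ = ‖regBeurling e f x‖ₑ ^ 2 * V n x * (V n x * (W x)⁻¹) := by
            simp only [hg]; ring
        _ ≤ ‖regBeurling e f x‖ₑ ^ 2 * V n x * (W x * (W x)⁻¹) := by
            gcongr; exact hVW n x
        _ = _ := by rw [ENNReal.mul_inv_cancel (h.ne_zero x) (h.ne_top x), mul_one]
    have hXX : X * X ≤ C1 ^ 2 * C2 * K ^ 2 * I * X := by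
      calc X * X = X ^ 2 := (sq X).symm
        _ ≤ (C1 * K * ∫⁻ x, maximalProduct W f g x) ^ 2 := pow_le_pow_left' hXb 2
        _ = (C1 * K) ^ 2 * (∫⁻ x, maximalProduct W f g x) ^ 2 := mul_pow _ _ _
        _ ≤ (C1 * K) ^ 2 * (C2 * I * X) := by
            gcongr
            exact (h2 W K h f hfm g hgm).trans (by gcongr)
        _ = _ := by ring
    by_cases hX0 : X = 0
    · rw [hX0]; exact zero_le
    · exact (ENNReal.mul_le_mul_iff_left hX0 hXt).1 hXX
  have hfin : ∫⁻ x, ‖regBeurling e f x‖ₑ ^ 2 * W x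
      = ⨆ n, ∫⁻ x, ‖regBeurling e f x‖ₑ ^ 2 * V n x := by
    have hm : ∀ n, Measurable fun x => ‖regBeurling e f x‖ₑ ^ 2 * V n x :=
      fun n => (hTm.pow_const 2).mul (hVm n)
    rw [← lintegral_iSup hm fun n m hnm x => mul_le_mul_right (hmono hnm x) _]
    refine lintegral_congr fun x => ?_
    rw [← ENNReal.mul_iSup, hsup]
  rw [hfin]
  push_cast
  exact iSup_le hX

end IsA2Density

/-! ### Principal values as limits of the regularised transforms -/

lemma integrableOn_ball_one_div_norm (R : ℝ) :
    IntegrableOn (fun u : ℂ => 1 / ‖u‖) (Metric.ball 0 R) := by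
  refine integrableOn_ball_of_norm_le_rpow (C := 1) (α := 1) ?_ ?_ ?_ ?_
  · rw [Complex.finrank_real_complex]; norm_num
  · rw [Complex.finrank_real_complex]; norm_num
  · refine Eventually.of_forall fun u => ?_
    rw [Real.rpow_neg_one, one_mul, one_div, norm_inv, norm_norm]
  · exact (measurable_const.div measurable_norm).aestronglyMeasurable

/-- A function that changes sign under rotation by a right angle has mean zero on centered
discs. -/
lemma setIntegral_ball_eq_zero_of_rotation {k : ℂ → ℂ} (hk : ∀ u, k (Complex.I * u) = -k u)
    (R : ℝ) : ∫ u in Metric.ball (0 : ℂ) R, k u = 0 := by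
  rw [← integral_indicator Metric.isOpen_ball.measurableSet]
  set h := (Metric.ball (0 : ℂ) R).indicator k with hh
  have h1 : ∀ u, h (Complex.I * u) = -h u := by
    intro u
    by_cases hu : u ∈ Metric.ball (0 : ℂ) R
    · have hIu : Complex.I * u ∈ Metric.ball (0 : ℂ) R := by simpa using hu
      simp only [hh, Set.indicator_of_mem hu, Set.indicator_of_mem hIu, hk]
    · have hIu : Complex.I * u ∉ Metric.ball (0 : ℂ) R := by simpa using hu
      simp only [hh, Set.indicator_of_notMem hu, Set.indicator_of_notMem hIu, neg_zero]
  have h2 := (rotation ⟨Complex.I, by simp [Submonoid.unitSphere]⟩).measurePreserving.integral_comp'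
    (f := (rotation ⟨Complex.I, by simp [Submonoid.unitSphere]⟩).toMeasurableEquiv) h
  have h3 : ∫ u, h (Complex.I * u) = ∫ u, h u := h2
  simp only [h1, integral_neg] at h3
  exact self_eq_neg.1 h3.symm

/-- The limit of singular integrals with truncated kernels, in absolutely convergent form. -/
def beurlingLimit (R : ℝ) (φ : ℂ → ℂ) (z : ℂ) : ℂ :=
  ∫ u in Metric.ball (0 : ℂ) R, 1 / u ^ 2 * (φ (z + u) - φ z)

/-- Stated for a general family so that sharp truncation and smooth regularisation are seen to have
the same limit. The sign change under rotation by `i` gives mean zero on discs, so `φ(z)` can be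
subtracted; the Lipschitz bound then dominates the integrand by `L/|u|`, which is integrable on the
disc. -/
lemma tendsto_truncated_kernel {φ : ℂ → ℂ} (hφ : ContDiff ℝ ∞ φ) (hc : HasCompactSupport φ) (z : ℂ)
    {R : ℝ} (hR : ∀ u ∉ Metric.ball (0 : ℂ) R, φ (z + u) = 0) {k : ℝ → ℂ → ℂ}
    (hm : ∀ ε > 0, AEStronglyMeasurable (k ε) volume)
    (hb : ∀ ε > 0, ∀ u, ‖k ε u‖ ≤ 1 / ε ^ 2) (hle : ∀ ε > 0, ∀ u ≠ 0, ‖k ε u‖ ≤ 1 / ‖u‖ ^ 2)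
    (hI : ∀ ε > 0, ∀ u, k ε (Complex.I * u) = -k ε u)
    (hlim : ∀ u ≠ 0, Tendsto (fun ε => k ε u) (𝓝[>] 0) (𝓝 (1 / u ^ 2))) :
    Tendsto (fun ε => ∫ ζ, k ε (ζ - z) * φ ζ) (𝓝[>] 0) (𝓝 (beurlingLimit R φ z)) := by
  have hφc := hφ.continuous
  obtain ⟨L, hL⟩ := ContDiff.lipschitzWith_of_hasCompactSupport hc hφ (by simp)
  set B := Metric.ball (0 : ℂ) R with hB
  have hBm : MeasurableSet B := Metric.isOpen_ball.measurableSet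
  have hBt : volume B ≠ ⊤ := measure_ball_lt_top.ne
  have hmain : ∀ ε > 0, ∫ ζ, k ε (ζ - z) * φ ζ = ∫ u in B, k ε u * (φ (z + u) - φ z) := by
    intro ε hε
    have hki : IntegrableOn (k ε) B := by
      refine Measure.integrableOn_of_bounded (M := 1 / ε ^ 2) hBt (hm ε hε)
        (Eventually.of_forall (hb ε hε))
    have hpi : Integrable (fun u => k ε u * φ (z + u)) := by
      have h1 : Integrable (fun u => φ (z + u)) :=
        (hφc.integrable_of_hasCompactSupport hc).comp_add_left z
      exact h1.bdd_mul (hm ε hε) (Eventually.of_forall (hb ε hε))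
    rw [← integral_add_left_eq_self (fun ζ => k ε (ζ - z) * φ ζ) z]
    simp only [add_sub_cancel_left, mul_sub]
    rw [integral_sub hpi.integrableOn (hki.mul_const _), integral_mul_const,
      setIntegral_ball_eq_zero_of_rotation (hI ε hε), zero_mul, sub_zero,
      setIntegral_eq_integral_of_forall_compl_eq_zero]
    intro u hu
    rw [hR u hu, mul_zero]
  have hev : ∀ᶠ ε in 𝓝[>] (0 : ℝ), 0 < ε := self_mem_nhdsWithin
  refine Tendsto.congr' (hev.mono fun ε hε => (hmain ε hε).symm) ?_
  refine tendsto_integral_filter_of_dominated_convergence (fun u => L * (1 / ‖u‖)) ?_ ?_ ?_ ?_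
  · refine hev.mono fun ε hε => ((hm ε hε).restrict).mul ?_
    exact (by fun_prop : Continuous fun u => φ (z + u) - φ z).aestronglyMeasurable
  · refine hev.mono fun ε hε => Eventually.of_forall fun u => ?_
    have h1 : ‖φ (z + u) - φ z‖ ≤ L * ‖u‖ := by
      simpa [dist_eq_norm] using hL.dist_le_mul (z + u) z
    rcases eq_or_ne u 0 with rfl | hu
    · simp
    · have hu' := norm_pos_iff.2 hu
      rw [norm_mul]
      calc _ ≤ 1 / ‖u‖ ^ 2 * (L * ‖u‖) :=
            mul_le_mul (hle ε hε u hu) h1 (norm_nonneg _) (by positivity)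
        _ = _ := by field_simp
  · exact (integrableOn_ball_one_div_norm R).const_mul _
  · have h0 : ∀ᵐ u : ℂ ∂volume.restrict B, u ≠ 0 :=
      ae_restrict_of_ae (by simp [ae_iff])
    filter_upwards [h0] with u hu
    exact (hlim u hu).mul_const _

lemma exists_support_radius {φ : ℂ → ℂ} (hc : HasCompactSupport φ) (z : ℂ) :
    ∃ R : ℝ, ∀ u ∉ Metric.ball (0 : ℂ) R, φ (z + u) = 0 := by
  obtain ⟨R, hR⟩ := hc.isCompact.isBounded.subset_ball z
  refine ⟨R, fun u hu => image_eq_zero_of_notMem_tsupport fun h => hu ?_⟩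
  simpa using hR h

lemma tendsto_truncatedBeurling_aux {φ : ℂ → ℂ} (hφ : ContDiff ℝ ∞ φ) (hc : HasCompactSupport φ)
    (z : ℂ) {R : ℝ} (hR : ∀ u ∉ Metric.ball (0 : ℂ) R, φ (z + u) = 0) :
    Tendsto (truncatedBeurling φ z) (𝓝[>] 0) (𝓝 (1 / (Real.pi : ℂ) * beurlingLimit R φ z)) := by
  set k : ℝ → ℂ → ℂ := fun ε => {u : ℂ | ε < ‖u‖}.indicator fun u => 1 / u ^ 2 with hk
  have hs : ∀ ε : ℝ, MeasurableSet {u : ℂ | ε < ‖u‖} := fun ε =>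
    (isOpen_lt continuous_const continuous_norm).measurableSet
  have h : ∀ ε, truncatedBeurling φ z ε = 1 / (Real.pi : ℂ) * ∫ ζ, k ε (ζ - z) * φ ζ := by
    intro ε
    have hset : MeasurableSet {ζ : ℂ | ε < ‖ζ - z‖} :=
      (isOpen_lt continuous_const (by fun_prop)).measurableSet
    rw [truncatedBeurling, ← integral_indicator hset]
    congr 2
    ext ζ
    by_cases hζ : ε < ‖ζ - z‖
    · rw [Set.indicator_of_mem (by exact hζ)]
      simp only [hk]
      rw [Set.indicator_of_mem (by exact hζ)]
      ring
    · rw [Set.indicator_of_notMem (by exact hζ)]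
      simp only [hk]
      rw [Set.indicator_of_notMem (by exact hζ), zero_mul]
  simp only [funext h]
  refine (tendsto_truncated_kernel hφ hc z hR ?_ ?_ ?_ ?_ ?_).const_mul _
  · intro ε _
    exact ((measurable_const.div (measurable_id.pow_const 2)).indicator (hs ε)).aestronglyMeasurable
  · intro ε hε u
    by_cases hu : ε < ‖u‖
    · simp only [hk]
      rw [Set.indicator_of_mem (by exact hu), norm_div, norm_one, norm_pow]
      gcongr
    · simp only [hk]
      rw [Set.indicator_of_notMem (by exact hu), norm_zero]
      positivity
  · intro ε _ u _
    simp only [hk]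
    refine (norm_indicator_le_norm_self _ _).trans_eq ?_
    rw [norm_div, norm_one, norm_pow]
  · intro ε _ u
    by_cases hu : ε < ‖u‖
    · have hu' : ε < ‖Complex.I * u‖ := by simpa using hu
      simp only [hk]
      rw [Set.indicator_of_mem (by exact hu'), Set.indicator_of_mem (by exact hu), mul_pow,
        Complex.I_sq, neg_one_mul, div_neg]
    · have hu' : ¬ ε < ‖Complex.I * u‖ := by simpa using hu
      simp only [hk]
      rw [Set.indicator_of_notMem (by exact hu'), Set.indicator_of_notMem (by exact hu), neg_zero]
  · intro u hu
    refine tendsto_const_nhds.congr' ?_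
    filter_upwards [nhdsWithin_le_nhds (Iio_mem_nhds (norm_pos_iff.2 hu))] with ε hε
    simp only [hk]
    rw [Set.indicator_of_mem (by exact hε)]

lemma tendsto_truncatedBeurling {φ : ℂ → ℂ} (hφ : ContDiff ℝ ∞ φ) (hc : HasCompactSupport φ)
    (z : ℂ) : Tendsto (truncatedBeurling φ z) (𝓝[>] 0) (𝓝 (beurling φ z)) := by
  obtain ⟨R, hR⟩ := exists_support_radius hc z
  exact tendsto_nhds_limUnder ⟨_, tendsto_truncatedBeurling_aux hφ hc z hR⟩

lemma tendsto_regBeurling {φ : ℂ → ℂ} (hφ : ContDiff ℝ ∞ φ) (hc : HasCompactSupport φ)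
    (z : ℂ) : Tendsto (fun e => regBeurling e φ z) (𝓝[>] 0) (𝓝 (Real.pi * beurling φ z)) := by
  obtain ⟨R, hR⟩ := exists_support_radius hc z
  have h1 := tendsto_nhds_unique (tendsto_truncatedBeurling hφ hc z)
    (tendsto_truncatedBeurling_aux hφ hc z hR)
  have hpi : (Real.pi : ℂ) ≠ 0 := by exact_mod_cast Real.pi_ne_zero
  have h2 : (Real.pi : ℂ) * beurling φ z = beurlingLimit R φ z := by
    rw [h1]; field_simp
  rw [h2]
  have heven : ∀ (e : ℝ) (u v : ℂ), beurlingKernel e (u - v) = beurlingKernel e (v - u) := by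
    intro e u v
    rw [beurlingKernel, beurlingKernel, cauchyKernel, cauchyKernel, norm_sub_rev,
      ← neg_sub v u, map_neg, neg_div, neg_sq]
  have h3 : ∀ e, regBeurling e φ z = ∫ ζ, beurlingKernel e (ζ - z) * φ ζ := fun e => by
    simp only [regBeurling, heven e z]
  simp only [h3]
  refine tendsto_truncated_kernel hφ hc z hR ?_ ?_ ?_ ?_ ?_
  · exact fun e he => (continuous_beurlingKernel he).aestronglyMeasurable
  · exact fun e he u => norm_beurlingKernel_le_const he u
  · exact fun e _ u hu => norm_beurlingKernel_le hu
  · intro e _ u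
    have : cauchyKernel e (Complex.I * u) = -Complex.I * cauchyKernel e u := by
      rw [cauchyKernel, cauchyKernel, norm_mul, Complex.norm_I, one_mul, map_mul, Complex.conj_I,
        mul_div_assoc]
    rw [beurlingKernel, beurlingKernel, this, mul_pow, neg_sq, Complex.I_sq, neg_one_mul]
  · intro u hu
    have hu' : (‖u‖ ^ 2 + 0 ^ 2 : ℝ) ≠ 0 := by simpa using hu
    have hcont : ContinuousAt (fun e : ℝ => beurlingKernel e u) 0 := by
      have hD : ContinuousAt (fun e : ℝ => ((‖u‖ ^ 2 + e ^ 2 : ℝ) : ℂ)) 0 :=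
        (by fun_prop : Continuous fun e : ℝ => ((‖u‖ ^ 2 + e ^ 2 : ℝ) : ℂ)).continuousAt
      exact (continuousAt_const.div hD (by exact_mod_cast hu')).pow 2
    have hval : beurlingKernel 0 u = 1 / u ^ 2 := by
      have hcu : (starRingEnd ℂ) u ≠ 0 := by simpa using hu
      rw [beurlingKernel, cauchyKernel, ofReal_normSq_add]
      simp only [Complex.ofReal_zero, ne_eq, OfNat.ofNat_ne_zero, not_false_eq_true, zero_pow,
        add_zero]
      field_simp
    rw [← hval]
    exact hcont.tendsto.mono_left nhdsWithin_le_nhds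

/-! ### From weights to densities, and the estimate on test functions -/

/-- A measurable representative of `w`, reset to 1 on the null set where it is not positive, is
finite and nonzero everywhere. The measure and all disc averages are unchanged, and `W W⁻¹ = 1`
holds pointwise. -/
lemma IsA2Weight.exists_isA2Density {w : ℂ → ℝ} (hw : IsA2Weight w) :
    ∃ W : ℂ → ℝ≥0∞, IsA2Density W (a2Characteristic w) ∧
      weightMeasure w = volume.withDensity W := by
  set w' := hw.aemeasurable.mk w with hw'
  have hw'm : Measurable w' := hw.aemeasurable.measurable_mk
  have hs : MeasurableSet {x | 0 < w' x} := measurableSet_lt measurable_const hw'm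
  classical
  set W : ℂ → ℝ≥0∞ := {x | 0 < w' x}.piecewise (fun x => ENNReal.ofReal (w' x)) fun _ => 1 with hW
  have hWm : Measurable W := hw'm.ennreal_ofReal.piecewise hs measurable_const
  have hae : (fun z => ENNReal.ofReal (w z)) =ᵐ[volume] W := by
    filter_upwards [hw.aemeasurable.ae_eq_mk, hw.pos] with x hx hpos
    have : x ∈ {x | 0 < w' x} := by
      change 0 < w' x
      rw [hw', ← hx]; exact hpos
    rw [hW, Set.piecewise_eq_of_mem _ _ _ this, hx]
  refine ⟨W, ⟨hWm, ?_, ?_, hw.finite.ne, ?_⟩, withDensity_congr_ae hae⟩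
  · intro x
    by_cases hx : x ∈ {x | 0 < w' x}
    · rw [hW, Set.piecewise_eq_of_mem _ _ _ hx]
      exact (ENNReal.ofReal_pos.2 hx).ne'
    · rw [hW, Set.piecewise_eq_of_notMem _ _ _ hx]
      exact one_ne_zero
  · intro x
    by_cases hx : x ∈ {x | 0 < w' x}
    · rw [hW, Set.piecewise_eq_of_mem _ _ _ hx]
      exact ENNReal.ofReal_ne_top
    · rw [hW, Set.piecewise_eq_of_notMem _ _ _ hx]
      exact ENNReal.one_ne_top
  · intro x R hR
    have h0 := volume_ball_pos x hR
    have ht : volume (Metric.ball x R) ≠ ⊤ := measure_ball_lt_top.ne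
    have h1 : ∫⁻ y in Metric.ball x R, W y = ∫⁻ y in Metric.ball x R, ENNReal.ofReal (w y) :=
      lintegral_congr_ae (ae_restrict_of_ae hae.symm)
    have h2 : ∫⁻ y in Metric.ball x R, (W y)⁻¹
        = ∫⁻ y in Metric.ball x R, (ENNReal.ofReal (w y))⁻¹ :=
      lintegral_congr_ae (ae_restrict_of_ae (by
        filter_upwards [hae] with y hy
        rw [hy]))
    have h3 : (⨍⁻ z in Metric.ball x R, ENNReal.ofReal (w z) ∂volume) *
        (⨍⁻ z in Metric.ball x R, (ENNReal.ofReal (w z))⁻¹ ∂volume) ≤ a2Characteristic w :=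
      le_iSup₂_of_le x R (le_iSup_of_le hR le_rfl)
    rw [h1, h2]
    have h4 : ∀ u : ℂ → ℝ≥0∞, ∫⁻ y in Metric.ball x R, u y
        = (⨍⁻ y in Metric.ball x R, u y ∂volume) * volume (Metric.ball x R) := fun u => by
      rw [setLAverage_eq, ENNReal.div_mul_cancel h0 ht]
    rw [h4, h4]
    calc _ = _ * volume (Metric.ball x R) ^ 2 := by rw [sq, mul_mul_mul_comm]
      _ ≤ _ := mul_le_mul_left h3 _

lemma IsA2Density.isLocallyFiniteMeasure {W : ℂ → ℝ≥0∞} {K : ℝ≥0∞} (h : IsA2Density W K) :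
    IsLocallyFiniteMeasure (volume.withDensity W) := by
  refine ⟨fun x => ⟨Metric.ball x 1, Metric.ball_mem_nhds x one_pos, ?_⟩⟩
  rw [IsA2Density.withDensity_ball]
  exact (h.lintegral_ball_ne_top x one_pos).lt_top

lemma eLpNorm_two_sq {μ : Measure ℂ} (f : ℂ → ℂ) :
    eLpNorm f 2 μ ^ 2 = ∫⁻ x, ‖f x‖ₑ ^ 2 ∂μ := by
  have := eLpNorm_nnreal_pow_eq_lintegral (μ := μ) (f := f) (p := 2) (by norm_num)
  simpa using this

lemma measurable_beurling {φ : ℂ → ℂ} (hφ : ContDiff ℝ ∞ φ) (hc : HasCompactSupport φ) :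
    Measurable (beurling φ) := by
  have hpi : (Real.pi : ℂ) ≠ 0 := by exact_mod_cast Real.pi_ne_zero
  have hi := hφ.continuous.integrable_of_hasCompactSupport hc (μ := volume)
  have h1 : Measurable fun z => (Real.pi : ℂ) * beurling φ z := by
    refine measurable_of_tendsto_metrizable (f := fun (n : ℕ) => regBeurling (1 / ((n : ℝ) + 1)) φ)
      (fun n => (continuous_regBeurling (by positivity) hi).measurable) ?_
    refine tendsto_pi_nhds.2 fun z => (tendsto_regBeurling hφ hc z).comp ?_
    exact tendsto_nhdsWithin_iff.2 ⟨tendsto_one_div_add_atTop_nhds_zero_nat,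
      Eventually.of_forall fun n => by simp only [Set.mem_Ioi]; positivity⟩
  have h2 := h1.const_mul (Real.pi : ℂ)⁻¹
  simpa only [inv_mul_cancel_left₀ hpi] using h2

/-- The weighted estimate for the principal value operator on test functions. -/
theorem exists_eLpNorm_beurling_le : ∃ C : ℝ≥0, 0 < C ∧ ∀ (W : ℂ → ℝ≥0∞) (K : ℝ≥0∞)
    (_ : IsA2Density W K) (φ : ℂ → ℂ) (_ : ContDiff ℝ ∞ φ) (_ : HasCompactSupport φ),
    eLpNorm (beurling φ) 2 (volume.withDensity W) ≤ C * K * eLpNorm φ 2 (volume.withDensity W) := by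
  obtain ⟨C, hC⟩ := IsA2Density.exists_weighted_regBeurling_le
  -- The estimate for squares has constant `C`; since `C ≤ (C + 1)²`, a square root is avoided and
  -- the constant is positive.
  refine ⟨C + 1, by positivity, fun W K h φ hφ hc => ?_⟩
  have hi := hφ.continuous.integrable_of_hasCompactSupport hc (μ := volume)
  have hm := hφ.continuous.measurable
  have hBm := measurable_beurling hφ hc
  set ε : ℕ → ℝ := fun n => 1 / ((n : ℝ) + 1) with hε
  have hε0 : ∀ n, 0 < ε n := fun n => by positivity
  have hεlim : Tendsto ε atTop (𝓝[>] 0) :=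
    tendsto_nhdsWithin_iff.2 ⟨tendsto_one_div_add_atTop_nhds_zero_nat,
      Eventually.of_forall hε0⟩
  -- The regularised transforms lack the factor `1/π` and converge to `π` times the principal value;
  -- as `π ≥ 1` the factor can be discarded.
  have hle : ∀ x, ‖beurling φ x‖ₑ ≤ ‖(Real.pi : ℂ) * beurling φ x‖ₑ := by
    intro x
    rw [enorm_mul]
    refine le_mul_of_one_le_left zero_le ?_
    rw [← ofReal_norm, Complex.norm_real, Real.norm_of_nonneg Real.pi_pos.le, ← ENNReal.ofReal_one]
    exact ENNReal.ofReal_le_ofReal (by linarith [Real.pi_gt_three])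
  have hsq : ∫⁻ x, ‖beurling φ x‖ₑ ^ 2 * W x ≤ C * K ^ 2 * ∫⁻ x, ‖φ x‖ₑ ^ 2 * W x := by
    calc ∫⁻ x, ‖beurling φ x‖ₑ ^ 2 * W x
        ≤ ∫⁻ x, liminf (fun n => ‖regBeurling (ε n) φ x‖ₑ ^ 2 * W x) atTop := by
          refine lintegral_mono fun x => ?_
          have h1 : Tendsto (fun n => ‖regBeurling (ε n) φ x‖ₑ ^ 2 * W x) atTop
              (𝓝 (‖(Real.pi : ℂ) * beurling φ x‖ₑ ^ 2 * W x)) := by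
            refine ENNReal.Tendsto.mul_const (ENNReal.Tendsto.pow ?_) (Or.inr (h.ne_top x))
            exact ((tendsto_regBeurling hφ hc x).comp hεlim).enorm
          rw [h1.liminf_eq]
          gcongr
          exact hle x
      _ ≤ liminf (fun n => ∫⁻ x, ‖regBeurling (ε n) φ x‖ₑ ^ 2 * W x) atTop :=
          lintegral_liminf_le fun n =>
            ((continuous_regBeurling (hε0 n) hi).measurable.enorm.pow_const 2).mul h.measurable
      _ ≤ _ := by
          refine liminf_le_of_le (by isBoundedDefault) fun b hb => ?_
          obtain ⟨n, hn⟩ := hb.exists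
          exact hn.trans (hC W K h (ε n) (hε0 n) φ hm hi hc)
  have hnorm : ∀ f : ℂ → ℂ, Measurable f →
      eLpNorm f 2 (volume.withDensity W) ^ 2 = ∫⁻ x, ‖f x‖ₑ ^ 2 * W x := by
    intro f hf
    rw [eLpNorm_two_sq, lintegral_withDensity_eq_lintegral_mul _ h.measurable
      (hf.enorm.pow_const 2)]
    exact lintegral_congr fun x => mul_comm _ _
  refine (ENNReal.pow_le_pow_left_iff two_ne_zero).1 ?_
  rw [mul_pow, hnorm _ hBm, hnorm _ hm]
  refine hsq.trans (mul_le_mul_left ?_ _)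
  rw [mul_pow]
  refine mul_le_mul_left ?_ _
  rw [← ENNReal.coe_pow]
  have : C ≤ (C + 1) ^ 2 := by
    calc C ≤ C + (C ^ 2 + C + 1) := le_self_add
      _ = _ := by ring
  exact_mod_cast this

/-- Additivity is inherited from the absolutely convergent regularised integrals by uniqueness of
limits. -/
lemma beurling_add {φ ψ : ℂ → ℂ} (hφ : ContDiff ℝ ∞ φ) (hφc : HasCompactSupport φ)
    (hψ : ContDiff ℝ ∞ ψ) (hψc : HasCompactSupport ψ) :
    beurling (φ + ψ) = beurling φ + beurling ψ := by
  have hpi : (Real.pi : ℂ) ≠ 0 := by exact_mod_cast Real.pi_ne_zero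
  funext z
  apply mul_left_cancel₀ hpi
  rw [Pi.add_apply, mul_add]
  refine tendsto_nhds_unique (tendsto_regBeurling (hφ.add hψ) (hφc.add hψc) z) ?_
  refine ((tendsto_regBeurling hφ hφc z).add (tendsto_regBeurling hψ hψc z)).congr' ?_
  filter_upwards [self_mem_nhdsWithin] with e he
  exact (regBeurling_add he (hφ.continuous.integrable_of_hasCompactSupport hφc)
    (hψ.continuous.integrable_of_hasCompactSupport hψc) z).symm

lemma beurling_smul {φ : ℂ → ℂ} (hφ : ContDiff ℝ ∞ φ) (hφc : HasCompactSupport φ) (c : ℂ) :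
    beurling (c • φ) = c • beurling φ := by
  have hpi : (Real.pi : ℂ) ≠ 0 := by exact_mod_cast Real.pi_ne_zero
  funext z
  apply mul_left_cancel₀ hpi
  rw [Pi.smul_apply, smul_eq_mul, mul_left_comm]
  have hcs : HasCompactSupport (c • φ) := hφc.smul_left
  refine tendsto_nhds_unique (tendsto_regBeurling (hφ.const_smul c) hcs z) ?_
  refine ((tendsto_regBeurling hφ hφc z).const_mul c).congr fun e => ?_
  simp only [regBeurling, smul_eq_mul, mul_left_comm _ c]
  rw [integral_const_mul]

/-! ### Test functions in `L²(μ)` and the extension by density -/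

/-- The space of complex-valued test functions on the plane. -/
def testFunctions : Submodule ℂ (ℂ → ℂ) where
  carrier := {φ | ContDiff ℝ ∞ φ ∧ HasCompactSupport φ}
  add_mem' h1 h2 := ⟨h1.1.add h2.1, h1.2.add h2.2⟩
  zero_mem' := ⟨contDiff_const, HasCompactSupport.zero⟩
  smul_mem' c _ h := ⟨h.1.const_smul c, h.2.smul_left⟩

lemma testFunctions.memLp (μ : Measure ℂ) [IsLocallyFiniteMeasure μ] (φ : testFunctions) :
    MemLp (φ : ℂ → ℂ) 2 μ :=
  φ.2.1.continuous.memLp_of_hasCompactSupport φ.2.2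

/-- The inclusion of test functions into `L²(μ)`. -/
def testFunctionsToLp (μ : Measure ℂ) [IsLocallyFiniteMeasure μ] :
    testFunctions →ₗ[ℂ] Lp ℂ 2 μ where
  toFun φ := (testFunctions.memLp μ φ).toLp φ
  map_add' φ ψ := MemLp.toLp_add (testFunctions.memLp μ φ) (testFunctions.memLp μ ψ)
  map_smul' c φ := MemLp.toLp_const_smul c (testFunctions.memLp μ φ)

/-- The Beurling transform on test functions, with values in `L²(μ)`. -/
def beurlingToLp (μ : Measure ℂ) (h : ∀ φ : testFunctions, MemLp (beurling φ) 2 μ) :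
    testFunctions →ₗ[ℂ] Lp ℂ 2 μ where
  toFun φ := (h φ).toLp (beurling φ)
  map_add' φ ψ := by
    rw [← MemLp.toLp_add (h φ) (h ψ)]
    exact MemLp.toLp_congr _ _ (Eventually.of_forall fun x =>
      congrFun (beurling_add φ.2.1 φ.2.2 ψ.2.1 ψ.2.2) x)
  map_smul' c φ := by
    rw [RingHom.id_apply, ← MemLp.toLp_const_smul c (h φ)]
    exact MemLp.toLp_congr _ _ (Eventually.of_forall fun x =>
      congrFun (beurling_smul φ.2.1 φ.2.2 c) x)

lemma norm_testFunctionsToLp (μ : Measure ℂ) [IsLocallyFiniteMeasure μ] (φ : testFunctions) :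
    ‖testFunctionsToLp μ φ‖ = (eLpNorm (φ : ℂ → ℂ) 2 μ).toReal :=
  Lp.norm_toLp _ (testFunctions.memLp μ φ)

lemma norm_beurlingToLp {μ : Measure ℂ} (h : ∀ φ : testFunctions, MemLp (beurling φ) 2 μ)
    (φ : testFunctions) : ‖beurlingToLp μ h φ‖ = (eLpNorm (beurling φ) 2 μ).toReal :=
  Lp.norm_toLp _ (h φ)

lemma coeFn_beurlingToLp {μ : Measure ℂ} (h : ∀ φ : testFunctions, MemLp (beurling φ) 2 μ)
    (φ : testFunctions) : beurlingToLp μ h φ =ᵐ[μ] beurling φ :=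
  MemLp.coeFn_toLp (h φ)

lemma denseRange_testFunctionsToLp (μ : Measure ℂ) [IsLocallyFiniteMeasure μ] :
    DenseRange (testFunctionsToLp μ) := by
  refine (Lp.dense_hasCompactSupport_contDiff (F := ℂ) (μ := μ) (p := 2) (by norm_num)).mono ?_
  rintro f ⟨g, hfg, hgc, hg⟩
  refine ⟨⟨g, hg, hgc⟩, Lp.ext ?_⟩
  exact (MemLp.coeFn_toLp (testFunctions.memLp μ ⟨g, hg, hgc⟩)).trans hfg.symm

end

theorem theorem2p3 :
    ∃ C : ℝ, 0 < C ∧ ∀ w : ℂ → ℝ, IsA2Weight w →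
      ∃ S : Lp ℂ 2 (weightMeasure w) →L[ℂ] Lp ℂ 2 (weightMeasure w),
        IsBeurlingOperator w S ∧
        (∀ S' : Lp ℂ 2 (weightMeasure w) →L[ℂ] Lp ℂ 2 (weightMeasure w),
          IsBeurlingOperator w S' → S' = S) ∧
        ‖S‖ ≤ C * (a2Characteristic w).toReal := by
  obtain ⟨C, hC0, hC⟩ := exists_eLpNorm_beurling_le
  refine ⟨C, by exact_mod_cast hC0, fun w hw => ?_⟩
  obtain ⟨W, hW, hμ⟩ := hw.exists_isA2Density
  set K := a2Characteristic w with hK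
  have hKt : K ≠ ⊤ := hw.finite.ne
  set μ := weightMeasure w with hμdef
  have : IsLocallyFiniteMeasure μ := by rw [hμ]; exact hW.isLocallyFiniteMeasure
  have hle : ∀ φ : testFunctions, eLpNorm (beurling φ) 2 μ ≤ C * K * eLpNorm (φ : ℂ → ℂ) 2 μ := by
    intro φ
    have := hC W K hW φ φ.2.1 φ.2.2
    rwa [← hμ] at this
  have hCK : (C : ℝ≥0∞) * K ≠ ⊤ := ENNReal.mul_ne_top ENNReal.coe_ne_top hKt
  have memB : ∀ φ : testFunctions, MemLp (beurling φ) 2 μ := fun φ =>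
    ⟨(measurable_beurling φ.2.1 φ.2.2).aestronglyMeasurable,
      (hle φ).trans_lt (ENNReal.mul_lt_top hCK.lt_top (testFunctions.memLp μ φ).2)⟩
  have hdense := denseRange_testFunctionsToLp μ
  have hnorm : ∀ φ, ‖beurlingToLp μ memB φ‖ ≤ C * K.toReal * ‖testFunctionsToLp μ φ‖ := by
    intro φ
    rw [norm_beurlingToLp, norm_testFunctionsToLp]
    refine (ENNReal.toReal_mono (ENNReal.mul_ne_top hCK (testFunctions.memLp μ φ).2.ne)
      (hle φ)).trans_eq ?_
    rw [ENNReal.toReal_mul, ENNReal.toReal_mul, ENNReal.coe_toReal]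
  -- Test functions are dense in `L²(μ)` because the weighted measure is locally finite. The
  -- estimate `hnorm` therefore yields a bounded extension with the same constant, and any operator
  -- with the prescribed values on test functions coincides with it.
  refine ⟨(beurlingToLp μ memB).extendOfNorm (testFunctionsToLp μ), ?_, ?_, ?_⟩
  · intro φ hφ hφc
    refine ⟨fun z => tendsto_truncatedBeurling hφ hφc z, testFunctions.memLp μ ⟨φ, hφ, hφc⟩, ?_⟩
    have h := LinearMap.extendOfNorm_eq hdense ⟨_, hnorm⟩ ⟨φ, hφ, hφc⟩
    change (beurlingToLp μ memB).extendOfNorm (testFunctionsToLp μ)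
      (testFunctionsToLp μ ⟨φ, hφ, hφc⟩) =ᵐ[μ] beurling φ
    rw [h]
    exact coeFn_beurlingToLp memB ⟨φ, hφ, hφc⟩
  · intro S' hS'
    refine (LinearMap.extendOfNorm_unique hdense _ hnorm S' ?_).symm
    refine LinearMap.ext fun φ => ?_
    obtain ⟨-, hmem, hS⟩ := hS' φ φ.2.1 φ.2.2
    exact Lp.ext (hS.trans (coeFn_beurlingToLp memB φ).symm)
  · exact LinearMap.opNorm_extendOfNorm_le hdense (by positivity) hnorm
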